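/- **Setting.** Let $\lambda=(\lambda_1\ge\lambda_2\ge\cdots\ge 0)$ be a finite Young diagram of length $\ell(\lambda)$ (the number of positive $\lambda_i$), with cells $(i,j)$, $1\le j\le\lambda_i$. A *Poissonized Young tableau* of shape $\lambda$ is a function $T$ from the cells of $\lambda$ to $[0,1]$ with $T(i,j)\le T(i,j+1)$ and $T(i,j)\le T(i+1,j)$ whenever both cells lie in $\lambda$; a *uniformly random* one has as its law the normalized Lebesgue measure on the set of these functions in $[0,1]^{\lambda}$. For $i\ge1$ and $t\in[0,1]$ put a particle at the half-integer $p_i(t)=\#\{j: T(i,j)\le t\}-i+\tfrac12$. The *jumps* of $T$ are the points $(x,t)\in\mathbb Z\times[0,1]$ for which, for some $i$, the integer $x$ lies between the position of the $i$-th particle immediately before time $t$ (which is $-i+\frac12$ if $t=0$) and $p_i(t)$; they are counted with multiplicity over $i$. Let $\mathcal X_\lambda$ be the point process of jumps of a uniformly random Poissonized Young tableau of shape $\lambda$. A point process $\mathcal X$ on a space $S$ is *determinantal* with kernel $K:S\times S\to\mathbb R$ and reference measure $\mu$ (a Radon measure) if it is almost surely simple and, for every $k$ and every continuous compactly supported $f:S^k\to\mathbb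 R$, $$\mathbb E\Big[\sum_{\substack{(p_1,\dots,p_k)\in\mathcal X^k\\ \text{distinct}}} f(p_1,\dots,p_k)\Big]=\int_{S^k}\det\big[K(p_i,p_j)\big]\,f(p_1,\dots,p_k)\,\mu^{\otimes k}(dp_1,\dots,dp_k),$$ both sides converging absolutely. **Theorem 1.3 (Poissonized tableaux).** Let $n\ge\ell(\lambda)$ be an integer. Then $\mathcal X_\lambda$ is a determinantal point process on $\mathbb Z\times[0,1]$, with reference measure the product of counting measure and Lebesgue measure, and with the real-valued correlation kernel $$K_\lambda(x_1,t_1;x_2,t_2)=\mathbf 1_{\{t_2>t_1,\;x_1>x_2\}}\frac{(t_1-t_2)^{x_1-x_2-1}}{(x_1-x_2-1)!}+\frac1{(2\pi\mathbf i)^2}\oint_{C_z}dz\oint_{C_w}dw\;\frac{\Gamma(-w)}{\Gamma(z+1)}\cdot\frac{G_\lambda(z+x_2)}{G_\lambda(x_1-1-w)}\cdot\frac{(1-t_2)^z(1-t_1)^w}{w+z+x_2-x_1+1},$$ where, for $u\in\mathbb C\setminus\mathbb Z$, $$G_\lambda(u)=\Gamma(u+1)\prod_{i=1}^\infty\frac{u+i}{u-\lambda_i+i}=\frac{\Gamma(u+1+n)}{\prod_{i=1}^n(u-\lambda_i+i)}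 .$$ Here, for each pair $x_1,x_2\in\mathbb Z$, $C_z=C_z[0,\lambda_1-x_2)$ and $C_w=C_w[0,n+x_1)$ are any contours (finite, possibly empty, unions of closed piecewise $C^1$ curves in $\mathbb C\setminus\mathbb Z$) such that 1. $C_z$ has winding number $1$ around each integer of $[0,\lambda_1-x_2)$ and $0$ around every other integer, and $C_w$ has winding number $1$ around each integer of $[0,n+x_1)$ and $0$ around every other integer; 2. $w+z+x_2-x_1+1$ is bounded away from $0$ for $z\in C_z$, $w\in C_w$; 3. for every $z\in C_z$, the contour $C_w$ has winding number $0$ around the zero $w=x_1-x_2-1-z$ of this expression. Such contours exist for all $x_1,x_2$ (for example, circles of radius $\frac13$ for $C_z$ and of radius $\frac14$ for $C_w$ around the integers to be enclosed). When $t_1$ or $t_2$ equals $1$, the double integral is understood as its limit from $[0,1)\times[0,1)$; these limits exist. -/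

import Mathlib

open Set Filter Topology MeasureTheory
open scoped unitInterval ENNReal

namespace PYT

noncomputable section

/-! ### Point processes and determinantal point processes

A random discrete multiset of points of `S` is given by its multiplicity function
`X : Ω → S → ℕ`. -/

/-- `X` is a point process on `S` defined on the probability space `(Ω, P)`: every realization is
a locally finite multiset, and the number of points in each Borel set (counted with
multiplicity) is a random variable. -/
structure IsPointProcess {Ω S : Type*} [MeasurableSpace Ω] [TopologicalSpace S]
    [MeasurableSpace S] (P : Measure Ω) (X : Ω → S → ℕ) : Prop where
  isProbabilityMeasure : IsProbabilityMeasure P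
  locallyFinite : ∀ ω, ∀ C : Set S, IsCompact C → (Function.support (X ω) ∩ C).Finite
  measurable_count : ∀ B : Set S, MeasurableSet B →
    Measurable fun ω => ∑' s : B, (X ω (s : S) : ℝ≥0∞)

/-- The sum of `f (p 0, …, p (k-1))` over all `k`-tuples of pairwise distinct points of the
configuration with multiplicity function `m`. -/
def distinctSum {S : Type*} (m : S → ℕ) (k : ℕ) (f : (Fin k → S) → ℝ) : ℝ :=
  ∑ᶠ (p : Fin k → S) (_ : Function.Injective p), (∏ i, (m (p i) : ℝ)) * f p

/-- `X` is a determinantal point process on `S` with correlation kernel `K` and reference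
measure `ν`: it is an almost surely simple point process, `ν` is a Radon measure, and for all `k`
and all continuous compactly supported `f : S ^ k → ℝ`,
`E ∑ f (p 1, …, p k) = ∫ det [K (p i) (p j)] f (p 1, …, p k) dν^k`, the sum being over tuples of
distinct points of `X`; both sides are required to converge absolutely. -/
structure IsDeterminantal {Ω S : Type*} [MeasurableSpace Ω] [TopologicalSpace S]
    [MeasurableSpace S] (P : Measure Ω) (X : Ω → S → ℕ) (K : S → S → ℝ) (ν : Measure S) :
    Prop where
  isPointProcess : IsPointProcess P X
  simple : ∀ᵐ ω ∂P, ∀ s, X ω s ≤ 1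
  radon : ν.Regular
  correlation : ∀ (k : ℕ) (f : (Fin k → S) → ℝ), Continuous f → HasCompactSupport f →
    Integrable (fun ω => distinctSum (X ω) k f) P ∧
    Integrable (fun p : Fin k → S => (Matrix.of fun i j => K (p i) (p j)).det * f p)
      (Measure.pi fun _ => ν) ∧
    ∫ ω, distinctSum (X ω) k f ∂P =
      ∫ p : Fin k → S, (Matrix.of fun i j => K (p i) (p j)).det * f p ∂(Measure.pi fun _ => ν)

/-! ### Poissonized Young tableaux and their jumps

Rows and columns of a `YoungDiagram` are numbered from `0`, so that the part `λ_(i+1)` is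
`lam.rowLen i` and the length of `λ` is `lam.colLen 0`. -/

/-- The Poissonized Young tableaux of shape `lam`: fillings of the cells with numbers of `[0,1]`
that are weakly increasing along rows and along columns. -/
def tableaux (lam : YoungDiagram) : Set (lam.cells → I) :=
  {T | (∀ (i j : ℕ) (h : (i, j) ∈ lam.cells) (h' : (i, j + 1) ∈ lam.cells),
          T ⟨(i, j), h⟩ ≤ T ⟨(i, j + 1), h'⟩) ∧
       (∀ (i j : ℕ) (h : (i, j) ∈ lam.cells) (h' : (i + 1, j) ∈ lam.cells),
          T ⟨(i, j), h⟩ ≤ T ⟨(i + 1, j), h'⟩)}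

/-- The law of a uniformly random Poissonized Young tableau: normalized Lebesgue measure on the
set `tableaux lam ⊆ [0,1]^λ`. -/
def uniformTableau (lam : YoungDiagram) : Measure (tableaux lam) :=
  ((volume : Measure (lam.cells → I)) (tableaux lam))⁻¹ •
    (volume : Measure (lam.cells → I)).comap Subtype.val

/-- The number of entries `≤ t` in row `i` of `T`, i.e. the length of row `i` of the Young diagram
filled by the entries `≤ t`. -/
def rowCount {lam : YoungDiagram} (T : lam.cells → I) (i : ℕ) (t : ℝ) : ℕ :=
  Nat.card {c : lam.cells // (c : ℕ × ℕ).1 = i ∧ (T c : ℝ) ≤ t}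

/-- The position at time `t` of the `(i+1)`-st particle, a half-integer: `λ_(i+1) - (i+1) + 1/2` for
the diagram filled by the entries `≤ t`. -/
def particle {lam : YoungDiagram} (T : lam.cells → I) (i : ℕ) (t : ℝ) : ℝ :=
  (rowCount T i t : ℝ) - ((i : ℝ) + 1) + 1 / 2

/-- `(x, t)` is a jump of the particle number `i`: the integer `x` lies between the positions of
the particle immediately before time `t` and at time `t`. -/
def IsJump {lam : YoungDiagram} (T : lam.cells → I) (i : ℕ) (s : ℤ × I) : Prop :=
  (s.1 : ℝ) ∈ Icc (Function.leftLim (particle T i) (s.2 : ℝ)) (particle T i (s.2 : ℝ))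

/-- The multiset of jumps of `T`: the multiplicity of `s` is the number of particles of which `s`
is a jump. -/
def jumps {lam : YoungDiagram} (T : tableaux lam) (s : ℤ × I) : ℕ :=
  {i : ℕ | IsJump T.1 i s}.ncard

/-! ### Contours -/

/-- A closed piecewise continuously differentiable curve in `ℂ`, parametrized by `[0,1]`. -/
structure ClosedCurve where
  toFun : ℝ → ℂ
  continuousOn : ContinuousOn toFun (Icc 0 1)
  closed : toFun 0 = toFun 1
  piecewise : ∃ (s : Finset ℝ) (M : ℝ), ∀ t ∈ Ioo (0 : ℝ) 1, t ∉ s →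
    DifferentiableAt ℝ toFun t ∧ ContinuousAt (deriv toFun) t ∧ ‖deriv toFun t‖ ≤ M

/-- A contour: a finite (possibly empty) union of closed curves. -/
abbrev Contour := List ClosedCurve

/-- The points on a contour. -/
def Contour.trace (C : Contour) : Set ℂ := {z | ∃ γ ∈ C, z ∈ γ.toFun '' Icc 0 1}

/-- The contour integral `∮_C f(z) dz`. -/
def Contour.integral (C : Contour) (f : ℂ → ℂ) : ℂ :=
  (C.map fun γ : ClosedCurve => ∫ t in (0 : ℝ)..1, f (γ.toFun t) * deriv γ.toFun t).sum

/-- The winding number of `C` about the point `a`. -/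
def Contour.winding (C : Contour) (a : ℂ) : ℂ :=
  (2 * Real.pi * Complex.I)⁻¹ * Contour.integral C fun z => (z - a)⁻¹

/-- `C` is a contour `C[a,b)`: it avoids the integers, winds once counter-clockwise around each
integer of `[a,b)` and does not wind around the other integers. -/
def Contour.Encloses (C : Contour) (a b : ℤ) : Prop :=
  (∀ k : ℤ, (k : ℂ) ∉ Contour.trace C) ∧
  (∀ k ∈ Ico a b, Contour.winding C (k : ℂ) = 1) ∧
  (∀ k : ℤ, k ∉ Ico a b → Contour.winding C (k : ℂ) = 0)

/-- `Cz`, `Cw` are contours `C_z[0, λ₁ - x₂)` and `C_w[0, n + x₁)` along which `w + z + x₂ - x₁ + 1`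
is bounded away from `0`, arranged so that the `w`-contour does not enclose the zero
`w = x₁ - x₂ - 1 - z` of this expression, for any `z` on the `z`-contour. -/
def Admissible (lam : YoungDiagram) (n : ℕ) (x₁ x₂ : ℤ) (Cz Cw : Contour) : Prop :=
  Contour.Encloses Cz 0 ((lam.rowLen 0 : ℤ) - x₂) ∧
  Contour.Encloses Cw 0 ((n : ℤ) + x₁) ∧
  (∃ δ > (0 : ℝ), ∀ z ∈ Contour.trace Cz, ∀ w ∈ Contour.trace Cw,
    δ ≤ ‖w + z + (x₂ : ℂ) - (x₁ : ℂ) + 1‖) ∧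
  (∀ z ∈ Contour.trace Cz, Contour.winding Cw ((x₁ : ℂ) - (x₂ : ℂ) - 1 - z) = 0)

/-! ### The kernel -/

/-- `G_λ(u) = Γ(u+1+n) / ∏_{i=1}^n (u - λ_i + i)`. -/
def G (lam : YoungDiagram) (n : ℕ) (u : ℂ) : ℂ :=
  Complex.Gamma (u + 1 + n) / ∏ i ∈ Finset.range n, (u - (lam.rowLen i : ℂ) + ((i : ℂ) + 1))

/-- The double contour integral in the kernel, for `t₁, t₂ < 1`. -/
def doubleIntegral (lam : YoungDiagram) (n : ℕ) (Cz Cw : Contour)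
    (x₁ : ℤ) (t₁ : ℝ) (x₂ : ℤ) (t₂ : ℝ) : ℂ :=
  ((2 * Real.pi * Complex.I) ^ 2)⁻¹ *
    Contour.integral Cz fun z => Contour.integral Cw fun w =>
      Complex.Gamma (-w) / Complex.Gamma (z + 1) *
        (G lam n (z + x₂) / G lam n ((x₁ : ℂ) - 1 - w)) *
        ((((1 - t₂ : ℝ) : ℂ) ^ z * ((1 - t₁ : ℝ) : ℂ) ^ w) /
          (w + z + (x₂ : ℂ) - (x₁ : ℂ) + 1))

/-- The double contour integral for `t₁, t₂ ∈ [0,1]`; if `t₁` or `t₂` equals `1` it is understood as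
a limit from `[0,1) × [0,1)`. -/
def doubleIntegralExt (lam : YoungDiagram) (n : ℕ) (Cz Cw : Contour)
    (x₁ : ℤ) (t₁ : ℝ) (x₂ : ℤ) (t₂ : ℝ) : ℂ :=
  open Classical in
  if t₁ < 1 ∧ t₂ < 1 then doubleIntegral lam n Cz Cw x₁ t₁ x₂ t₂
  else limUnder (𝓝[Ico (0 : ℝ) 1 ×ˢ Ico (0 : ℝ) 1] (t₁, t₂))
    fun p : ℝ × ℝ => doubleIntegral lam n Cz Cw x₁ p.1 x₂ p.2

/-- The kernel `K_λ(x₁,t₁; x₂,t₂)`, computed with contours `Cz x₁ x₂` and `Cw x₁ x₂`. -/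
def kernel (lam : YoungDiagram) (n : ℕ) (Cz Cw : ℤ → ℤ → Contour) (p q : ℤ × I) : ℂ :=
  open Classical in
  (if p.2 < q.2 ∧ q.1 < p.1 then
    (((p.2 : ℝ) - (q.2 : ℝ) : ℝ) : ℂ) ^ (p.1 - q.1 - 1).toNat /
      (((p.1 - q.1 - 1).toNat.factorial : ℕ) : ℂ)
   else 0) +
  doubleIntegralExt lam n (Cz p.1 q.1) (Cw p.1 q.1) p.1 (p.2 : ℝ) q.1 (q.2 : ℝ)

end

end PYT

namespace PYT

/-! ### Contour integrals of rational functions times entire functions -/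

/-! A particle moves exactly when a cell of its row is filled, so the jumps are the points (content
of c, T(c)), one for each cell c (`isJump_iff`, `jumps_eq`), and the entries are almost surely
distinct. It remains to find the joint densities of k of these points and to recognize them as
determinants of the kernel.

Write e_t(m) = t^m/m!, extended by 0 to m < 0. The unnormalized density of marks (x_a, s_a) is the
bordered determinant `jumpDet`: its particle block describes n paths from -1, …, -n to the positions
y of the diagram at time t, and each mark (x, s) adds a row and a column that force a step from x -
1 to x at time s. Both the integral over tableaux with entries ≤ t and the integral against this
determinant obey the same recursion on the number of cells. For tableaux, the largest entry sits at
a corner, which is erased; its point is either unmarked or the last mark. For the determinant, the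
t-derivative lowers one final position (`hasDerivAt_jumpDet`), at the time of the last mark that
mark can be traded for one lowered position (`jumpDet_at_last_mark`), and lowerings that do not
erase a corner contribute 0 (`sum_jumpDet_update`). Induction gives
`tabIntegral_eq_densityIntegral`.

At t = 1 the mark rows of the first block column are linear combinations of the particle rows: e_1(v
- m) is 1/v! times a polynomial in v of degree m < n, hence is determined by Lagrange interpolation
at the n shifted positions. Block elimination turns the bordered determinant into a constant times a
k × k determinant (`jumpDet_eq_mul_det`).

On the analytic side the Gamma functions cancel to rational functions with integer poles, multiplied
by entire exponentials. The double contour integral is therefore a finite sum of residues,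
`doubleSum`, real and polynomial in 1 - t₁ and 1 - t₂; this also settles the limits at time 1 and
the independence of the contours. By `doubleSum_eq` it equals the interpolation part of the kernel
minus e_{t₁-t₂}(x₁-1-x₂). That last term exchanges the indicator of t₂ < t₁ for that of t₁ < t₂, up
to coinciding times, which form a null set. -/

lemma ClosedCurve.mem_trace {C : Contour} {γ : ClosedCurve} (hγ : γ ∈ C) {t : ℝ}
    (ht : t ∈ Icc (0 : ℝ) 1) : γ.toFun t ∈ Contour.trace C :=
  ⟨γ, hγ, t, ht, rfl⟩

lemma ClosedCurve.intervalIntegrable_deriv (γ : ClosedCurve) :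
    IntervalIntegrable (deriv γ.toFun) volume 0 1 := by
  obtain ⟨s, M, h⟩ := γ.piecewise
  rw [intervalIntegrable_iff_integrableOn_Ioo_of_le zero_le_one]
  refine Measure.integrableOn_of_bounded (M := M) (by simp)
    (measurable_deriv _).aestronglyMeasurable ?_
  have h1 : ∀ᵐ t ∂(volume.restrict (Ioo (0 : ℝ) 1)), t ∉ (s : Set ℝ) :=
    ae_restrict_of_ae (s.finite_toSet.countable.ae_notMem volume)
  filter_upwards [h1, ae_restrict_mem measurableSet_Ioo] with t ht ht'
  exact (h t ht' (by simpa using ht)).2.2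

lemma ClosedCurve.intervalIntegrable_mul (γ : ClosedCurve) {f : ℂ → ℂ}
    (hf : ContinuousOn f (γ.toFun '' Icc 0 1)) :
    IntervalIntegrable (fun t => f (γ.toFun t) * deriv γ.toFun t) volume 0 1 := by
  refine IntervalIntegrable.continuousOn_mul γ.intervalIntegrable_deriv ?_
  rw [uIcc_of_le zero_le_one]
  exact hf.comp γ.continuousOn (mapsTo_image _ _)

/-- The fundamental theorem of calculus along the curve tolerates the finitely many exceptional
parameters, and the endpoints coincide. -/
lemma ClosedCurve.integral_deriv_eq_zero (γ : ClosedCurve) {g g' : ℂ → ℂ}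
    (hg : ∀ z ∈ γ.toFun '' Icc 0 1, HasDerivAt g (g' z) z)
    (hg' : ContinuousOn g' (γ.toFun '' Icc 0 1)) :
    ∫ t in (0 : ℝ)..1, g' (γ.toFun t) * deriv γ.toFun t = 0 := by
  obtain ⟨s, M, h⟩ := γ.piecewise
  have hc : ContinuousOn g (γ.toFun '' Icc 0 1) := fun z hz =>
    (hg z hz).continuousAt.continuousWithinAt
  have := MeasureTheory.integral_eq_of_hasDerivAt_off_countable_of_le
    (fun t => g (γ.toFun t)) (fun t => g' (γ.toFun t) * deriv γ.toFun t) zero_le_one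
    (s := (s : Set ℝ)) s.finite_toSet.countable
    (hc.comp γ.continuousOn (mapsTo_image _ _))
    (fun t ht => (hg _ (mem_image_of_mem _ (Ioo_subset_Icc_self ht.1))).comp_of_eq t
      (h t ht.1 (by simpa using ht.2)).1.hasDerivAt rfl)
    (γ.intervalIntegrable_mul hg')
  rw [this, γ.closed, sub_self]

namespace Contour

lemma integral_congr {C : Contour} {f g : ℂ → ℂ} (h : ∀ z ∈ C.trace, f z = g z) :
    C.integral f = C.integral g := by
  unfold Contour.integral
  congr 1
  refine List.map_congr_left fun γ hγ => ?_
  refine intervalIntegral.integral_congr fun t ht => ?_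
  rw [uIcc_of_le zero_le_one] at ht
  simp only [h _ (ClosedCurve.mem_trace hγ ht)]

lemma integral_const_mul (C : Contour) (a : ℂ) (f : ℂ → ℂ) :
    C.integral (fun z => a * f z) = a * C.integral f := by
  unfold Contour.integral
  rw [← List.sum_map_mul_left]
  simp only [mul_assoc, intervalIntegral.integral_const_mul]

lemma integral_add {C : Contour} {f g : ℂ → ℂ} (hf : ContinuousOn f C.trace)
    (hg : ContinuousOn g C.trace) :
    C.integral (fun z => f z + g z) = C.integral f + C.integral g := by
  unfold Contour.integral
  rw [← List.sum_map_add]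
  congr 1
  refine List.map_congr_left fun γ hγ => ?_
  have hs : γ.toFun '' Icc 0 1 ⊆ Contour.trace C := fun z hz => ⟨γ, hγ, hz⟩
  rw [← intervalIntegral.integral_add (γ.intervalIntegrable_mul (hf.mono hs))
    (γ.intervalIntegrable_mul (hg.mono hs))]
  simp only [add_mul]

lemma integral_zero (C : Contour) : C.integral (fun _ => 0) = 0 := by
  simp [Contour.integral]

lemma integral_sum {ι : Type*} (s : Finset ι) {C : Contour} {f : ι → ℂ → ℂ}
    (hf : ∀ i ∈ s, ContinuousOn (f i) C.trace) :
    C.integral (fun z => ∑ i ∈ s, f i z) = ∑ i ∈ s, C.integral (f i) := by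
  classical
  induction s using Finset.induction_on with
  | empty => simp [integral_zero]
  | insert a s ha ih =>
    simp only [Finset.sum_insert ha]
    rw [integral_add (hf a (Finset.mem_insert_self a s))
      (continuousOn_finsetSum _ fun i hi => hf i (Finset.mem_insert_of_mem hi)),
      ih fun i hi => hf i (Finset.mem_insert_of_mem hi)]

/-- Cauchy's theorem. -/
lemma integral_entire (C : Contour) {f : ℂ → ℂ} (hf : Differentiable ℂ f) : C.integral f = 0 := by
  obtain ⟨g, hg⟩ := hf.isExactOn_univ
  refine List.sum_eq_zero fun x hx => ?_
  obtain ⟨γ, -, rfl⟩ := List.mem_map.1 hx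
  exact γ.integral_deriv_eq_zero (fun z _ => hg z (mem_univ z)) hf.continuous.continuousOn

/-- Cauchy's integral formula. -/
lemma integral_entire_div {C : Contour} {f : ℂ → ℂ} (hf : Differentiable ℂ f) {a : ℂ}
    (ha : a ∉ C.trace) :
    C.integral (fun z => f z / (z - a)) = 2 * Real.pi * Complex.I * (C.winding a * f a) := by
  have h1 : Differentiable ℂ (dslope f a) := by
    rw [← differentiableOn_univ] at hf ⊢
    exact (Complex.differentiableOn_dslope univ_mem).2 hf
  have hne : ∀ z ∈ C.trace, z - a ≠ 0 := fun z hz h => ha (sub_eq_zero.1 h ▸ hz)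
  -- Removing the pole leaves the difference quotient of f at a, which is entire and integrates to
  -- 0; no deformation of contours is needed.
  have h2 : ∀ z ∈ C.trace, f z / (z - a) = dslope f a z + f a * (z - a)⁻¹ := by
    intro z hz
    rw [dslope_of_ne _ (sub_ne_zero.1 (hne z hz)), slope_def_field]
    field_simp [hne z hz]
    ring
  rw [integral_congr h2, integral_add h1.continuous.continuousOn, integral_entire C h1, zero_add,
    integral_const_mul, Contour.winding]
  · have : (2 * Real.pi * Complex.I : ℂ) ≠ 0 := by simp [Real.pi_ne_zero]
    field_simp
  · exact continuousOn_const.mul ((continuousOn_id.sub continuousOn_const).inv₀ hne)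

end Contour

/-- The partial fraction decomposition of the inverse of a product of distinct linear factors. -/
lemma inv_prod_sub_eq_sum {ι : Type*} [DecidableEq ι] (S : Finset ι) (v : ι → ℂ)
    (hv : Set.InjOn v S) (hS : S.Nonempty) {z : ℂ} (hz : ∀ i ∈ S, z - v i ≠ 0) :
    (∏ i ∈ S, (z - v i))⁻¹ = ∑ i ∈ S, (∏ j ∈ S.erase i, (v i - v j))⁻¹ * (z - v i)⁻¹ := by
  -- The Lagrange basis polynomials sum to 1, and each of them at z is the full product times one
  -- partial fraction.
  have h := congrArg (Polynomial.eval z) (Lagrange.sum_basis hv hS)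
  rw [Polynomial.eval_finsetSum, Polynomial.eval_one] at h
  have h2 : ∀ i ∈ S, Polynomial.eval z (Lagrange.basis S v i) =
      (∏ i ∈ S, (z - v i)) * ((∏ j ∈ S.erase i, (v i - v j))⁻¹ * (z - v i)⁻¹) := by
    intro i hi
    rw [Lagrange.basis, Polynomial.eval_prod, ← Finset.mul_prod_erase S _ hi]
    simp only [Lagrange.basisDivisor, Polynomial.eval_mul, Polynomial.eval_C, Polynomial.eval_sub,
      Polynomial.eval_X, Finset.prod_mul_distrib, Finset.prod_inv_distrib]
    field_simp [hz i hi]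
  rw [Finset.sum_congr rfl h2, ← Finset.mul_sum] at h
  exact (eq_inv_of_mul_eq_one_right h).symm

/-- The residue theorem for an entire function divided by distinct linear factors. -/
lemma Contour.integral_entire_div_prod {ι : Type*} [DecidableEq ι] {C : Contour} {f : ℂ → ℂ}
    (hf : Differentiable ℂ f) (S : Finset ι) (v : ι → ℂ) (hv : Set.InjOn v S)
    (hC : ∀ i ∈ S, v i ∉ C.trace) :
    C.integral (fun z => f z / ∏ i ∈ S, (z - v i)) =
      2 * Real.pi * Complex.I *
        ∑ i ∈ S, C.winding (v i) * (f (v i) / ∏ j ∈ S.erase i, (v i - v j)) := by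
  rcases S.eq_empty_or_nonempty with rfl | hS
  · simpa using integral_entire C hf
  have hne : ∀ z ∈ C.trace, ∀ i ∈ S, z - v i ≠ 0 := fun z hz i hi h =>
    hC i hi (sub_eq_zero.1 h ▸ hz)
  have h1 : ∀ z ∈ C.trace, f z / ∏ i ∈ S, (z - v i) =
      ∑ i ∈ S, (∏ j ∈ S.erase i, (v i - v j))⁻¹ * (f z / (z - v i)) := by
    intro z hz
    rw [div_eq_mul_inv, inv_prod_sub_eq_sum S v hv hS (hne z hz), Finset.mul_sum]
    exact Finset.sum_congr rfl fun i _ => by ring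
  rw [integral_congr h1, integral_sum, Finset.mul_sum]
  · refine Finset.sum_congr rfl fun i hi => ?_
    rw [integral_const_mul, integral_entire_div hf (hC i hi)]
    ring
  · intro i hi
    exact continuousOn_const.mul (hf.continuous.continuousOn.div
      (continuousOn_id.sub continuousOn_const) fun z hz => hne z hz i hi)

/-! ### Circles around integers -/

/-- The positively oriented circle. -/
noncomputable def circleCurve (c : ℂ) (r : ℝ) : ClosedCurve where
  toFun t := circleMap c r (2 * Real.pi * t)
  continuousOn := by
    have := continuous_circleMap c r
    fun_prop
  closed := by simp [circleMap, Complex.exp_two_pi_mul_I]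
  piecewise := by
    have hd : ∀ t : ℝ, HasDerivAt (fun t : ℝ => circleMap c r (2 * Real.pi * t))
        (((2 * Real.pi : ℝ) : ℂ) * (circleMap 0 r (2 * Real.pi * t) * Complex.I)) t := fun t => by
      have := (hasDerivAt_circleMap c r (2 * Real.pi * t)).scomp t
        ((hasDerivAt_id t).const_mul (2 * Real.pi))
      simpa [Function.comp_def] using this
    have hd' : deriv (fun t : ℝ => circleMap c r (2 * Real.pi * t)) = fun t =>
        ((2 * Real.pi : ℝ) : ℂ) * (circleMap 0 r (2 * Real.pi * t) * Complex.I) :=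
      funext fun t => (hd t).deriv
    refine ⟨∅, 2 * Real.pi * |r|, fun t _ _ => ⟨(hd t).differentiableAt, ?_, ?_⟩⟩
    · rw [hd']
      have := continuous_circleMap 0 r
      fun_prop
    · rw [hd']
      simp [abs_of_pos Real.pi_pos]

lemma circleCurve_norm_sub (c : ℂ) {r : ℝ} (hr : 0 ≤ r) (t : ℝ) :
    ‖(circleCurve c r).toFun t - c‖ = r := by
  simp [circleCurve, abs_of_nonneg hr]

lemma circleCurve_integral (c : ℂ) (r : ℝ) (f : ℂ → ℂ) :
    ∫ t in (0 : ℝ)..1, f ((circleCurve c r).toFun t) * deriv (circleCurve c r).toFun t =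
      ∮ z in C(c, r), f z := by
  have hd : deriv (circleCurve c r).toFun = fun t : ℝ =>
      ((2 * Real.pi : ℝ) : ℂ) * deriv (circleMap c r) (2 * Real.pi * t) := by
    funext t
    have := (hasDerivAt_circleMap c r (2 * Real.pi * t)).scomp t
        ((hasDerivAt_id t).const_mul (2 * Real.pi))
    have h2 : HasDerivAt (circleCurve c r).toFun _ t := this
    rw [h2.deriv, (hasDerivAt_circleMap c r (2 * Real.pi * t)).deriv]
    simp
  have := intervalIntegral.smul_integral_comp_mul_left (a := 0) (b := 1)
    (fun θ => deriv (circleMap c r) θ • f (circleMap c r θ)) (2 * Real.pi)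
  rw [mul_zero, mul_one] at this
  rw [circleIntegral, ← this, hd, ← intervalIntegral.integral_smul]
  refine intervalIntegral.integral_congr fun t _ => ?_
  simp only [circleCurve, smul_eq_mul, Complex.real_smul]
  ring

/-- Circles of radius `r` around the integers of `[0, b)`. -/
noncomputable def circles (b : ℤ) (r : ℝ) : Contour :=
  (List.range b.toNat).map fun k : ℕ => circleCurve (k : ℂ) r

lemma circles_trace {b : ℤ} {r : ℝ} (hr : 0 ≤ r) {z : ℂ} (hz : z ∈ (circles b r).trace) :
    ∃ k : ℤ, ‖z - k‖ = r := by
  obtain ⟨γ, hγ, t, -, rfl⟩ := hz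
  obtain ⟨k, -, rfl⟩ := List.mem_map.1 hγ
  exact ⟨k, by simpa using circleCurve_norm_sub (k : ℂ) hr t⟩

lemma circles_winding (b : ℤ) (r : ℝ) (a : ℂ) :
    (circles b r).winding a = ∑ k ∈ Finset.range b.toNat,
      (2 * Real.pi * Complex.I)⁻¹ * ∮ z in C((k : ℂ), r), (z - a)⁻¹ := by
  rw [Contour.winding, Contour.integral, circles, List.map_map, ← Finset.mul_sum]
  congr 1
  rw [Finset.sum, Finset.range_val, Multiset.range, Multiset.map_coe, Multiset.sum_coe]
  congr 1
  exact List.map_congr_left fun k _ => circleCurve_integral (k : ℂ) r fun z => (z - a)⁻¹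

lemma circleIntegral_sub_inv_of_lt {c a : ℂ} {r : ℝ} (hr : 0 ≤ r) (h : r < ‖a - c‖) :
    ∮ z in C(c, r), (z - a)⁻¹ = 0 := by
  refine Complex.circleIntegral_eq_zero_of_differentiable_on_off_countable hr
    (s := ∅) (by simp) ?_ ?_
  · refine (continuousOn_id.sub continuousOn_const).inv₀ fun z hz h0 => ?_
    have h0 := sub_eq_zero.1 h0
    dsimp only [id] at h0
    subst h0
    exact absurd (mem_closedBall_iff_norm.1 hz) (not_le.2 h)
  · intro z hz
    refine (differentiableAt_id.sub_const a).inv fun h0 => ?_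
    have h0 := sub_eq_zero.1 h0
    dsimp only [id] at h0
    subst h0
    exact absurd (mem_ball_iff_norm.1 hz.1) (not_lt.2 h.le)

lemma circles_winding_eq_zero {b : ℤ} {r : ℝ} (hr : 0 ≤ r) {a : ℂ}
    (h : ∀ k : ℤ, k ∈ Ico 0 b → r < ‖a - k‖) : (circles b r).winding a = 0 := by
  rw [circles_winding]
  refine Finset.sum_eq_zero fun k hk => ?_
  rw [Finset.mem_range] at hk
  rw [circleIntegral_sub_inv_of_lt hr (by simpa using h k ⟨by lia, by lia⟩), mul_zero]

lemma one_le_norm_intCast_sub {j k : ℤ} (h : j ≠ k) : (1 : ℝ) ≤ ‖(j : ℂ) - k‖ := by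
  rw [← Int.cast_sub, Complex.norm_intCast]
  exact_mod_cast Int.one_le_abs (sub_ne_zero.2 h)

lemma circles_encloses (b : ℤ) {r : ℝ} (hr : 0 < r) (hr1 : r < 1) :
    (circles b r).Encloses 0 b := by
  refine ⟨fun k hk => ?_, fun k hk => ?_, fun k hk => ?_⟩
  · obtain ⟨j, hj⟩ := circles_trace hr.le hk
    rcases eq_or_ne k j with rfl | h
    · simp at hj; linarith
    · linarith [one_le_norm_intCast_sub h]
  · rw [circles_winding, Finset.sum_eq_single k.toNat]
    · have : ((k.toNat : ℕ) : ℂ) = (k : ℂ) := by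
        rw [← Int.cast_natCast, Int.toNat_of_nonneg hk.1]
      rw [this, circleIntegral.integral_sub_inv_of_mem_ball (Metric.mem_ball_self hr)]
      exact inv_mul_cancel₀ (by simp [Real.pi_ne_zero])
    · intro j hj hjk
      have : (j : ℤ) ≠ k := by rintro rfl; simp at hjk
      have h2 := one_le_norm_intCast_sub this.symm
      rw [circleIntegral_sub_inv_of_lt hr.le (by simpa using hr1.trans_le h2), mul_zero]
    · intro h
      rw [Finset.mem_range] at h
      have := hk.1
      have := hk.2
      lia
  · exact circles_winding_eq_zero hr.le fun j hj =>
      hr1.trans_le (one_le_norm_intCast_sub (by rintro rfl; exact hk hj))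

/-- On these circles z and w have distances 1/3 and 1/4 from some integers, so w + z plus any
integer has modulus at least min(1/3 - 1/4, 1 - 7/12) = 1/12. The zero x₁ - x₂ - 1 - z stays at
distance at least 1/3 from every integer, hence outside the w-circles. -/
lemma exists_admissible (lam : YoungDiagram) (n : ℕ) (x₁ x₂ : ℤ) :
    ∃ Cz Cw : Contour, Admissible lam n x₁ x₂ Cz Cw := by
  refine ⟨circles _ (1 / 3), circles _ (1 / 4), circles_encloses _ (by norm_num) (by norm_num),
    circles_encloses _ (by norm_num) (by norm_num), ⟨1 / 12, by norm_num, ?_⟩, ?_⟩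
  · intro z hz w hw
    obtain ⟨j, hj⟩ := circles_trace (by norm_num) hz
    obtain ⟨k, hk⟩ := circles_trace (by norm_num) hw
    have e : w + z + (x₂ : ℂ) - x₁ + 1 =
        ((z - j) + (w - k)) + ((j + k + x₂ - x₁ + 1 : ℤ) : ℂ) := by push_cast; ring
    rw [e]
    have h1 : ‖(z - j) + (w - k)‖ ≤ 1 / 3 + 1 / 4 := (norm_add_le _ _).trans (by rw [hj, hk])
    have h2 : 1 / 3 - 1 / 4 ≤ ‖(z - j) + (w - k)‖ := by
      have := norm_sub_le_norm_add (z - j) (w - k)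
      rwa [hj, hk] at this
    rcases eq_or_ne (j + k + x₂ - x₁ + 1) 0 with h0 | h0
    · rw [h0, Int.cast_zero, add_zero]; linarith
    · have h3 := one_le_norm_intCast_sub h0
      rw [Int.cast_zero, sub_zero] at h3
      have := norm_sub_le_norm_add ((j + k + x₂ - x₁ + 1 : ℤ) : ℂ) ((z - j) + (w - k))
      rw [add_comm]
      linarith
  · intro z hz
    obtain ⟨j, hj⟩ := circles_trace (by norm_num) hz
    refine circles_winding_eq_zero (by norm_num) fun k _ => ?_
    have e : (x₁ : ℂ) - x₂ - 1 - z - k = -(z - j) + ((x₁ - x₂ - 1 - j - k : ℤ) : ℂ) := by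
      push_cast; ring
    rw [e]
    rcases eq_or_ne (x₁ - x₂ - 1 - j - k) 0 with h0 | h0
    · rw [h0, Int.cast_zero, add_zero, norm_neg, hj]; norm_num
    · have h3 := one_le_norm_intCast_sub h0
      rw [Int.cast_zero, sub_zero] at h3
      have := norm_sub_le_norm_add ((x₁ - x₂ - 1 - j - k : ℤ) : ℂ) (-(z - j))
      rw [norm_neg, hj] at this
      rw [add_comm]
      linarith

/-! ### The function `G` -/

lemma Gamma_add_natCast {z : ℂ} (hz : ∀ k : ℤ, z ≠ k) (m : ℕ) :
    Complex.Gamma (z + m) = (∏ i ∈ Finset.range m, (z + i)) * Complex.Gamma z := by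
  induction m with
  | zero => simp
  | succ m ih =>
    have h : z + m ≠ 0 := fun h => hz (-m) (by push_cast; linear_combination h)
    rw [Nat.cast_succ, ← add_assoc, Complex.Gamma_add_one _ h, ih, Finset.prod_range_succ]
    ring

lemma rowLen_eq_zero {lam : YoungDiagram} {n i : ℕ} (hn : lam.colLen 0 ≤ n) (hi : n ≤ i) :
    lam.rowLen i = 0 := by
  by_contra h
  have h1 : (i, 0) ∈ lam := YoungDiagram.mem_iff_lt_rowLen.2 (Nat.pos_of_ne_zero h)
  have := YoungDiagram.mem_iff_lt_colLen.1 h1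
  lia

/-- Rows from the n-th on are empty, so the remaining factors are 1 and the product is finite; its
numerators are absorbed into Γ(u+1+n) by the functional equation. -/
lemma exists_hasProd_G {lam : YoungDiagram} {n : ℕ} (hn : lam.colLen 0 ≤ n) {u : ℂ}
    (hu : ∀ k : ℤ, u ≠ k) : ∃ Q : ℂ,
      HasProd (fun i : ℕ => (u + ((i : ℂ) + 1)) / (u - (lam.rowLen i : ℂ) + ((i : ℂ) + 1))) Q ∧
      G lam n u = Complex.Gamma (u + 1) * Q := by
  refine ⟨_, hasProd_prod_of_ne_finset_one (s := Finset.range n) fun i hi => ?_, ?_⟩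
  · rw [rowLen_eq_zero hn (by simpa using hi), Nat.cast_zero, sub_zero]
    exact div_self fun h => hu (-(i + 1)) (by push_cast; linear_combination h)
  · have h1 : ∀ k : ℤ, u + 1 ≠ k := fun k h => hu (k - 1) (by push_cast; linear_combination h)
    rw [G, Gamma_add_natCast h1, Finset.prod_div_distrib]
    simp only [add_assoc, add_comm (1 : ℂ)]
    ring

/-! ### Coefficients of the exponential series -/

/-- The coefficient `t ^ m / m!` of `exp (t X)`, extended by zero to negative `m`. -/
noncomputable def expCoeff (t : ℝ) (m : ℤ) : ℝ :=
  if 0 ≤ m then t ^ m.toNat / (m.toNat.factorial : ℝ) else 0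

lemma expCoeff_of_neg (t : ℝ) {m : ℤ} (hm : m < 0) : expCoeff t m = 0 := if_neg (not_le.2 hm)

lemma expCoeff_natCast (t : ℝ) (m : ℕ) : expCoeff t m = t ^ m / (m.factorial : ℝ) := by
  simp [expCoeff]

lemma expCoeff_zero_right (t : ℝ) : expCoeff t 0 = 1 := by simp [expCoeff]

lemma expCoeff_zero_left (m : ℤ) : expCoeff 0 m = if m = 0 then 1 else 0 := by
  rcases lt_or_ge m 0 with h | h
  · rw [expCoeff_of_neg _ h, if_neg h.ne]
  · lift m to ℕ using h
    rw [expCoeff_natCast]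
    rcases m with _ | m
    · simp
    · rw [if_neg (by lia)]; simp

lemma hasDerivAt_expCoeff (m : ℤ) (t : ℝ) :
    HasDerivAt (fun t => expCoeff t m) (expCoeff t (m - 1)) t := by
  rcases lt_or_ge m 0 with h | h
  · simp only [expCoeff_of_neg _ h, expCoeff_of_neg _ (by lia : m - 1 < 0)]
    exact hasDerivAt_const _ _
  · lift m to ℕ using h
    rcases m with _ | m
    · simp only [Nat.cast_zero, expCoeff_zero_right, expCoeff_of_neg _ (by lia : (0 : ℤ) - 1 < 0)]
      exact hasDerivAt_const _ _
    · rw [show ((m + 1 : ℕ) : ℤ) - 1 = (m : ℕ) by push_cast; ring]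
      simp only [expCoeff_natCast]
      refine ((hasDerivAt_pow (m + 1) t).div_const _).congr_deriv ?_
      rw [Nat.factorial_succ]
      push_cast
      field_simp

lemma continuous_expCoeff (m : ℤ) : Continuous fun t => expCoeff t m :=
  continuous_iff_continuousAt.2 fun t => (hasDerivAt_expCoeff m t).continuousAt

lemma measurable_expCoeff : Measurable fun q : ℝ × ℤ => expCoeff q.1 q.2 :=
  measurable_from_prod_countable_left fun m => (continuous_expCoeff m).measurable

lemma expCoeff_add (s t : ℝ) (m : ℕ) :
    expCoeff (s + t) m = ∑ j ∈ Finset.range (m + 1), expCoeff s (m - j : ℤ) * expCoeff t j := by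
  rw [expCoeff_natCast, add_comm, add_pow, Finset.sum_div]
  refine Finset.sum_congr rfl fun j hj => ?_
  have hj : j ≤ m := Nat.lt_succ_iff.1 (Finset.mem_range.1 hj)
  rw [← Nat.cast_sub hj, expCoeff_natCast, expCoeff_natCast, Nat.cast_choose ℝ hj]
  have := Nat.factorial_ne_zero m
  field_simp

/-! ### Derivative and reduction of determinants -/

lemma hasDerivAt_det {ι : Type*} [Fintype ι] [DecidableEq ι] {M : ℝ → Matrix ι ι ℝ}
    {M' : Matrix ι ι ℝ} {t : ℝ} (h : ∀ i j, HasDerivAt (fun t => M t i j) (M' i j) t) :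
    HasDerivAt (fun t => (M t).det) (∑ i, ((M t).updateRow i (M' i)).det) t := by
  -- After transposing, the products in the permutation expansion run over rows, which is where the
  -- derivative is to act.
  simp only [← Matrix.det_transpose (M _), ← Matrix.det_transpose ((M t).updateRow _ _),
    Matrix.det_apply, Matrix.transpose_apply]
  rw [Finset.sum_comm]
  refine HasDerivAt.fun_sum fun τ _ => ?_
  rw [← Finset.smul_sum]
  refine HasDerivAt.const_smul _ ?_
  refine (HasDerivAt.fun_finsetProd fun i _ => h i (τ i)).congr_deriv ?_
  refine Finset.sum_congr rfl fun i _ => ?_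
  rw [← Finset.mul_prod_erase Finset.univ _ (Finset.mem_univ i), Matrix.updateRow_self, smul_eq_mul,
    mul_comm]
  congr 1
  refine Finset.prod_congr rfl fun j hj => ?_
  rw [Matrix.updateRow_ne (Finset.ne_of_mem_erase hj)]

/-- Expansion of a determinant along a column that vanishes off the diagonal. -/
lemma det_eq_of_column_eq_zero {n k : ℕ} (M : Matrix (Fin n ⊕ Fin (k + 1)) (Fin n ⊕ Fin (k + 1)) ℝ)
    (i : Fin (k + 1)) (h : ∀ r, r ≠ Sum.inr i → M r (Sum.inr i) = 0) :
    M.det = M (Sum.inr i) (Sum.inr i) *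
      (M.submatrix (Sum.map id i.succAbove) (Sum.map id i.succAbove)).det := by
  -- The reindexing moves `Sum.inr i` to the end, so that the matrix becomes block lower triangular
  -- with a 1 × 1 corner block.
  let e : (Fin n ⊕ Fin k) ⊕ Unit ≃ Fin n ⊕ Fin (k + 1) :=
    Equiv.ofBijective (Sum.elim (Sum.map id i.succAbove) fun _ => Sum.inr i) (by
      constructor
      · rintro ((a | a) | a) ((b | b) | b) hab <;>
          simp_all [(i.succAbove_right_injective).eq_iff, Fin.succAbove_ne, (Fin.succAbove_ne _ _).symm]
      · rintro (a | a)
        · exact ⟨Sum.inl (Sum.inl a), rfl⟩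
        · rcases eq_or_ne a i with rfl | hai
          · exact ⟨Sum.inr (), rfl⟩
          · obtain ⟨b, rfl⟩ := Fin.exists_succAbove_eq hai
            exact ⟨Sum.inl (Sum.inr b), rfl⟩)
  have he : ∀ a, e (Sum.inl a) = Sum.map id i.succAbove a := fun a => rfl
  have he' : e (Sum.inr ()) = Sum.inr i := rfl
  rw [← Matrix.det_submatrix_equiv_self e M, ← Matrix.fromBlocks_toBlocks (M.submatrix e e)]
  have h0 : (M.submatrix e e).toBlocks₁₂ = 0 := by
    ext a b
    refine h _ ?_
    rw [he]
    rcases a with a | a <;> simp [Fin.succAbove_ne]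
  rw [h0, Matrix.det_fromBlocks_zero₁₂, mul_comm]
  congr 1
  rw [Matrix.det_unique]
  rfl

/-! ### The bordered determinant -/

/-- The matrix of transition weights from the initial positions `-1, …, -n` and the marks `p` to
the positions `y` at time `t` and the marks `p`. -/
noncomputable def jumpMatrix {n k : ℕ} (y : Fin n → ℤ) (t : ℝ) (p : Fin k → ℤ × I) :
    Matrix (Fin n ⊕ Fin k) (Fin n ⊕ Fin k) ℝ :=
  Matrix.fromBlocks
    (Matrix.of fun i j => expCoeff t (y i + ((j : ℤ) + 1)))
    (Matrix.of fun i b => expCoeff (t - (p b).2) (y i - (p b).1))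
    (Matrix.of fun a j => expCoeff (p a).2 ((p a).1 - 1 + ((j : ℤ) + 1)))
    (Matrix.of fun a b => if (p b).2 < (p a).2 then
      expCoeff ((p a).2 - (p b).2) ((p a).1 - 1 - (p b).1) else 0)

/-- The unnormalized weight of the configurations of non-intersecting particles that start at
`-1, …, -n`, end at `y` at time `t` and jump at the marks `p`. -/
noncomputable def jumpDet {n k : ℕ} (y : Fin n → ℤ) (t : ℝ) (p : Fin k → ℤ × I) : ℝ :=
  (-1) ^ k * (jumpMatrix y t p).det

lemma jumpMatrix_updateRow {n k : ℕ} (y : Fin n → ℤ) (t : ℝ) (p : Fin k → ℤ × I) (i : Fin n)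
    (z : ℤ) : jumpMatrix (Function.update y i z) t p =
      (jumpMatrix y t p).updateRow (Sum.inl i) (Sum.elim (fun j : Fin n => expCoeff t (z + ((j : ℤ) + 1)))
        fun b => expCoeff (t - (p b).2) (z - (p b).1)) := by
  ext a b
  rcases a with a | a
  · rcases eq_or_ne a i with rfl | h
    · rcases b with b | b <;> simp [jumpMatrix]
    · rw [Matrix.updateRow_ne (by simpa using h)]
      rcases b with b | b <;> simp [jumpMatrix, h]
  · rw [Matrix.updateRow_ne (by simp)]
    rcases b with b | b <;> simp [jumpMatrix]

/-- Only the particle rows depend on t, and the derivative of e_t(m) is e_t(m-1); differentiating a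
row thus lowers its final position by one. -/
lemma hasDerivAt_jumpDet {n k : ℕ} (y : Fin n → ℤ) (t : ℝ) (p : Fin k → ℤ × I) :
    HasDerivAt (fun t => jumpDet y t p)
      (∑ i, jumpDet (Function.update y i (y i - 1)) t p) t := by
  have h := hasDerivAt_det (M := fun t => jumpMatrix y t p) (t := t)
    (M' := Matrix.fromBlocks
      (Matrix.of fun i j => expCoeff t (y i - 1 + ((j : ℤ) + 1)))
      (Matrix.of fun i b => expCoeff (t - (p b).2) (y i - 1 - (p b).1)) 0 0) (by
    rintro (i | a) (j | b)
    · have := hasDerivAt_expCoeff (y i + ((j : ℤ) + 1)) t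
      simpa [jumpMatrix, add_sub_right_comm] using this
    · have := (hasDerivAt_expCoeff (y i - (p b).1) (t - (p b).2)).comp_sub_const t ((p b).2 : ℝ)
      simpa [jumpMatrix, sub_right_comm] using this
    · simpa [jumpMatrix] using hasDerivAt_const _ _
    · simpa [jumpMatrix] using hasDerivAt_const _ _)
  rw [Fintype.sum_sum_type] at h
  have h0 : ∀ a : Fin k, ((jumpMatrix y t p).updateRow (Sum.inr a)
      ((Matrix.fromBlocks (Matrix.of fun i j => expCoeff t (y i - 1 + ((j : ℤ) + 1)))
      (Matrix.of fun i b => expCoeff (t - (p b).2) (y i - 1 - (p b).1)) 0 0 :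
        Matrix (Fin n ⊕ Fin k) (Fin n ⊕ Fin k) ℝ) (Sum.inr a))).det = 0 := fun a =>
    Matrix.det_eq_zero_of_row_eq_zero (Sum.inr a) fun j => by rcases j with j | j <;> simp
  rw [Finset.sum_eq_zero fun a _ => h0 a, add_zero] at h
  refine (h.const_mul ((-1) ^ k)).congr_deriv ?_
  rw [Finset.mul_sum]
  refine Finset.sum_congr rfl fun i _ => ?_
  rw [jumpDet, jumpMatrix_updateRow]
  congr 3

lemma continuous_jumpDet {n k : ℕ} (y : Fin n → ℤ) (p : Fin k → ℤ × I) :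
    Continuous fun t => jumpDet y t p :=
  continuous_iff_continuousAt.2 fun t => (hasDerivAt_jumpDet y t p).continuousAt

/-- At the time of the last mark, the particle at the site of the mark has just arrived there. -/
lemma jumpDet_at_last_mark {n k : ℕ} {y : Fin n → ℤ} (hy : Function.Injective y)
    (p : Fin (k + 1) → ℤ × I) (i : Fin (k + 1)) (hi : ∀ j, j ≠ i → (p j).2 < (p i).2) :
    jumpDet y (p i).2 p = ∑ a, if y a = (p i).1 then
      jumpDet (Function.update y a (y a - 1)) (p i).2 (i.removeNth p) else 0 := by
  -- No mark is later than mark i, so its column vanishes on all mark rows. On the particle rows it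
  -- is e_0, the indicator of y a = (p i).1.
  have hcol : ∀ r : Fin (k + 1), jumpMatrix y (p i).2 p (Sum.inr r) (Sum.inr i) = 0 := by
    intro r
    rcases eq_or_ne r i with rfl | hr
    · simp [jumpMatrix]
    · simp [jumpMatrix, not_lt.2 (hi r hr).le]
  have hcol' : ∀ a : Fin n, jumpMatrix y (p i).2 p (Sum.inl a) (Sum.inr i) =
      if y a = (p i).1 then 1 else 0 := by
    intro a
    simp [jumpMatrix, expCoeff_zero_left, sub_eq_zero]
  by_cases hex : ∃ a, y a = (p i).1
  · obtain ⟨a, ha⟩ := hex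
    rw [Finset.sum_eq_single_of_mem a (Finset.mem_univ a) fun b _ hb =>
      if_neg fun h => hb (hy (h.trans ha.symm)), if_pos ha]
    have hswap := Matrix.det_permute (Equiv.swap (Sum.inl a) (Sum.inr i))
      (jumpMatrix y (p i).2 p)
    rw [Equiv.Perm.sign_swap (by simp)] at hswap
    rw [det_eq_of_column_eq_zero _ i] at hswap
    · simp only [Matrix.submatrix_apply, Equiv.swap_apply_right, id] at hswap
      rw [hcol', if_pos ha, one_mul] at hswap
      -- After the swap, row a holds the former row of mark i, which is the row of a particle at (p
      -- i).1 - 1 = y a - 1. The sign of the swap is the ratio of (-1)^(k+1) and (-1)^k.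
      have hsub : (((jumpMatrix y (p i).2 p).submatrix (Equiv.swap (Sum.inl a) (Sum.inr i)) id).submatrix
          (Sum.map id i.succAbove) (Sum.map id i.succAbove)) =
          jumpMatrix (Function.update y a (y a - 1)) (p i).2 (i.removeNth p) := by
        rw [jumpMatrix_updateRow]
        ext r b
        rcases r with r | r
        · rcases eq_or_ne r a with rfl | hr
          · rcases b with b | b
            · simp [jumpMatrix, ha]
            · simp [jumpMatrix, ha, hi _ (Fin.succAbove_ne i b), Fin.removeNth]
          · rw [Matrix.updateRow_ne (by simpa using hr)]
            rcases b with b | b <;>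
              simp [jumpMatrix, Equiv.swap_apply_of_ne_of_ne, hr, Fin.removeNth]
        · rw [Matrix.updateRow_ne (by simp)]
          rcases b with b | b
          · simp [jumpMatrix, Equiv.swap_apply_of_ne_of_ne, Fin.succAbove_ne, Fin.removeNth]
          · simp only [jumpMatrix, Equiv.swap_apply_of_ne_of_ne, Fin.succAbove_ne, Fin.removeNth,
              Matrix.submatrix_apply, Sum.map_inr, ne_eq, reduceCtorEq, not_false_eq_true,
              Sum.inr.injEq, id, Matrix.fromBlocks_apply₂₂, Matrix.of_apply]
            congr
      rw [hsub] at hswap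
      rw [jumpDet, jumpDet, hswap, pow_succ]
      simp
    · intro r hr
      simp only [Matrix.submatrix_apply, id]
      rcases r with r | r
      · rcases eq_or_ne r a with rfl | hra
        · rw [Equiv.swap_apply_left, hcol]
        · rw [Equiv.swap_apply_of_ne_of_ne (by simpa using hra) (by simp), hcol',
            if_neg fun h => hra (hy (h.trans ha.symm))]
      · rw [Equiv.swap_apply_of_ne_of_ne (by simp) hr, hcol]
  · push Not at hex
    rw [Finset.sum_eq_zero fun a _ => if_neg (hex a), jumpDet,
      Matrix.det_eq_zero_of_column_eq_zero (Sum.inr i), mul_zero]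
    rintro (a | r)
    · rw [hcol', if_neg (hex a)]
    · exact hcol r

lemma jumpDet_eq_zero_of_eq {n k : ℕ} {y : Fin n → ℤ} (t : ℝ) (p : Fin k → ℤ × I) {a b : Fin n}
    (hab : a ≠ b) (h : y a = y b) : jumpDet y t p = 0 := by
  rw [jumpDet, Matrix.det_zero_of_row_eq (i := Sum.inl a) (j := Sum.inl b) (by simpa using hab),
    mul_zero]
  ext r
  rcases r with r | r <;> simp [jumpMatrix, h]

/-- Take the mark of smallest content x: every starting position and every mark lies above x - 1, so
nothing reaches it and its row is zero. -/
lemma jumpDet_eq_zero_of_mark_le {n k : ℕ} (y : Fin n → ℤ) (t : ℝ) (p : Fin k → ℤ × I) {q : Fin k}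
    (hq : (p q).1 ≤ -n) : jumpDet y t p = 0 := by
  obtain ⟨r, -, hr⟩ := Finset.exists_min_image Finset.univ (fun r => (p r).1) ⟨q, Finset.mem_univ q⟩
  have hr' := (hr q (Finset.mem_univ q)).trans hq
  rw [jumpDet, Matrix.det_eq_zero_of_row_eq_zero (Sum.inr r), mul_zero]
  rintro (j | b)
  · exact expCoeff_of_neg _ (by have := j.2; lia)
  · have := hr b (Finset.mem_univ b)
    simp only [jumpMatrix, Matrix.fromBlocks_apply₂₂, Matrix.of_apply]
    rw [expCoeff_of_neg _ (by lia), ite_self]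

/-- Starting positions are at least -n, and a mark at or below -n already makes the determinant
vanish; otherwise the row of a has only negative degrees. -/
lemma jumpDet_eq_zero_of_lt {n k : ℕ} {y : Fin n → ℤ} (t : ℝ) (p : Fin k → ℤ × I) {a : Fin n}
    (ha : y a < -n) : jumpDet y t p = 0 := by
  by_cases h : ∃ q, (p q).1 ≤ -n
  · obtain ⟨q, hq⟩ := h
    exact jumpDet_eq_zero_of_mark_le y t p hq
  · push Not at h
    rw [jumpDet, Matrix.det_eq_zero_of_row_eq_zero (Sum.inl a), mul_zero]
    rintro (j | b)
    · exact expCoeff_of_neg _ (by have := j.2; lia)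
    · have := h b
      exact expCoeff_of_neg _ (by lia)

/-! ### Corners of Young diagrams -/

/-- The content of a cell. -/
def content (c : ℕ × ℕ) : ℤ := (c.2 : ℤ) - c.1

/-- The corners of a Young diagram: its maximal cells. -/
def corners (lam : YoungDiagram) : Finset (ℕ × ℕ) :=
  lam.cells.filter fun c => ∀ d ∈ lam.cells, c ≤ d → d = c

/-- The Young diagram of the cells that are not to the south-east of `c`. -/
def eraseCell (lam : YoungDiagram) (c : ℕ × ℕ) : YoungDiagram where
  cells := lam.cells.filter fun d => ¬ c ≤ d
  isLowerSet := by
    intro a b hba ha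
    simp only [Finset.coe_filter, mem_ofPred_eq] at ha ⊢
    exact ⟨lam.isLowerSet hba ha.1, fun h => ha.2 (h.trans hba)⟩

lemma mem_corners {lam : YoungDiagram} {c : ℕ × ℕ} :
    c ∈ corners lam ↔ c ∈ lam.cells ∧ ∀ d ∈ lam.cells, c ≤ d → d = c := by
  simp [corners]

lemma eraseCell_cells {lam : YoungDiagram} {c : ℕ × ℕ} (hc : c ∈ corners lam) :
    (eraseCell lam c).cells = lam.cells.erase c := by
  ext d
  simp only [eraseCell, Finset.mem_filter, Finset.mem_erase]
  constructor
  · rintro ⟨h1, h2⟩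
    exact ⟨fun h => h2 h.ge, h1⟩
  · rintro ⟨h1, h2⟩
    exact ⟨h2, fun h => h1 ((mem_corners.1 hc).2 d h2 h)⟩

lemma card_eraseCell_lt {lam : YoungDiagram} {c : ℕ × ℕ} (hc : c ∈ corners lam) :
    (eraseCell lam c).cells.card < lam.cells.card := by
  rw [eraseCell_cells hc]
  exact Finset.card_erase_lt_of_mem (mem_corners.1 hc).1

lemma colLen_eraseCell_le (lam : YoungDiagram) (c : ℕ × ℕ) (j : ℕ) :
    (eraseCell lam c).colLen j ≤ lam.colLen j := by
  by_contra! h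
  have h1 := YoungDiagram.mem_iff_lt_colLen.2 h
  have h2 : (lam.colLen j, j) ∈ lam.cells := (Finset.mem_filter.1 h1).1
  exact lt_irrefl _ (YoungDiagram.mem_iff_lt_colLen.1 h2)

lemma mem_corners_iff_rowLen {lam : YoungDiagram} {a b : ℕ} :
    (a, b) ∈ corners lam ↔ lam.rowLen a = b + 1 ∧ lam.rowLen (a + 1) < lam.rowLen a := by
  rw [mem_corners]
  constructor
  · rintro ⟨h1, h2⟩
    have h3 := YoungDiagram.mem_iff_lt_rowLen.1 h1
    constructor
    · by_contra h
      have := h2 (a, b + 1) (YoungDiagram.mem_iff_lt_rowLen.2 (by lia)) (by simp)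
      simp at this
    · by_contra h
      have := h2 (a + 1, b) (YoungDiagram.mem_iff_lt_rowLen.2 (by lia)) (by simp)
      simp at this
  · rintro ⟨h1, h2⟩
    refine ⟨YoungDiagram.mem_iff_lt_rowLen.2 (by lia), ?_⟩
    rintro ⟨a', b'⟩ hd hle
    have hd := YoungDiagram.mem_iff_lt_rowLen.1 hd
    obtain ⟨ha, hb⟩ := Prod.mk_le_mk.1 hle
    rcases ha.eq_or_lt with rfl | ha
    · ext <;> simp; lia
    · have := lam.rowLen_anti (a + 1) a' ha
      lia

lemma rowLen_eraseCell {lam : YoungDiagram} {a b : ℕ} (hc : (a, b) ∈ corners lam) (i : ℕ) :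
    (eraseCell lam (a, b)).rowLen i = if i = a then lam.rowLen a - 1 else lam.rowLen i := by
  have h : ∀ j, j < (eraseCell lam (a, b)).rowLen i ↔ (i, j) ≠ (a, b) ∧ j < lam.rowLen i := by
    intro j
    rw [← YoungDiagram.mem_iff_lt_rowLen, ← YoungDiagram.mem_iff_lt_rowLen,
      ← YoungDiagram.mem_cells, eraseCell_cells hc, Finset.mem_erase, YoungDiagram.mem_cells]
  have h2 := (mem_corners_iff_rowLen.1 hc).1
  refine eq_of_forall_lt_iff fun j => ?_
  rw [h]
  split_ifs with hi
  · subst hi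
    simp only [ne_eq, Prod.mk.injEq, true_and]
    lia
  · simp [hi]

/-! ### Integration over tableaux -/

/-- The fillings of the plane whose restriction to `lam` is a tableau with entries `≤ t`. -/
def tabSet (lam : YoungDiagram) (t : I) : Set (ℕ × ℕ → I) :=
  {T | MonotoneOn T lam.cells ∧ ∀ c ∈ lam.cells, T c ≤ t}

lemma measurableSet_tabSet (lam : YoungDiagram) (t : I) : MeasurableSet (tabSet lam t) := by
  have : tabSet lam t = (⋂ a ∈ lam.cells, ⋂ b ∈ lam.cells, ⋂ (_ : a ≤ b), {T | T a ≤ T b}) ∩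
      ⋂ c ∈ lam.cells, {T : ℕ × ℕ → I | T c ≤ t} := by
    ext T
    simp [tabSet, MonotoneOn]
  rw [this]
  refine MeasurableSet.inter ?_ ?_
  · refine .biInter (to_countable _) fun a _ => .biInter (to_countable _) fun b _ =>
      .iInter fun _ => measurableSet_le (measurable_pi_apply a) (measurable_pi_apply b)
  · exact .biInter (to_countable _) fun c _ =>
      measurableSet_le (measurable_pi_apply c) measurable_const

lemma mem_tabSet_of_mem_eraseCell {lam : YoungDiagram} {T : ℕ × ℕ → I} {c : ℕ × ℕ}
    (hc : c ∈ corners lam) {t : I} (h : T c ≤ t) (hT : T ∈ tabSet (eraseCell lam c) (T c)) :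
    T ∈ tabSet lam t ∧ ∀ d ∈ lam.cells, T d ≤ T c := by
  obtain ⟨h1, h2⟩ := hT
  rw [eraseCell_cells hc] at h1 h2
  have h3 : ∀ d ∈ lam.cells, T d ≤ T c := fun d hd => by
    rcases eq_or_ne d c with rfl | hdc
    · exact le_rfl
    · exact h2 d (Finset.mem_erase.2 ⟨hdc, hd⟩)
  refine ⟨⟨fun a ha b hb hab => ?_, fun d hd => (h3 d hd).trans h⟩, h3⟩
  rcases eq_or_ne b c with rfl | hb'
  · exact h3 a ha
  rcases eq_or_ne a c with rfl | ha'
  · exact absurd ((mem_corners.1 hc).2 b hb hab) hb'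
  · exact h1 (Finset.mem_erase.2 ⟨ha', ha⟩) (Finset.mem_erase.2 ⟨hb', hb⟩) hab

-- A filling with distinct entries has its largest entry at a single cell, necessarily a corner, and
-- the remaining entries are bounded by it. Fillings of the whole plane let the diagram shrink
-- without a change of type.
open Classical in
lemma indicator_tabSet_eq_sum {lam : YoungDiagram} (hne : lam.cells.Nonempty) {T : ℕ × ℕ → I}
    (hT : Set.InjOn T lam.cells) (t : I) (F : (ℕ × ℕ → I) → ℝ≥0∞) :
    (tabSet lam t).indicator F T = ∑ c ∈ corners lam,
      if T c ≤ t then (tabSet (eraseCell lam c) (T c)).indicator F T else 0 := by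
  by_cases h : T ∈ tabSet lam t
  · obtain ⟨c, hc, hmax⟩ := Finset.exists_max_image lam.cells T hne
    have hcc : c ∈ corners lam := mem_corners.2 ⟨hc, fun d hd hcd =>
      hT hd hc (le_antisymm (hmax d hd) (h.1 hc hd hcd))⟩
    have hmem : T ∈ tabSet (eraseCell lam c) (T c) := by
      refine ⟨?_, ?_⟩ <;> rw [eraseCell_cells hcc]
      · exact h.1.mono (by simp)
      · exact fun d hd => hmax d (Finset.mem_of_mem_erase hd)
    rw [Finset.sum_eq_single_of_mem c hcc, if_pos (h.2 c hc), indicator_of_mem hmem,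
      indicator_of_mem h]
    intro d hd hdc
    split_ifs with h1
    · refine indicator_of_notMem (fun h2 => hdc ?_) _
      have hd1 := (mem_corners.1 hd).1
      exact hT hd1 hc (le_antisymm (hmax d hd1) ((mem_tabSet_of_mem_eraseCell hd h1 h2).2 c hc))
    · rfl
  · rw [indicator_of_notMem h, Finset.sum_eq_zero]
    intro c hc
    split_ifs with h1
    · exact indicator_of_notMem (fun h2 => h (mem_tabSet_of_mem_eraseCell hc h1 h2).1) _
    · rfl

/-- For a fixed pair of coordinates, integrate out one of them first: the fibres of g are null. This
serves both for the entries of a tableau and for the times of the marks. -/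
lemma ae_pi_injective {ι α : Type*} [Fintype ι] [MeasurableSpace α] (μ : Measure α) [SigmaFinite μ]
    {g : α → I} (hg : Measurable g) (h : ∀ s, μ (g ⁻¹' {s}) = 0) :
    ∀ᵐ x ∂(Measure.pi fun _ : ι => μ), Function.Injective fun i => g (x i) := by
  classical
  have h2 : ∀ i j : ι, i ≠ j → ∀ᵐ x ∂(Measure.pi fun _ : ι => μ), g (x i) ≠ g (x j) := by
    intro i j hij
    have hm : MeasurableSet {x : ι → α | g (x i) = g (x j)} :=
      measurableSet_eq_fun (hg.comp (measurable_pi_apply i)) (hg.comp (measurable_pi_apply j))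
    rw [ae_iff]
    simp only [not_not]
    have x₀ : Nonempty (ι → α) ∨ IsEmpty (ι → α) := (isEmpty_or_nonempty _).symm
    rcases x₀ with ⟨⟨x₀⟩⟩ | he
    · rw [← lintegral_indicator_one hm, lintegral_eq_lmarginal_univ x₀,
        lmarginal_erase' _ (measurable_one.indicator hm) (Finset.mem_univ i)]
      have : (fun x : ι → α => ∫⁻ xᵢ, {x : ι → α | g (x i) = g (x j)}.indicator 1
          (Function.update x i xᵢ) ∂μ) = fun _ => 0 := by
        funext x
        have : ∀ y, {x : ι → α | g (x i) = g (x j)}.indicator (1 : (ι → α) → ℝ≥0∞)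
            (Function.update x i y) = (g ⁻¹' {g (x j)}).indicator 1 y := by
          intro y
          simp [indicator_apply, hij.symm]
        simp_rw [this]
        rw [lintegral_indicator_one (hg (measurableSet_singleton _)), h]
      rw [this]
      simp [lmarginal]
    · rw [Set.eq_empty_of_isEmpty {x : ι → α | g (x i) = g (x j)}, measure_empty]
  have h3 : ∀ᵐ x ∂(Measure.pi fun _ : ι => μ), ∀ i j, i ≠ j → g (x i) ≠ g (x j) := by
    simp only [ae_all_iff]
    exact h2
  filter_upwards [h3] with x hx i j hij
  by_contra hne
  exact hx i j hne hij

/-- Integration over tableaux, according to the corner that contains the largest entry. -/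
lemma lmarginal_tabSet {lam : YoungDiagram} (hne : lam.cells.Nonempty) (t : I)
    {F : (ℕ × ℕ → I) → ℝ≥0∞} (hF : Measurable F) (x : ℕ × ℕ → I) :
    lmarginal (fun _ => volume) lam.cells ((tabSet lam t).indicator F) x =
      ∑ c ∈ corners lam, ∫⁻ s in Iic t, lmarginal (fun _ => volume) (eraseCell lam c).cells
        ((tabSet (eraseCell lam c) s).indicator F) (Function.update x c s) := by
  classical
  have hmeas : ∀ c ∈ corners lam, Measurable fun T : ℕ × ℕ → I => if T c ≤ t then
      (tabSet (eraseCell lam c) (T c)).indicator F T else 0 := by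
    intro c hc
    refine Measurable.ite (measurableSet_le (measurable_pi_apply c) measurable_const) ?_
      measurable_const
    have hs : MeasurableSet {T : ℕ × ℕ → I | T ∈ tabSet (eraseCell lam c) (T c)} := by
      have : {T : ℕ × ℕ → I | T ∈ tabSet (eraseCell lam c) (T c)} =
          tabSet (eraseCell lam c) 1 ∩ ⋂ d ∈ (eraseCell lam c).cells, {T | T d ≤ T c} := by
        ext T
        simp [tabSet, unitInterval.le_one']
      rw [this]
      exact (measurableSet_tabSet _ _).inter (.biInter (to_countable _) fun d _ =>
        measurableSet_le (measurable_pi_apply d) (measurable_pi_apply c))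
    exact hF.indicator hs
  have h1 : lmarginal (fun _ => volume) lam.cells ((tabSet lam t).indicator F) x =
      ∑ c ∈ corners lam, lmarginal (fun _ => volume) lam.cells (fun T => if T c ≤ t then
        (tabSet (eraseCell lam c) (T c)).indicator F T else 0) x := by
    simp only [lmarginal]
    refine Eq.trans ?_ (lintegral_finsetSum (corners lam) fun c hc =>
      (hmeas c hc).comp measurable_updateFinset)
    refine lintegral_congr_ae ?_
    filter_upwards [ae_pi_injective (ι := lam.cells) (volume : Measure I) measurable_id
      fun s => by simp] with y hy
    refine indicator_tabSet_eq_sum hne ?_ t F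
    intro a ha b hb hab
    have ha' : a ∈ lam.cells := ha
    have hb' : b ∈ lam.cells := hb
    simp only [Function.updateFinset, ha', hb', dif_pos] at hab
    simpa using hy hab
  rw [h1]
  refine Finset.sum_congr rfl fun c hc => ?_
  -- The entry of the corner becomes the outer variable s, which bounds the other entries.
  rw [lmarginal_erase _ (hmeas c hc) (mem_corners.1 hc).1, ← lintegral_indicator measurableSet_Iic]
  refine lintegral_congr fun s => ?_
  rw [← eraseCell_cells hc]
  have hcs : ∀ y, Function.updateFinset (Function.update x c s) (eraseCell lam c).cells y c = s := by
    intro y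
    have : c ∉ (eraseCell lam c).cells := by rw [eraseCell_cells hc]; simp
    simp [Function.updateFinset, this]
  simp only [lmarginal, hcs]
  by_cases hs : s ≤ t
  · simp [hs]
  · rw [indicator_of_notMem (by simpa using hs)]
    simp [hs]

/-! ### Sums over the points of a tableau -/

/-- The tuples of `k` distinct cells of `lam`. -/
def cellTuples (lam : YoungDiagram) (k : ℕ) : Finset (Fin k → ℕ × ℕ) :=
  (Fintype.piFinset fun _ => lam.cells).filter Function.Injective

/-- The sum of `f` over the tuples of points belonging to distinct cells. -/
noncomputable def pointSum {k : ℕ} (lam : YoungDiagram) (f : (Fin k → ℤ × I) → ℝ≥0∞)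
    (T : ℕ × ℕ → I) : ℝ≥0∞ :=
  ∑ c ∈ cellTuples lam k, f fun i => (content (c i), T (c i))

lemma measurable_pointSum {k : ℕ} (lam : YoungDiagram) {f : (Fin k → ℤ × I) → ℝ≥0∞}
    (hf : Measurable f) : Measurable (pointSum lam f) := by
  refine Finset.measurable_sum _ fun c _ => hf.comp ?_
  exact measurable_pi_lambda _ fun i => measurable_const.prodMk (measurable_pi_apply _)

lemma pointSum_zero (lam : YoungDiagram) (f : (Fin 0 → ℤ × I) → ℝ≥0∞) (T : ℕ × ℕ → I) :
    pointSum lam f T = f default := by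
  have : cellTuples lam 0 = {default} := by
    ext c
    simp only [cellTuples, Finset.mem_filter, Fintype.mem_piFinset, Finset.mem_singleton]
    exact ⟨fun _ => Subsingleton.elim _ _, fun _ => ⟨fun i => i.elim0,
      Function.injective_of_subsingleton _⟩⟩
  rw [pointSum, this, Finset.sum_singleton]
  congr
  exact Subsingleton.elim _ _

/-- A tuple of distinct cells either avoids the corner or contains it at exactly one index i. -/
lemma pointSum_eraseCell {k : ℕ} {lam : YoungDiagram} {c : ℕ × ℕ} (hc : c ∈ corners lam)
    (f : (Fin (k + 1) → ℤ × I) → ℝ≥0∞) (T : ℕ × ℕ → I) :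
    pointSum lam f T = pointSum (eraseCell lam c) f T + ∑ i : Fin (k + 1),
      pointSum (eraseCell lam c) (fun p => f (i.insertNth (content c, T c) p)) T := by
  classical
  have hcl := (mem_corners.1 hc).1
  set g : (Fin (k + 1) → ℕ × ℕ) → ℝ≥0∞ := fun d => f fun i => (content (d i), T (d i)) with hg
  have h1 : ∀ d ∈ cellTuples lam (k + 1), g d =
      (if ∀ i, d i ≠ c then g d else 0) + ∑ i, if d i = c then g d else 0 := by
    intro d hd
    have hinj : Function.Injective d := (Finset.mem_filter.1 hd).2
    by_cases h : ∃ i, d i = c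
    · obtain ⟨i, hi⟩ := h
      rw [if_neg (by push Not; exact ⟨i, hi⟩), zero_add, Finset.sum_eq_single_of_mem i
        (Finset.mem_univ i) fun j _ hj => if_neg fun h => hj (hinj (h.trans hi.symm)), if_pos hi]
    · push Not at h
      rw [if_pos h, Finset.sum_eq_zero fun i _ => if_neg (h i), add_zero]
  rw [pointSum, Finset.sum_congr rfl h1, Finset.sum_add_distrib, Finset.sum_comm]
  congr 1
  · rw [← Finset.sum_filter, pointSum]
    refine Finset.sum_congr ?_ fun _ _ => rfl
    ext d
    simp only [cellTuples, Finset.mem_filter, Fintype.mem_piFinset, eraseCell_cells hc,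
      Finset.mem_erase]
    exact ⟨fun h => ⟨fun i => ⟨h.2 i, h.1.1 i⟩, h.1.2⟩,
      fun h => ⟨⟨fun i => (h.1 i).2, h.2⟩, fun i => (h.1 i).1⟩⟩
  · refine Finset.sum_congr rfl fun i _ => ?_
    rw [← Finset.sum_filter, pointSum]
    refine Finset.sum_bij' (fun d _ => i.removeNth d) (fun d _ => i.insertNth c d) ?_ ?_ ?_ ?_ ?_
    · intro d hd
      simp only [cellTuples, Finset.mem_filter, Fintype.mem_piFinset, eraseCell_cells hc,
        Finset.mem_erase] at hd ⊢
      obtain ⟨⟨hd1, hd2⟩, hd3⟩ := hd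
      refine ⟨fun j => ⟨fun h => ?_, hd1 _⟩, fun a b hab => ?_⟩
      · exact Fin.succAbove_ne i j (hd2 (h.trans hd3.symm))
      · exact Fin.succAbove_right_injective (hd2 hab)
    · intro d hd
      simp only [cellTuples, Finset.mem_filter, Fintype.mem_piFinset, eraseCell_cells hc,
        Finset.mem_erase] at hd ⊢
      obtain ⟨hd1, hd2⟩ := hd
      refine ⟨⟨fun j => ?_, ?_⟩, by simp⟩
      · rcases Fin.eq_self_or_eq_succAbove i j with rfl | ⟨j, rfl⟩
        · simpa using hcl
        · simpa using (hd1 j).2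
      · intro a b hab
        rcases Fin.eq_self_or_eq_succAbove i a with h' | ⟨a, rfl⟩ <;>
        rcases Fin.eq_self_or_eq_succAbove i b with h | ⟨b, rfl⟩
        · exact h'.trans h.symm
        · subst h'
          simp only [Fin.insertNth_apply_same, Fin.insertNth_apply_succAbove] at hab
          exact absurd hab.symm (hd1 b).1
        · subst h
          simp only [Fin.insertNth_apply_same, Fin.insertNth_apply_succAbove] at hab
          exact absurd hab (hd1 a).1
        · simp only [Fin.insertNth_apply_succAbove] at hab
          rw [hd2 hab]
    · intro d hd
      have := (Finset.mem_filter.1 hd).2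
      rw [← this]
      exact Fin.insertNth_self_removeNth i d
    · intro d _
      simp
    · intro d hd
      have := (Finset.mem_filter.1 hd).2
      rw [hg]
      dsimp only
      congr 1
      funext j
      rcases Fin.eq_self_or_eq_succAbove i j with rfl | ⟨j, rfl⟩
      · simp [this]
      · simp [Fin.removeNth]

/-- The integral over the tableaux with entries `≤ t` of the sum of `f` over tuples of points. -/
noncomputable def tabIntegral {k : ℕ} (lam : YoungDiagram) (t : I)
    (f : (Fin k → ℤ × I) → ℝ≥0∞) (x : ℕ × ℕ → I) : ℝ≥0∞ :=
  lmarginal (fun _ => volume) lam.cells ((tabSet lam t).indicator (pointSum lam f)) x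

lemma tabIntegral_zero {lam : YoungDiagram} (hne : lam.cells.Nonempty) (t : I)
    {f : (Fin 0 → ℤ × I) → ℝ≥0∞} (hf : Measurable f) (x : ℕ × ℕ → I) :
    tabIntegral lam t f x = ∑ c ∈ corners lam, ∫⁻ s in Iic t,
      tabIntegral (eraseCell lam c) s f (Function.update x c s) := by
  rw [tabIntegral, lmarginal_tabSet hne t (measurable_pointSum lam hf)]
  have : ∀ lam' : YoungDiagram, pointSum lam' f = fun _ => f default := fun lam' =>
    funext (pointSum_zero lam' f)
  simp only [tabIntegral, this]

/-- The largest entry s belongs to no point of the tuple or to exactly one, which is then (content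
c, s). The empty diagram is no exception here: it has no tuples of k + 1 cells. -/
lemma tabIntegral_succ {k : ℕ} (lam : YoungDiagram) (t : I)
    {f : (Fin (k + 1) → ℤ × I) → ℝ≥0∞} (hf : Measurable f) (x : ℕ × ℕ → I) :
    tabIntegral lam t f x = ∑ c ∈ corners lam, ∫⁻ s in Iic t,
      (tabIntegral (eraseCell lam c) s f (Function.update x c s) + ∑ i : Fin (k + 1),
        tabIntegral (eraseCell lam c) s (fun p => f (i.insertNth (content c, s) p))
          (Function.update x c s)) := by
  rcases lam.cells.eq_empty_or_nonempty with h0 | hne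
  · have h1 : cellTuples lam (k + 1) = ∅ := by
      rw [Finset.eq_empty_iff_forall_notMem]
      intro d hd
      have := Fintype.mem_piFinset.1 (Finset.mem_filter.1 hd).1 0
      simp [h0] at this
    have h2 : pointSum lam f = 0 := by
      funext T
      simp [pointSum, h1]
    simp [tabIntegral, h2, corners, h0]
  rw [tabIntegral, lmarginal_tabSet hne t (measurable_pointSum lam hf)]
  refine Finset.sum_congr rfl fun c hc => lintegral_congr fun s => ?_
  have hcs : ∀ y, Function.updateFinset (Function.update x c s) (eraseCell lam c).cells y c = s := by
    intro y
    have : c ∉ (eraseCell lam c).cells := by rw [eraseCell_cells hc]; simp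
    simp [Function.updateFinset, this]
  have hins : ∀ i : Fin (k + 1), Measurable fun p : Fin k → ℤ × I =>
      f (i.insertNth (content c, s) p) := fun i => hf.comp
    ((MeasurableEquiv.piFinSuccAbove (fun _ => ℤ × I) i).symm.measurable.comp
      (measurable_const.prodMk measurable_id))
  have hm : ∀ {k' : ℕ} {f' : (Fin k' → ℤ × I) → ℝ≥0∞}, Measurable f' → Measurable fun y =>
      (tabSet (eraseCell lam c) s).indicator (pointSum (eraseCell lam c) f')
      (Function.updateFinset (Function.update x c s) (eraseCell lam c).cells y) := fun hf' =>
    ((measurable_pointSum _ hf').indicator (measurableSet_tabSet _ _)).comp measurable_updateFinset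
  simp only [tabIntegral, lmarginal]
  rw [← lintegral_finsetSum _ fun i _ => hm (hins i), ← lintegral_add_left (hm hf)]
  refine lintegral_congr fun y => ?_
  by_cases h : Function.updateFinset (Function.update x c s) (eraseCell lam c).cells y ∈
      tabSet (eraseCell lam c) s
  · simp only [indicator_of_mem h]
    rw [pointSum_eraseCell hc, hcs]
  · simp only [indicator_of_notMem h, Finset.sum_const_zero, add_zero]

/-! ### The recursion for the bordered determinants of a Young diagram -/

/-- The positions of the first `n` particles for the diagram `lam`. -/
def positions (n : ℕ) (lam : YoungDiagram) (i : Fin n) : ℤ := (lam.rowLen i : ℤ) - ((i : ℤ) + 1)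

lemma positions_strictAnti (n : ℕ) (lam : YoungDiagram) : StrictAnti (positions n lam) := by
  intro a b hab
  have := lam.rowLen_anti a b hab.le
  have h : (a : ℕ) < b := hab
  simp only [positions]
  lia

lemma positions_eraseCell {n : ℕ} {lam : YoungDiagram} {a : Fin n} {b : ℕ}
    (hc : ((a : ℕ), b) ∈ corners lam) : positions n (eraseCell lam (a, b)) =
      Function.update (positions n lam) a (positions n lam a - 1) := by
  have h2 := (mem_corners_iff_rowLen.1 hc).1
  funext i
  rw [positions, rowLen_eraseCell hc]
  rcases eq_or_ne i a with rfl | hi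
  · simp only [if_true, Function.update_self, positions]
    lia
  · rw [if_neg (by simpa [Fin.ext_iff] using hi), Function.update_of_ne hi, positions]

/-- If lowering row a does not erase a corner, then either the particle lands on its successor and
two rows agree, or a is the last row, is empty, and moves below -n. The weight g is 1 for the
derivative and the indicator of a site for the last mark. -/
lemma sum_jumpDet_update {n k : ℕ} {lam : YoungDiagram} (hn : lam.colLen 0 ≤ n) (t : ℝ)
    (p : Fin k → ℤ × I) (g : ℤ → ℝ) :
    ∑ a, g (positions n lam a) *
      jumpDet (Function.update (positions n lam) a (positions n lam a - 1)) t p =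
    ∑ c ∈ corners lam, g (content c) * jumpDet (positions n (eraseCell lam c)) t p := by
  have hlt : ∀ c ∈ corners lam, c.1 < n := fun c hc => by
    have h1 := mem_corners_iff_rowLen.1 (show (c.1, c.2) ∈ corners lam from hc)
    by_contra h
    have := rowLen_eq_zero hn (not_lt.1 h)
    lia
  symm
  refine Finset.sum_bij_ne_zero (fun c hc _ => (⟨c.1, hlt c hc⟩ : Fin n)) (by simp) ?_ ?_ ?_
  · rintro ⟨a, b⟩ h1 - ⟨a', b'⟩ h2 - he
    obtain rfl : a = a' := by simpa using he
    have e1 := (mem_corners_iff_rowLen.1 h1).1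
    have e2 := (mem_corners_iff_rowLen.1 h2).1
    ext <;> simp; lia
  · intro a _ ha
    have ha' := right_ne_zero_of_mul ha
    have h1 : lam.rowLen (a + 1) < lam.rowLen a := by
      by_contra h
      have h' : lam.rowLen (a + 1) = lam.rowLen a :=
        le_antisymm (lam.rowLen_anti _ _ (Nat.le_succ _)) (not_lt.1 h)
      refine ha' ?_
      by_cases hlast : (a : ℕ) + 1 < n
      · have hne : a ≠ ⟨a + 1, hlast⟩ := by simp [Fin.ext_iff]
        refine jumpDet_eq_zero_of_eq t p hne ?_
        rw [Function.update_self, Function.update_of_ne hne.symm]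
        simp only [positions]
        push_cast
        lia
      · refine jumpDet_eq_zero_of_lt t p (a := a) ?_
        have := rowLen_eq_zero hn (not_lt.1 hlast)
        rw [Function.update_self]
        simp only [positions]
        lia
    have hc : ((a : ℕ), lam.rowLen a - 1) ∈ corners lam :=
      mem_corners_iff_rowLen.2 ⟨by lia, h1⟩
    refine ⟨_, hc, ?_, by simp⟩
    rw [positions_eraseCell hc]
    have : content ((a : ℕ), lam.rowLen a - 1) = positions n lam a := by
      simp only [content, positions]
      lia
    rwa [this]
  · rintro ⟨a, b⟩ hc _
    have h2 := (mem_corners_iff_rowLen.1 hc).1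
    have := positions_eraseCell (n := n) (a := ⟨a, hlt _ hc⟩) hc
    rw [this]
    congr 2
    simp only [content, positions]
    lia

lemma jumpDet_sub_eq_integral {n k : ℕ} {lam : YoungDiagram} (hn : lam.colLen 0 ≤ n) (s t : ℝ)
    (p : Fin k → ℤ × I) : jumpDet (positions n lam) t p - jumpDet (positions n lam) s p =
      ∫ r in s..t, ∑ c ∈ corners lam, jumpDet (positions n (eraseCell lam c)) r p := by
  rw [intervalIntegral.integral_eq_sub_of_hasDerivAt (f := fun t => jumpDet (positions n lam) t p)]
  · intro r _
    refine (hasDerivAt_jumpDet (positions n lam) r p).congr_deriv ?_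
    simpa using sum_jumpDet_update hn r p fun _ => 1
  · exact (continuous_finsetSum _ fun c _ => continuous_jumpDet _ p).intervalIntegrable _ _

lemma jumpDet_last_mark {n k : ℕ} {lam : YoungDiagram} (hn : lam.colLen 0 ≤ n)
    (p : Fin (k + 1) → ℤ × I) (i : Fin (k + 1)) (hi : ∀ j, j ≠ i → (p j).2 < (p i).2) :
    jumpDet (positions n lam) (p i).2 p = ∑ c ∈ corners lam, if content c = (p i).1 then
      jumpDet (positions n (eraseCell lam c)) (p i).2 (i.removeNth p) else 0 := by
  rw [jumpDet_at_last_mark (positions_strictAnti n lam).injective p i hi]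
  simpa using sum_jumpDet_update hn (p i).2 (i.removeNth p) fun x => if x = (p i).1 then 1 else 0

/-! ### Initial values and positivity of the bordered determinants -/

lemma jumpDet_fin_zero {n : ℕ} (y : Fin n → ℤ) (t : ℝ) (p : Fin 0 → ℤ × I) :
    jumpDet y t p = (Matrix.of fun i j : Fin n => expCoeff t (y i + ((j : ℤ) + 1))).det := by
  rw [jumpDet, jumpMatrix, Subsingleton.elim (Matrix.of _ : Matrix (Fin 0) (Fin n) ℝ) 0,
    Matrix.det_fromBlocks_zero₂₁]
  simp

lemma rowLen_eq_zero_of_cells_eq_empty {lam : YoungDiagram} (h : lam.cells = ∅) (i : ℕ) :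
    lam.rowLen i = 0 := by
  by_contra h0
  have h1 : (i, 0) ∈ lam.cells := YoungDiagram.mem_iff_lt_rowLen.2 (Nat.pos_of_ne_zero h0)
  simp [h] at h1

lemma jumpDet_of_cells_eq_empty {n : ℕ} {lam : YoungDiagram} (h : lam.cells = ∅) (t : ℝ)
    (p : Fin 0 → ℤ × I) : jumpDet (positions n lam) t p = 1 := by
  rw [jumpDet_fin_zero, Matrix.det_of_isUpperTriangular]
  · refine Finset.prod_eq_one fun i _ => ?_
    simp [positions, rowLen_eq_zero_of_cells_eq_empty h, expCoeff_zero_right]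
  · intro i j hij
    have hij : (j : ℕ) < i := hij
    simp only [Matrix.of_apply, positions, rowLen_eq_zero_of_cells_eq_empty h]
    exact expCoeff_of_neg _ (by lia)

/-- The first row consists of e_0(λ₁ + j) with λ₁ > 0, hence vanishes: a nonempty diagram cannot be
reached in time 0. -/
lemma jumpDet_zero_of_nonempty {n : ℕ} {lam : YoungDiagram} (hn : lam.colLen 0 ≤ n)
    (h : lam.cells.Nonempty) (p : Fin 0 → ℤ × I) : jumpDet (positions n lam) 0 p = 0 := by
  obtain ⟨⟨a, b⟩, hab⟩ := h
  have h0 : (0, 0) ∈ lam := lam.up_left_mem (Nat.zero_le a) (Nat.zero_le b) hab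
  have h1 := YoungDiagram.mem_iff_lt_rowLen.1 h0
  have h2 := YoungDiagram.mem_iff_lt_colLen.1 h0
  rw [jumpDet_fin_zero]
  refine Matrix.det_eq_zero_of_row_eq_zero (⟨0, by lia⟩ : Fin n) fun j => ?_
  simp only [Matrix.of_apply, positions, expCoeff_zero_left]
  rw [if_neg (by push_cast; lia)]

lemma exists_last_mark {k : ℕ} {p : Fin (k + 1) → ℤ × I}
    (hp : Function.Injective fun i => (p i).2) : ∃ i, ∀ j, j ≠ i → (p j).2 < (p i).2 := by
  obtain ⟨i, -, hi⟩ := Finset.exists_max_image Finset.univ (fun i => (p i).2) Finset.univ_nonempty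
  exact ⟨i, fun j hj => lt_of_le_of_ne (hi j (Finset.mem_univ j)) fun h => hj (hp h)⟩

lemma removeNth_injective {k : ℕ} {p : Fin (k + 1) → ℤ × I}
    (hp : Function.Injective fun i => (p i).2) (i : Fin (k + 1)) :
    Function.Injective fun j => (i.removeNth p j).2 :=
  fun _ _ h => Fin.succAbove_right_injective (hp h)

/-- At the time of the last mark (or at time 0 without marks) the value is 0, 1 or a sum of weights
of smaller diagrams; from then on the derivative is such a sum too. Positivity makes the passage to
`ENNReal.ofReal` lossless. -/
lemma jumpDet_nonneg {n : ℕ} (lam : YoungDiagram) (hn : lam.colLen 0 ≤ n) {k : ℕ}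
    (p : Fin k → ℤ × I) (hp : Function.Injective fun i => (p i).2) (t : ℝ) (ht : 0 ≤ t)
    (hpt : ∀ i, (p i).2 ≤ t) : 0 ≤ jumpDet (positions n lam) t p := by
  induction hm : lam.cells.card using Nat.strong_induction_on generalizing lam k p t with
  | _ m ih =>
  subst hm
  have ih' : ∀ c ∈ corners lam, ∀ {k : ℕ} (p : Fin k → ℤ × I),
      (Function.Injective fun i => (p i).2) → ∀ t : ℝ, 0 ≤ t → (∀ i, (p i).2 ≤ t) →
      0 ≤ jumpDet (positions n (eraseCell lam c)) t p := fun c hc _ p hp t ht hpt =>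
    ih _ (card_eraseCell_lt hc) _ ((colLen_eraseCell_le lam c 0).trans hn) p hp t ht hpt rfl
  have key : ∀ s : ℝ, 0 ≤ s → s ≤ t → (∀ i, (p i).2 ≤ s) → 0 ≤ jumpDet (positions n lam) s p →
      0 ≤ jumpDet (positions n lam) t p := by
    intro s hs hst hps h
    have h1 := jumpDet_sub_eq_integral hn s t p
    have h2 : 0 ≤ ∫ r in s..t, ∑ c ∈ corners lam, jumpDet (positions n (eraseCell lam c)) r p :=
      intervalIntegral.integral_nonneg hst fun r hr => Finset.sum_nonneg fun c hc =>
        ih' c hc p hp r (hs.trans hr.1) fun i => (hps i).trans hr.1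
    linarith
  rcases k with _ | k
  · refine key 0 le_rfl ht (fun i => i.elim0) ?_
    rcases lam.cells.eq_empty_or_nonempty with h | h
    · rw [jumpDet_of_cells_eq_empty h]; exact zero_le_one
    · rw [jumpDet_zero_of_nonempty hn h]
  · obtain ⟨i, hi⟩ := exists_last_mark hp
    refine key (p i).2 (p i).2.2.1 (hpt i) (fun j => ?_) ?_
    · rcases eq_or_ne j i with rfl | h
      · exact le_rfl
      · exact (hi j h).le
    · rw [jumpDet_last_mark hn p i hi]
      refine Finset.sum_nonneg fun c hc => ?_
      split_ifs
      · exact ih' c hc _ (removeNth_injective hp i) _ (p i).2.2.1 fun j =>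
          (hi _ (Fin.succAbove_ne i j)).le
      · exact le_rfl

/-! ### The recursion in terms of densities -/

lemma lintegral_Icc_unitInterval (g : ℝ → ℝ≥0∞) (s t : I) :
    ∫⁻ r in Icc s t, g r = ∫⁻ r in Icc (s : ℝ) t, g r := by
  have h1 : ∀ r : I, (Icc s t).indicator (fun r : I => g r) r = (Icc (s : ℝ) t).indicator g r :=
    fun r => by simp [indicator_apply, ← Subtype.coe_le_coe]
  rw [← lintegral_indicator measurableSet_Icc, lintegral_congr h1]
  refine (lintegral_subtype_comap (measurableSet_Icc : MeasurableSet I) _).trans ?_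
  rw [lintegral_indicator measurableSet_Icc, Measure.restrict_restrict measurableSet_Icc,
    inter_eq_left.2 (Icc_subset_Icc s.2.1 t.2.2)]

lemma ofReal_jumpDet {n k : ℕ} {lam : YoungDiagram} (hn : lam.colLen 0 ≤ n)
    {p : Fin k → ℤ × I} (hp : Function.Injective fun i => (p i).2) {s t : I} (hst : s ≤ t)
    (hps : ∀ i, (p i).2 ≤ s) : ENNReal.ofReal (jumpDet (positions n lam) t p) =
      ENNReal.ofReal (jumpDet (positions n lam) s p) + ∑ c ∈ corners lam, ∫⁻ r in Icc s t,
        ENNReal.ofReal (jumpDet (positions n (eraseCell lam c)) r p) := by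
  have hst' : (s : ℝ) ≤ t := hst
  have hnn : ∀ r ∈ Icc (s : ℝ) t, ∀ c ∈ corners lam,
      0 ≤ jumpDet (positions n (eraseCell lam c)) r p := fun r hr c _ =>
    jumpDet_nonneg _ ((colLen_eraseCell_le lam c 0).trans hn) p hp r (s.2.1.trans hr.1)
      fun i => le_trans (hps i) hr.1
  have h1 := jumpDet_sub_eq_integral hn s t p
  have hc : Continuous fun r => ∑ c ∈ corners lam, jumpDet (positions n (eraseCell lam c)) r p :=
    continuous_finsetSum _ fun c _ => continuous_jumpDet _ p
  rw [intervalIntegral.integral_of_le hst', ← integral_Icc_eq_integral_Ioc] at h1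
  rw [eq_add_of_sub_eq' h1, ENNReal.ofReal_add (jumpDet_nonneg lam hn p hp s s.2.1 hps),
    ofReal_integral_eq_lintegral_ofReal]
  · congr 1
    have hL : ∀ c, ∫⁻ r in Icc s t, ENNReal.ofReal (jumpDet (positions n (eraseCell lam c)) r p) =
        ∫⁻ r in Icc (s : ℝ) t, ENNReal.ofReal (jumpDet (positions n (eraseCell lam c)) r p) :=
      fun c => lintegral_Icc_unitInterval
        (fun r => ENNReal.ofReal (jumpDet (positions n (eraseCell lam c)) r p)) s t
    simp only [hL]
    rw [← lintegral_finsetSum _ fun c _ => (continuous_jumpDet _ p).measurable.ennreal_ofReal]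
    refine setLIntegral_congr_fun measurableSet_Icc fun r hr => ?_
    exact ENNReal.ofReal_sum_of_nonneg (hnn r hr)
  · exact hc.continuousOn.integrableOn_compact isCompact_Icc
  · filter_upwards [ae_restrict_mem measurableSet_Icc] with r hr
    exact Finset.sum_nonneg (hnn r hr)
  · exact setIntegral_nonneg measurableSet_Icc fun r hr => Finset.sum_nonneg (hnn r hr)

open Classical in
/-- The density of the marks at time `t`. -/
noncomputable def jumpDensity {k : ℕ} (n : ℕ) (lam : YoungDiagram) (t : I) (p : Fin k → ℤ × I) :
    ℝ≥0∞ :=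
  if ∀ i, (p i).2 ≤ t then ENNReal.ofReal (jumpDet (positions n lam) t p) else 0

lemma measurable_jumpDet {n k : ℕ} (y : Fin n → ℤ) :
    Measurable fun q : ℝ × (Fin k → ℤ × I) => jumpDet y q.1 q.2 := by
  have hx : ∀ a : Fin k, Measurable fun q : ℝ × (Fin k → ℤ × I) => (q.2 a).1 := fun a => by fun_prop
  have hs : ∀ a : Fin k, Measurable fun q : ℝ × (Fin k → ℤ × I) => (q.2 a).2 := fun a => by fun_prop
  have hs' : ∀ a : Fin k, Measurable fun q : ℝ × (Fin k → ℤ × I) => ((q.2 a).2 : ℝ) := fun a =>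
    measurable_subtype_coe.comp (hs a)
  have he : ∀ {u : ℝ × (Fin k → ℤ × I) → ℝ} {v : ℝ × (Fin k → ℤ × I) → ℤ}, Measurable u →
      Measurable v → Measurable fun q => expCoeff (u q) (v q) := fun hu hv =>
    measurable_expCoeff.comp (hu.prodMk hv)
  have hM : ∀ i j, Measurable fun q : ℝ × (Fin k → ℤ × I) => jumpMatrix y q.1 q.2 i j := by
    rintro (i | a) (j | b)
    · exact he measurable_fst measurable_const
    · exact he (measurable_fst.sub (hs' b)) (measurable_const.sub (hx b))
    · exact he (hs' a) (((hx a).sub measurable_const).add measurable_const)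
    · exact Measurable.ite (measurableSet_lt (hs b) (hs a))
        (he ((hs' a).sub (hs' b)) (((hx a).sub measurable_const).sub (hx b))) measurable_const
  unfold jumpDet
  simp only [Matrix.det_apply]
  exact (Finset.measurable_sum _ fun τ _ => (Finset.measurable_prod _ fun i _ =>
    hM _ _).const_smul _).const_mul _

lemma measurable_jumpDensity (n k : ℕ) (lam : YoungDiagram) :
    Measurable fun q : I × (Fin k → ℤ × I) => jumpDensity n lam q.1 q.2 := by
  refine Measurable.ite ?_ ?_ measurable_const
  · simp only [ofPred_forall]
    exact .iInter fun i => measurableSet_le (by fun_prop) measurable_fst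
  · exact ((measurable_jumpDet _).comp ((measurable_subtype_coe.comp measurable_fst).prodMk
      measurable_snd)).ennreal_ofReal

lemma jumpDensity_zero {n : ℕ} {lam : YoungDiagram} (hn : lam.colLen 0 ≤ n)
    (h : lam.cells.Nonempty) (t : I) (p : Fin 0 → ℤ × I) : jumpDensity n lam t p =
      ∑ c ∈ corners lam, ∫⁻ s in Iic t, jumpDensity n (eraseCell lam c) s p := by
  have h1 := ofReal_jumpDet hn (p := p) (Function.injective_of_subsingleton _) (show 0 ≤ t from t.2.1)
    (fun i => i.elim0)
  rw [Icc.coe_zero, jumpDet_zero_of_nonempty hn h, ENNReal.ofReal_zero, zero_add] at h1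
  have : Icc 0 t = Iic t := by ext; simp
  rw [this] at h1
  simpa [jumpDensity] using h1

/-- Integrate the derivative from the time of the last mark, where the last-mark reduction gives the
starting value. -/
lemma jumpDensity_succ {n k : ℕ} {lam : YoungDiagram} (hn : lam.colLen 0 ≤ n) (t : I)
    (p : Fin (k + 1) → ℤ × I) (hp : Function.Injective fun i => (p i).2) :
    jumpDensity n lam t p =
      (∑ c ∈ corners lam, ∑ i, if content c = (p i).1 ∧ (p i).2 ≤ t then
        jumpDensity n (eraseCell lam c) (p i).2 (i.removeNth p) else 0) +
      ∑ c ∈ corners lam, ∫⁻ s in Iic t, jumpDensity n (eraseCell lam c) s p := by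
  obtain ⟨i, hi⟩ := exists_last_mark hp
  have hi' : ∀ j, (p j).2 ≤ (p i).2 := fun j => by
    rcases eq_or_ne j i with rfl | h
    · exact le_rfl
    · exact (hi j h).le
  -- Removing a mark that is not the last leaves a mark beyond the current time, where the density
  -- is cut off; so the sum over all marks has only one effective term.
  have hj : ∀ j ≠ i, ∀ c, jumpDensity n (eraseCell lam c) (p j).2 (j.removeNth p) = 0 := by
    intro j hji c
    refine if_neg fun h => ?_
    obtain ⟨l, hl⟩ := Fin.exists_succAbove_eq hji.symm
    have := h l
    rw [Fin.removeNth, hl] at this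
    exact absurd (hi j hji) (not_lt.2 this)
  have h1 : ∀ c, (∑ j, if content c = (p j).1 ∧ (p j).2 ≤ t then
        jumpDensity n (eraseCell lam c) (p j).2 (j.removeNth p) else 0) =
      if content c = (p i).1 ∧ (p i).2 ≤ t then
        jumpDensity n (eraseCell lam c) (p i).2 (i.removeNth p) else 0 := fun c =>
    Finset.sum_eq_single_of_mem i (Finset.mem_univ i) fun j _ hji => by rw [hj j hji, ite_self]
  have h2 : ∀ c s, jumpDensity n (eraseCell lam c) s p = (Ici (p i).2).indicator
      (fun s => ENNReal.ofReal (jumpDet (positions n (eraseCell lam c)) s p)) s := by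
    intro c s
    by_cases h : (p i).2 ≤ s
    · rw [indicator_of_mem (mem_Ici.2 h), jumpDensity, if_pos fun j => (hi' j).trans h]
    · rw [indicator_of_notMem (by simpa using h), jumpDensity, if_neg fun h' => h (h' i)]
  simp only [h1, h2]
  have h3 : ∀ f : I → ℝ≥0∞, ∫⁻ s in Iic t, (Ici (p i).2).indicator f s =
      ∫⁻ s in Icc (p i).2 t, f s := fun f => by
    rw [lintegral_indicator measurableSet_Ici, Measure.restrict_restrict measurableSet_Ici]
    rfl
  simp only [h3]
  by_cases ht : (p i).2 ≤ t
  · rw [jumpDensity, if_pos fun j => (hi' j).trans ht, ofReal_jumpDet hn hp ht hi',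
      jumpDet_last_mark hn p i hi, ENNReal.ofReal_sum_of_nonneg]
    · congr 1
      refine Finset.sum_congr rfl fun c _ => ?_
      simp only [ht, and_true]
      split_ifs
      · exact (if_pos fun j => hi' (i.succAbove j)).symm
      · exact ENNReal.ofReal_zero
    · intro c _
      split_ifs
      · exact jumpDet_nonneg _ ((colLen_eraseCell_le lam c 0).trans hn) _
          (removeNth_injective hp i) _ (p i).2.2.1 fun j => hi' _
      · exact le_rfl
  · rw [jumpDensity, if_neg fun h => ht (h i), Icc_eq_empty ht]
    simp [ht]

/-! ### The densities of the points of a random tableau -/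

/-- The product of counting measure and Lebesgue measure on `ℤ × [0, 1]`. -/
noncomputable abbrev refMeasure : Measure (ℤ × I) := Measure.count.prod volume

lemma ae_injective_times (k : ℕ) :
    ∀ᵐ p ∂(Measure.pi fun _ : Fin k => refMeasure), Function.Injective fun i => (p i).2 := by
  refine ae_pi_injective refMeasure measurable_snd fun s => ?_
  have : (Prod.snd ⁻¹' {s} : Set (ℤ × I)) = univ ×ˢ {s} := by ext; simp
  rw [this, Measure.prod_prod]
  simp

lemma lintegral_refMeasure {f : ℤ × I → ℝ≥0∞} (hf : Measurable f) :
    ∫⁻ q, f q ∂refMeasure = ∑' x, ∫⁻ s, f (x, s) := by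
  rw [lintegral_prod _ hf.aemeasurable, lintegral_count]

lemma lintegral_pi_insertNth {k : ℕ} (i : Fin (k + 1)) {f : (Fin (k + 1) → ℤ × I) → ℝ≥0∞}
    (hf : Measurable f) : ∫⁻ p, f p ∂(Measure.pi fun _ => refMeasure) =
      ∫⁻ q, ∫⁻ p, f (i.insertNth q p) ∂(Measure.pi fun _ => refMeasure) ∂refMeasure := by
  have h := (measurePreserving_piFinSuccAbove (fun _ : Fin (k + 1) => refMeasure) i).symm
  rw [← h.lintegral_comp hf, lintegral_prod]
  · rfl
  · exact (hf.comp (MeasurableEquiv.measurable _)).aemeasurable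

/-- The integral of `f` against the density of the marks at time `t`. -/
noncomputable def densityIntegral {k : ℕ} (n : ℕ) (lam : YoungDiagram) (t : I)
    (f : (Fin k → ℤ × I) → ℝ≥0∞) : ℝ≥0∞ :=
  ∫⁻ p, f p * jumpDensity n lam t p ∂(Measure.pi fun _ => refMeasure)

lemma measurable_insertNth {k : ℕ} (i : Fin (k + 1)) :
    Measurable fun q : (ℤ × I) × (Fin k → ℤ × I) => i.insertNth (α := fun _ => ℤ × I) q.1 q.2 :=
  (MeasurableEquiv.piFinSuccAbove (fun _ => ℤ × I) i).symm.measurable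

lemma lintegral_mul_setLIntegral_jumpDensity {k n : ℕ} (lam : YoungDiagram) (t : I)
    {f : (Fin k → ℤ × I) → ℝ≥0∞} (hf : Measurable f) :
    ∫⁻ p, f p * (∫⁻ s in Iic t, jumpDensity n lam s p) ∂(Measure.pi fun _ => refMeasure) =
      ∫⁻ s in Iic t, densityIntegral n lam s f := by
  have hm := measurable_jumpDensity n k lam
  have h1 : ∀ p, f p * ∫⁻ s in Iic t, jumpDensity n lam s p =
      ∫⁻ s in Iic t, f p * jumpDensity n lam s p := fun p =>
    (lintegral_const_mul _ (hm.comp (measurable_id.prodMk measurable_const))).symm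
  simp only [h1, densityIntegral]
  rw [lintegral_lintegral_swap]
  exact ((hf.comp measurable_fst).mul (hm.comp measurable_swap)).aemeasurable

lemma measurable_mul_setLIntegral_jumpDensity {k n : ℕ} (lam : YoungDiagram) (t : I)
    {f : (Fin k → ℤ × I) → ℝ≥0∞} (hf : Measurable f) :
    Measurable fun p => f p * ∫⁻ s in Iic t, jumpDensity n lam s p :=
  hf.mul (Measurable.lintegral_prod_right ((measurable_jumpDensity n k lam).comp measurable_swap))

lemma densityIntegral_zero {n : ℕ} {lam : YoungDiagram} (hn : lam.colLen 0 ≤ n)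
    (h : lam.cells.Nonempty) (t : I) {f : (Fin 0 → ℤ × I) → ℝ≥0∞} (hf : Measurable f) :
    densityIntegral n lam t f = ∑ c ∈ corners lam, ∫⁻ s in Iic t,
      densityIntegral n (eraseCell lam c) s f := by
  simp only [densityIntegral, jumpDensity_zero hn h, Finset.mul_sum]
  rw [lintegral_finsetSum _ fun c _ => measurable_mul_setLIntegral_jumpDensity _ t hf]
  exact Finset.sum_congr rfl fun c _ => lintegral_mul_setLIntegral_jumpDensity _ t hf

/-- This mirrors `tabIntegral_succ`. In the boundary terms the content of mark i is pinned to that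
of c, so the sum over its site has one term and its time becomes s. -/
lemma densityIntegral_succ {n k : ℕ} {lam : YoungDiagram} (hn : lam.colLen 0 ≤ n) (t : I)
    {f : (Fin (k + 1) → ℤ × I) → ℝ≥0∞} (hf : Measurable f) :
    densityIntegral n lam t f = ∑ c ∈ corners lam, ∫⁻ s in Iic t,
      (densityIntegral n (eraseCell lam c) s f + ∑ i : Fin (k + 1),
        densityIntegral n (eraseCell lam c) s fun p => f (i.insertNth (content c, s) p)) := by
  classical
  set g : ℕ × ℕ → Fin (k + 1) → (Fin (k + 1) → ℤ × I) → ℝ≥0∞ := fun c i p =>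
    f p * if content c = (p i).1 ∧ (p i).2 ≤ t then
        jumpDensity n (eraseCell lam c) (p i).2 (i.removeNth p) else 0 with hg
  have hgm : ∀ c i, Measurable (g c i) := by
    intro c i
    refine hf.mul (Measurable.ite ?_ ?_ measurable_const)
    · exact (measurableSet_eq_fun measurable_const (by fun_prop)).inter
        (measurableSet_le (by fun_prop) measurable_const)
    · refine (measurable_jumpDensity n k _).comp (Measurable.prodMk (by fun_prop) ?_)
      exact measurable_pi_lambda _ fun j => measurable_pi_apply _
  have h1 : densityIntegral n lam t f = ∫⁻ p, ((∑ c ∈ corners lam, ∑ i, g c i p) +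
      ∑ c ∈ corners lam, f p * (∫⁻ s in Iic t, jumpDensity n (eraseCell lam c) s p))
      ∂(Measure.pi fun _ => refMeasure) := by
    refine lintegral_congr_ae ?_
    filter_upwards [ae_injective_times (k + 1)] with p hp
    rw [jumpDensity_succ hn t p hp, mul_add, Finset.mul_sum, Finset.mul_sum]
    simp only [Finset.mul_sum, hg]
  have h2 : ∀ c i, ∫⁻ p, g c i p ∂(Measure.pi fun _ => refMeasure) = ∫⁻ s in Iic t,
      densityIntegral n (eraseCell lam c) s fun p => f (i.insertNth (content c, s) p) := by
    intro c i
    rw [lintegral_pi_insertNth i (hgm c i), lintegral_refMeasure]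
    · rw [tsum_eq_single (content c), ← lintegral_indicator measurableSet_Iic]
      · refine lintegral_congr fun s => ?_
        simp only [hg, Fin.insertNth_apply_same, true_and, Fin.removeNth_insertNth]
        by_cases hs : s ≤ t
        · simp [hs, densityIntegral]
        · simp [hs]
      · intro x hx
        simp [hg, hx.symm]
    · exact Measurable.lintegral_prod_right ((hgm c i).comp (measurable_insertNth i))
  rw [h1, lintegral_add_left (Finset.measurable_sum _ fun c _ =>
    Finset.measurable_sum _ fun i _ => hgm c i), lintegral_finsetSum _ fun c _ =>
    Finset.measurable_sum _ fun i _ => hgm c i, lintegral_finsetSum _ fun c _ =>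
    measurable_mul_setLIntegral_jumpDensity _ t hf, ← Finset.sum_add_distrib]
  refine Finset.sum_congr rfl fun c _ => ?_
  rw [lintegral_mul_setLIntegral_jumpDensity _ t hf, lintegral_finsetSum _ fun i _ => hgm c i,
    lintegral_add_left, lintegral_finsetSum, add_comm]
  · simp only [h2]
  · intro i _
    refine Measurable.lintegral_prod_right' (f := fun q : I × (Fin k → ℤ × I) =>
      f (i.insertNth (content c, q.1) q.2) * jumpDensity n (eraseCell lam c) q.1 q.2) ?_
    exact (hf.comp ((measurable_insertNth i).comp
      ((measurable_const.prodMk measurable_fst).prodMk measurable_snd))).mul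
      (measurable_jumpDensity n k _)
  · refine Measurable.lintegral_prod_right' (f := fun q : I × (Fin (k + 1) → ℤ × I) =>
      f q.2 * jumpDensity n (eraseCell lam c) q.1 q.2) ?_
    exact (hf.comp measurable_snd).mul (measurable_jumpDensity n (k + 1) _)

/-- Both sides satisfy the same recursion over corners. The only base case is the empty diagram
without marks, since with at least one mark the recursion holds for the empty diagram as well. -/
theorem tabIntegral_eq_densityIntegral {n k : ℕ} (lam : YoungDiagram) (hn : lam.colLen 0 ≤ n)
    (t : I) {f : (Fin k → ℤ × I) → ℝ≥0∞} (hf : Measurable f) (x : ℕ × ℕ → I) :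
    tabIntegral lam t f x = densityIntegral n lam t f := by
  induction hm : lam.cells.card using Nat.strong_induction_on generalizing lam k t x with
  | _ m ih =>
  subst hm
  have ih' : ∀ c ∈ corners lam, ∀ {k : ℕ} (s : I) {f : (Fin k → ℤ × I) → ℝ≥0∞}, Measurable f →
      ∀ x, tabIntegral (eraseCell lam c) s f x = densityIntegral n (eraseCell lam c) s f :=
    fun c hc _ s _ hf x => ih _ (card_eraseCell_lt hc) _
      ((colLen_eraseCell_le lam c 0).trans hn) s hf x rfl
  rcases k with _ | k
  · rcases lam.cells.eq_empty_or_nonempty with h | h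
    · have h1 : ∀ p : Fin 0 → ℤ × I, jumpDensity n lam t p = 1 := fun p => by
        simp [jumpDensity, jumpDet_of_cells_eq_empty h]
      have h2 : (tabSet lam t) = univ := by
        ext T
        simp [tabSet, h, MonotoneOn]
      have h3 : pointSum lam f = fun _ => f default := funext (pointSum_zero lam f)
      have h4 : ∀ p, f p = f default := fun p => congrArg f (Subsingleton.elim _ _)
      simp only [tabIntegral, h2, h3, densityIntegral, h1, indicator_univ, mul_one, lmarginal]
      simp [h4]
    · rw [tabIntegral_zero h t hf, densityIntegral_zero hn h t hf]
      refine Finset.sum_congr rfl fun c hc => lintegral_congr fun s => ih' c hc s hf _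
  · rw [tabIntegral_succ lam t hf, densityIntegral_succ hn t hf]
    refine Finset.sum_congr rfl fun c hc => lintegral_congr fun s => ?_
    rw [ih' c hc s hf]
    congr 1
    refine Finset.sum_congr rfl fun i _ => ih' c hc s ?_ _
    exact hf.comp ((measurable_insertNth i).comp (measurable_const.prodMk measurable_id))

/-! ### The correlation kernel as a finite sum -/

/-- The positions of the particles, shifted to be natural numbers. -/
def shiftedPosition (n : ℕ) (lam : YoungDiagram) (a : Fin n) : ℕ := lam.rowLen a + (n - 1 - a)

lemma shiftedPosition_cast {n : ℕ} (lam : YoungDiagram) (a : Fin n) :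
    (shiftedPosition n lam a : ℤ) = positions n lam a + n := by
  have := a.2
  simp only [shiftedPosition, positions]
  lia

lemma shiftedPosition_injective (n : ℕ) (lam : YoungDiagram) :
    Function.Injective (shiftedPosition n lam) := by
  intro a b h
  refine (positions_strictAnti n lam).injective ?_
  have h1 := shiftedPosition_cast lam a
  have h2 := shiftedPosition_cast lam b
  lia

/-- The coefficients that express the weights of arbitrary final positions by those of the
positions of `lam`. -/
noncomputable def interpCoeff (n : ℕ) (lam : YoungDiagram) (v : ℕ) (a : Fin n) : ℝ :=
  ((shiftedPosition n lam a).factorial : ℝ) / v.factorial *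
    (Lagrange.basis Finset.univ (fun b => (shiftedPosition n lam b : ℝ)) a).eval (v : ℝ)

/-- Up to 1/v! the weight is a falling factorial, a polynomial of degree m in v; this is what makes
interpolation available. -/
lemma expCoeff_one_sub (v m : ℕ) :
    expCoeff 1 ((v : ℤ) - m) = (descPochhammer ℝ m).eval (v : ℝ) / v.factorial := by
  rw [descPochhammer_eval_eq_descFactorial]
  rcases lt_or_ge v m with h | h
  · rw [expCoeff_of_neg _ (by lia), Nat.descFactorial_of_lt h]
    simp
  · rw [← Nat.cast_sub h, expCoeff_natCast, ← Nat.factorial_mul_descFactorial h]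
    have h1 : ((v - m).factorial : ℝ) ≠ 0 := Nat.cast_ne_zero.2 (Nat.factorial_ne_zero _)
    have h2 : (v.descFactorial m : ℝ) ≠ 0 :=
      Nat.cast_ne_zero.2 (by rw [Ne, Nat.descFactorial_eq_zero_iff_lt]; lia)
    push_cast
    field_simp
    simp

/-- Lagrange interpolation at n nodes is exact on polynomials of degree m < n. -/
lemma sum_interpCoeff (n : ℕ) (lam : YoungDiagram) (v : ℕ) {m : ℕ} (hm : m < n) :
    ∑ a, interpCoeff n lam v a * expCoeff 1 ((shiftedPosition n lam a : ℤ) - m) =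
      expCoeff 1 ((v : ℤ) - m) := by
  have hinj : Set.InjOn (fun b => (shiftedPosition n lam b : ℝ)) (Finset.univ : Finset (Fin n)) :=
    fun a _ b _ h => shiftedPosition_injective n lam (Nat.cast_injective h)
  have h := Lagrange.eq_interpolate (f := descPochhammer ℝ m) hinj (by
    rw [Polynomial.degree_eq_natDegree (monic_descPochhammer ℝ m).ne_zero,
      descPochhammer_natDegree]
    simpa using hm)
  have h2 := congrArg (Polynomial.eval (v : ℝ)) h
  rw [Lagrange.interpolate_apply, Polynomial.eval_finsetSum] at h2
  simp only [Polynomial.eval_mul, Polynomial.eval_C] at h2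
  rw [expCoeff_one_sub, h2, Finset.sum_div]
  refine Finset.sum_congr rfl fun a _ => ?_
  rw [expCoeff_one_sub, interpCoeff]
  have h1 : ((shiftedPosition n lam a).factorial : ℝ) ≠ 0 :=
    Nat.cast_ne_zero.2 (Nat.factorial_ne_zero _)
  field_simp

/-- The semigroup law of the weights. It is a polynomial identity in s and t, so negative times are
allowed; it is applied with s = t₁ - 1. -/
lemma expCoeff_add_sub (s t : ℝ) (N m : ℕ) : expCoeff (s + t) ((N : ℤ) - m) =
    ∑ v ∈ Finset.range (N + 1), expCoeff s ((N : ℤ) - v) * expCoeff t ((v : ℤ) - m) := by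
  rcases lt_or_ge N m with h | h
  · rw [expCoeff_of_neg _ (by lia), Finset.sum_eq_zero]
    intro v hv
    have := Finset.mem_range.1 hv
    rw [expCoeff_of_neg t (by lia), mul_zero]
  · obtain ⟨d, rfl⟩ := Nat.exists_eq_add_of_le h
    rw [add_assoc, Finset.sum_range_add, Finset.sum_eq_zero, zero_add]
    · rw [show ((m + d : ℕ) : ℤ) - m = (d : ℕ) by push_cast; ring, expCoeff_add]
      refine Finset.sum_congr rfl fun j _ => ?_
      congr 2 <;> push_cast <;> ring
    · intro v hv
      have := Finset.mem_range.1 hv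
      rw [expCoeff_of_neg t (by lia), mul_zero]

/-- The part of the kernel that comes from the final positions. -/
noncomputable def finalKernel (n : ℕ) (lam : YoungDiagram) (x₁ : ℤ) (t₁ : ℝ) (x₂ : ℤ) (t₂ : ℝ) :
    ℝ :=
  ∑ a : Fin n, (∑ v ∈ Finset.range ((x₁ - 1 + n).toNat + 1),
    expCoeff (t₁ - 1) (((x₁ - 1 + n).toNat : ℤ) - v) * interpCoeff n lam v a) *
      expCoeff (1 - t₂) (positions n lam a - x₂)

/-- The correlation kernel, for contents larger than `-n`. -/
noncomputable def markKernel (n : ℕ) (lam : YoungDiagram) (p q : ℤ × I) : ℝ :=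
  finalKernel n lam p.1 p.2 q.1 q.2 -
    if q.2 < p.2 then expCoeff (p.2 - q.2) (p.1 - 1 - q.1) else 0

lemma expCoeff_position_add {n : ℕ} (lam : YoungDiagram) (t : ℝ) (a j : Fin n) :
    expCoeff t (positions n lam a + ((j : ℤ) + 1)) =
      expCoeff t ((shiftedPosition n lam a : ℤ) - (n - 1 - j : ℕ)) := by
  rw [shiftedPosition_cast]
  congr 1
  have := j.2
  lia

/-- By interpolation, the matrix of the empty diagram, whose determinant is 1, has the matrix of
`lam` as a factor. -/
lemma jumpDet_fin_zero_ne_zero (n : ℕ) (lam : YoungDiagram) :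
    jumpDet (positions n lam) 1 (default : Fin 0 → ℤ × I) ≠ 0 := by
  have h1 := jumpDet_of_cells_eq_empty (n := n) (lam := ⊥) rfl 1 default
  have h2 : (Matrix.of fun i j : Fin n => expCoeff 1 (positions n ⊥ i + ((j : ℤ) + 1))) =
      (Matrix.of fun i a : Fin n => interpCoeff n lam (shiftedPosition n ⊥ i) a) *
      Matrix.of fun a j : Fin n => expCoeff 1 (positions n lam a + ((j : ℤ) + 1)) := by
    ext i j
    have := j.2
    simp only [Matrix.mul_apply, Matrix.of_apply, expCoeff_position_add]
    exact (sum_interpCoeff n lam _ (by lia)).symm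
  rw [jumpDet_fin_zero, h2, Matrix.det_mul] at h1
  rw [jumpDet_fin_zero]
  exact right_ne_zero_of_mul (h1.trans_ne one_ne_zero)

/-- Block elimination against the particle block A: since C = Q A, the Schur complement is D - Q B,
minus the kernel matrix, and this sign cancels the prefactor (-1)^k. -/
lemma jumpDet_eq_mul_det {n k : ℕ} (lam : YoungDiagram) (p : Fin k → ℤ × I)
    (hp : ∀ a, -(n : ℤ) < (p a).1) : jumpDet (positions n lam) 1 p =
      jumpDet (positions n lam) 1 (default : Fin 0 → ℤ × I) *
        (Matrix.of fun a b => markKernel n lam (p a) (p b)).det := by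
  set A : Matrix (Fin n) (Fin n) ℝ :=
    Matrix.of fun i j => expCoeff 1 (positions n lam i + ((j : ℤ) + 1)) with hA
  set B : Matrix (Fin n) (Fin k) ℝ :=
    Matrix.of fun i b => expCoeff (1 - (p b).2) (positions n lam i - (p b).1) with hB
  set C : Matrix (Fin k) (Fin n) ℝ :=
    Matrix.of fun a j => expCoeff (p a).2 ((p a).1 - 1 + ((j : ℤ) + 1)) with hC
  set D : Matrix (Fin k) (Fin k) ℝ := Matrix.of fun a b => if (p b).2 < (p a).2 then
      expCoeff ((p a).2 - (p b).2) ((p a).1 - 1 - (p b).1) else 0 with hD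
  set Q : Matrix (Fin k) (Fin n) ℝ := Matrix.of fun a i =>
    ∑ v ∈ Finset.range (((p a).1 - 1 + n).toNat + 1),
      expCoeff ((p a).2 - 1) ((((p a).1 - 1 + n).toNat : ℤ) - v) * interpCoeff n lam v i with hQ
  -- A mark row at time s is carried to time 1 through the negative time s - 1 and then
  -- interpolated. The content exceeds -n, so `toNat` loses nothing.
  have hCQ : C = Q * A := by
    ext a j
    have hj := j.2
    have ha := hp a
    simp only [hC, hQ, hA, Matrix.mul_apply, Matrix.of_apply, expCoeff_position_add,
      Finset.sum_mul]
    rw [Finset.sum_comm]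
    simp only [mul_assoc, ← Finset.mul_sum]
    simp only [sum_interpCoeff n lam _ (show n - 1 - (j : ℕ) < n by lia)]
    rw [← expCoeff_add_sub, sub_add_cancel]
    congr 1
    lia
  have hfac : jumpMatrix (positions n lam) 1 p =
      Matrix.fromBlocks 1 0 Q 1 * Matrix.fromBlocks A B 0 (D - Q * B) := by
    rw [Matrix.fromBlocks_multiply]
    simp only [one_mul, add_zero, Matrix.one_mul, Matrix.zero_mul,
      Matrix.mul_zero, add_sub_cancel]
    rw [← hCQ]
    rfl
  have hK : (Matrix.of fun a b => markKernel n lam (p a) (p b)) = -(D - Q * B) := by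
    ext a b
    simp [markKernel, finalKernel, hD, hQ, hB, Matrix.mul_apply]
  rw [jumpDet, hfac, Matrix.det_mul, Matrix.det_fromBlocks_zero₁₂, Matrix.det_fromBlocks_zero₂₁,
    jumpDet_fin_zero, hK, Matrix.det_neg, Fintype.card_fin, Matrix.det_one, Matrix.det_one]
  ring

/-! ### Evaluation of the double contour integral -/

/-- The residue theorem for an entire function divided by linear factors with integer roots and
one further linear factor. -/
lemma Contour.integral_entire_div_prod_mul {C : Contour} {f : ℂ → ℂ} (hf : Differentiable ℂ f)
    (S : Finset ℤ) {a : ℂ} (ha : ∀ p ∈ S, (p : ℂ) ≠ a) (hC : ∀ p ∈ S, (p : ℂ) ∉ C.trace)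
    (haC : a ∉ C.trace) :
    C.integral (fun z => f z / ((∏ p ∈ S, (z - p)) * (z - a))) = 2 * Real.pi * Complex.I *
      (C.winding a * (f a / ∏ p ∈ S, (a - p)) +
        ∑ p ∈ S, C.winding p * (f p / ((∏ q ∈ S.erase p, ((p : ℂ) - q)) * (p - a)))) := by
  set v : Option ℤ → ℂ := fun o => o.elim a fun p => (p : ℂ) with hv
  have hinj : Set.InjOn v (Finset.insertNone S) := by
    rintro (_ | p) hp (_ | q) hq h
    · rfl
    · exact absurd h.symm (ha q (by simpa using hq))
    · exact absurd h (ha p (by simpa using hp))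
    · have : (p : ℂ) = q := h
      rw [Int.cast_injective this]
  have h := Contour.integral_entire_div_prod (C := C) hf (Finset.insertNone S) v hinj (by
    rintro (_ | p) hp
    · exact haC
    · exact hC p (by simpa using hp))
  have he : (Finset.insertNone S).erase none = S.map Function.Embedding.some := by
    ext (_ | p) <;> simp
  have he' : ∀ p, (Finset.insertNone S).erase (some p) = Finset.insertNone (S.erase p) := by
    intro p
    ext (_ | q) <;> simp
  simp only [Finset.prod_insertNone, Finset.sum_insertNone, he, he', Finset.prod_map] at h
  simp only [hv, Option.elim_none, Option.elim_some, Function.Embedding.some_apply] at h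
  simpa only [mul_comm] using h

lemma prod_Ico_int {M : Type*} [CommMonoid M] (e : ℤ) (f : ℤ → M) :
    ∏ k ∈ Finset.Ico 0 e, f k = ∏ k ∈ Finset.range e.toNat, f k := by
  refine Finset.prod_bij' (fun k _ => k.toNat) (fun k _ => (k : ℤ)) ?_ ?_ ?_ ?_ ?_ <;>
    simp only [Finset.mem_Ico, Finset.mem_range] <;> intro k hk
  · lia
  · lia
  · lia
  · lia
  · rw [Int.toNat_of_nonneg hk.1]

/-- Repeated use of the functional equation; at most one of the two products is nonempty, according
to the sign of d. -/
lemma Gamma_add_intCast_div {z : ℂ} (hz : ∀ k : ℤ, z ≠ k) (d : ℤ) :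
    Complex.Gamma (z + 1 + d) / Complex.Gamma (z + 1) =
      (∏ k ∈ Finset.Ico 0 d, (z + 1 + k)) / ∏ k ∈ Finset.Ico 0 (-d), (z - k) := by
  have hne : ∀ m : ℤ, Complex.Gamma (z + m) ≠ 0 := fun m => Complex.Gamma_ne_zero fun k h =>
    hz (-k - m) (by push_cast; linear_combination h)
  have hz1 : ∀ m : ℤ, ∀ k : ℤ, z + m ≠ k := fun m k h =>
    hz (k - m) (by push_cast; linear_combination h)
  rw [prod_Ico_int, prod_Ico_int]
  rcases le_total 0 d with h | h
  · lift d to ℕ using h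
    have h1 := Gamma_add_natCast (fun k => by simpa using hz1 1 k) d
    have h2 : Complex.Gamma (z + 1) ≠ 0 := by simpa using hne 1
    rw [Int.cast_natCast, h1, mul_div_cancel_right₀ _ h2]
    simp
  · obtain ⟨N, rfl⟩ : ∃ N : ℕ, d = -N := ⟨(-d).toNat, by lia⟩
    have h1 := Gamma_add_natCast (hz1 (1 - N)) N
    have h2 := hne (1 - N)
    have e1 : z + ((1 - N : ℤ) : ℂ) + N = z + 1 := by push_cast; ring
    have e2 : z + 1 + ((-N : ℤ) : ℂ) = z + ((1 - N : ℤ) : ℂ) := by push_cast; ring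
    rw [e1] at h1
    rw [e2, h1, div_mul_cancel_right₀ h2, ← Finset.prod_range_reflect]
    simp only [neg_neg, Int.toNat_natCast, Int.toNat_neg_natCast, Finset.range_zero,
      Finset.prod_empty, one_div]
    congr 1
    refine Finset.prod_congr rfl fun k hk => ?_
    have := Finset.mem_range.1 hk
    rw [show N - 1 - k = N - (1 + k) by lia, Nat.cast_sub (by lia)]
    push_cast
    ring

/-- The numerator of the integrand as a function of `z`. -/
noncomputable def zNumerator {R : Type*} [CommRing R] (n : ℕ) (x₂ : ℤ) (z : R) : R :=
  ∏ k ∈ Finset.Ico 0 (x₂ + n), (z + 1 + (k : R))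

/-- The possible poles of the integrand as a function of `z`. -/
noncomputable def zPoles (lam : YoungDiagram) (n : ℕ) (x₂ : ℤ) : Finset ℤ :=
  (Finset.univ.image fun a : Fin n => positions n lam a - x₂) ∪ Finset.Ico 0 (-(x₂ + n))

/-- The numerator of the integrand as a function of `w`. -/
noncomputable def wNumerator {R : Type*} [CommRing R] (lam : YoungDiagram) (n : ℕ) (x₁ : ℤ) (w : R) : R :=
  (-1) ^ (x₁ + n).toNat * (∏ k ∈ Finset.Ico 0 (-(x₁ + n)), (-w - 1 - (k : R))) *
    ∏ a : Fin n, ((x₁ : R) - 1 - w - (positions n lam a : R))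

lemma neg_le_positions {n : ℕ} (lam : YoungDiagram) (a : Fin n) : -(n : ℤ) ≤ positions n lam a := by
  have := a.2
  simp only [positions]
  lia

/-- Positions are at least -n, so the two families of poles are disjoint and all these poles are
simple. -/
lemma zPoles_prod {R : Type*} [CommRing R] (lam : YoungDiagram) (n : ℕ) (x₂ : ℤ) (z : R) :
    ∏ p ∈ zPoles lam n x₂, (z - (p : R)) =
      (∏ a : Fin n, (z - ((positions n lam a - x₂ : ℤ) : R))) *
        ∏ k ∈ Finset.Ico 0 (-(x₂ + n)), (z - (k : R)) := by
  rw [zPoles, Finset.prod_union, Finset.prod_image]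
  · intro a _ b _ h
    exact (positions_strictAnti n lam).injective (sub_left_injective h)
  · rw [Finset.disjoint_left]
    intro p hp hp'
    obtain ⟨a, -, rfl⟩ := Finset.mem_image.1 hp
    have := neg_le_positions lam a
    have := (Finset.mem_Ico.1 hp').2
    lia

lemma G_div_Gamma {lam : YoungDiagram} {n : ℕ} {x₂ : ℤ} {z : ℂ} (hz : ∀ k : ℤ, z ≠ k) :
    G lam n (z + x₂) / Complex.Gamma (z + 1) =
      zNumerator n x₂ z / ∏ p ∈ zPoles lam n x₂, (z - (p : ℂ)) := by
  have h := Gamma_add_intCast_div hz (x₂ + n)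
  have e : z + x₂ + 1 + n = z + 1 + ((x₂ + n : ℤ) : ℂ) := by push_cast; ring
  have e2 : ∏ i ∈ Finset.range n, (z + x₂ - (lam.rowLen i : ℂ) + ((i : ℂ) + 1)) =
      ∏ a : Fin n, (z - ((positions n lam a - x₂ : ℤ) : ℂ)) := by
    rw [Finset.prod_range]
    refine Finset.prod_congr rfl fun a _ => ?_
    simp only [positions]
    push_cast
    ring
  rw [G, e, e2, div_right_comm, h, zPoles_prod, zNumerator, div_div, mul_comm (∏ _ ∈ _, _)]

lemma Gamma_div_G {lam : YoungDiagram} {n : ℕ} {x₁ : ℤ} {w : ℂ} (hw : ∀ k : ℤ, w ≠ k) :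
    Complex.Gamma (-w) / G lam n ((x₁ : ℂ) - 1 - w) =
      wNumerator lam n x₁ w / ∏ k ∈ Finset.Ico 0 (x₁ + n), (w - (k : ℂ)) := by
  have hw' : ∀ k : ℤ, -w - 1 ≠ k := fun k h => hw (-k - 1) (by push_cast; linear_combination -h)
  have h := Gamma_add_intCast_div hw' (x₁ + n)
  rw [sub_add_cancel] at h
  have e : (x₁ : ℂ) - 1 - w + 1 + n = -w + ((x₁ + n : ℤ) : ℂ) := by push_cast; ring
  have e2 : ∏ i ∈ Finset.range n, ((x₁ : ℂ) - 1 - w - (lam.rowLen i : ℂ) + ((i : ℂ) + 1)) =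
      ∏ a : Fin n, ((x₁ : ℂ) - 1 - w - (positions n lam a : ℂ)) := by
    rw [Finset.prod_range]
    refine Finset.prod_congr rfl fun a _ => ?_
    simp only [positions]
    push_cast
    ring
  have e3 : ∏ k ∈ Finset.Ico 0 (x₁ + n), (-w + (k : ℂ)) =
      (-1) ^ (x₁ + n).toNat * ∏ k ∈ Finset.Ico 0 (x₁ + n), (w - (k : ℂ)) := by
    have : ((Finset.Ico 0 (x₁ + n)).card) = (x₁ + n).toNat := by simp
    rw [← this, ← Finset.prod_const, ← Finset.prod_mul_distrib]
    exact Finset.prod_congr rfl fun k _ => by ring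
  have h4 : ((-1 : ℂ) ^ (x₁ + n).toNat)⁻¹ = (-1) ^ (x₁ + n).toNat := by
    rw [← inv_pow]; norm_num
  rw [G, e, e2, div_div_eq_mul_div, mul_div_right_comm, ← inv_div (Complex.Gamma _), h, e3, inv_div,
    wNumerator, ← div_div, div_eq_mul_inv _ ((-1 : ℂ) ^ _), h4]
  ring

/-- The coefficients of the residues in `w`. -/
noncomputable def wCoeff (lam : YoungDiagram) (n : ℕ) (x₁ : ℤ) (k : ℤ) : ℝ :=
  (wNumerator lam n x₁ k : ℤ) / ((∏ q ∈ (Finset.Ico 0 (x₁ + n)).erase k, (k - q) : ℤ) : ℝ)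

/-- The residue in `z` at a pole, as a function of the other factors. -/
noncomputable def zTerm (lam : YoungDiagram) (n : ℕ) (x₂ p : ℤ) (τ : ℝ) : ℝ :=
  if p ∈ Ico 0 ((lam.rowLen 0 : ℤ) - x₂) then (zNumerator n x₂ p : ℤ) * τ ^ p.toNat else 0

/-- The value of the double contour integral. -/
noncomputable def doubleSum (lam : YoungDiagram) (n : ℕ) (x₁ x₂ : ℤ) (τ₁ τ₂ : ℝ) : ℝ :=
  ∑ k ∈ Finset.Ico 0 (x₁ + n), wCoeff lam n x₁ k * τ₁ ^ k.toNat *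
    (zTerm lam n x₂ (x₁ - x₂ - 1 - k) τ₂ /
        ((∏ p ∈ zPoles lam n x₂, (x₁ - x₂ - 1 - k - p) : ℤ) : ℝ) +
      ∑ p ∈ zPoles lam n x₂, zTerm lam n x₂ p τ₂ /
        (((∏ q ∈ (zPoles lam n x₂).erase p, (p - q)) * (p - (x₁ - x₂ - 1 - k)) : ℤ) : ℝ))

/-- The residue at w = k leaves the factor 1/(z - (x₁-x₂-1-k)), which could collide with a pole in
z. In that case x₁ - 1 - k is a position, hence k is a root of the numerator in w. The other family
of poles lies too low to be hit. -/
lemma wCoeff_eq_zero_of_mem {lam : YoungDiagram} {n : ℕ} {x₁ x₂ k : ℤ}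
    (hk : k ∈ Finset.Ico 0 (x₁ + n)) (h : x₁ - x₂ - 1 - k ∈ zPoles lam n x₂) :
    wCoeff lam n x₁ k = 0 := by
  have hk := Finset.mem_Ico.1 hk
  rcases Finset.mem_union.1 h with h | h
  · obtain ⟨a, -, ha⟩ := Finset.mem_image.1 h
    have : (wNumerator lam n x₁ k : ℤ) = 0 := by
      rw [wNumerator, Finset.prod_eq_zero (Finset.mem_univ a), mul_zero]
      simp only [Int.cast_id]
      lia
    rw [wCoeff, this]
    simp
  · have := Finset.mem_Ico.1 h
    lia

lemma zNumerator_intCast (n : ℕ) (x₂ p : ℤ) :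
    zNumerator n x₂ (p : ℂ) = ((zNumerator n x₂ p : ℤ) : ℂ) := by
  simp [zNumerator]

lemma wNumerator_intCast (lam : YoungDiagram) (n : ℕ) (x₁ k : ℤ) :
    wNumerator lam n x₁ (k : ℂ) = ((wNumerator lam n x₁ k : ℤ) : ℂ) := by
  simp [wNumerator]

lemma ofReal_cpow_intCast {τ : ℝ} {p : ℤ} (hp : 0 ≤ p) : (τ : ℂ) ^ (p : ℂ) = ((τ ^ p.toNat : ℝ) : ℂ) := by
  lift p to ℕ using hp
  simp

lemma differentiable_cpow {τ : ℝ} (hτ : 0 < τ) : Differentiable ℂ fun z : ℂ => (τ : ℂ) ^ z :=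
  fun z => differentiableAt_id.const_cpow (Or.inl (by exact_mod_cast hτ.ne'))

lemma differentiable_zNumerator (n : ℕ) (x₂ : ℤ) : Differentiable ℂ (zNumerator n x₂ : ℂ → ℂ) := by
  unfold zNumerator
  fun_prop

lemma differentiable_wNumerator (lam : YoungDiagram) (n : ℕ) (x₁ : ℤ) :
    Differentiable ℂ (wNumerator lam n x₁ : ℂ → ℂ) := by
  unfold wNumerator
  fun_prop

lemma Contour.Encloses.winding_intCast {C : Contour} {b : ℤ} (h : C.Encloses 0 b) (p : ℤ) :
    C.winding p = if p ∈ Ico 0 b then 1 else 0 := by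
  split_ifs with hp
  · exact h.2.1 p hp
  · exact h.2.2 p hp

lemma winding_mul_zNumerator {lam : YoungDiagram} {n : ℕ} {x₂ : ℤ} {C : Contour}
    (h : C.Encloses 0 ((lam.rowLen 0 : ℤ) - x₂)) (p : ℤ) (τ : ℝ) (c : ℂ) :
    C.winding p * (zNumerator n x₂ (p : ℂ) * (τ : ℂ) ^ (p : ℂ) / c) =
      (zTerm lam n x₂ p τ : ℂ) / c := by
  rw [h.winding_intCast, zTerm]
  split_ifs with hp
  · rw [one_mul, zNumerator_intCast, ofReal_cpow_intCast hp.1]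
    push_cast
    rfl
  · simp

/-- Residues are taken in w first: the moving pole has winding number 0 by admissibility, so only
the integers of [0, n + x₁) count. Then the z-integral picks up the enclosed integer poles.
Positivity of 1 - t₁ and 1 - t₂ makes the powers entire. -/
lemma doubleIntegral_eq {lam : YoungDiagram} {n : ℕ} {x₁ x₂ : ℤ} {Cz Cw : Contour}
    (h : Admissible lam n x₁ x₂ Cz Cw) {t₁ t₂ : ℝ} (h₁ : t₁ < 1) (h₂ : t₂ < 1) :
    doubleIntegral lam n Cz Cw x₁ t₁ x₂ t₂ = doubleSum lam n x₁ x₂ (1 - t₁) (1 - t₂) := by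
  obtain ⟨hz, hw, ⟨δ, hδ, hδ'⟩, hwind⟩ := h
  have hnez : ∀ z ∈ Cz.trace, ∀ k : ℤ, z ≠ k := fun z h k hk => hz.1 k (hk ▸ h)
  have hnew : ∀ w ∈ Cw.trace, ∀ k : ℤ, w ≠ k := fun w h k hk => hw.1 k (hk ▸ h)
  set τ₁ := 1 - t₁ with hτ₁
  set τ₂ := 1 - t₂ with hτ₂
  have hp₁ : 0 < τ₁ := sub_pos.2 h₁
  have hp₂ : 0 < τ₂ := sub_pos.2 h₂
  have hpi : (2 * Real.pi * Complex.I : ℂ) ≠ 0 := by simp [Real.pi_ne_zero]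
  have hdw : Differentiable ℂ fun w : ℂ => wNumerator lam n x₁ w * (τ₁ : ℂ) ^ w :=
    (differentiable_wNumerator lam n x₁).mul (differentiable_cpow hp₁)
  have hdz : Differentiable ℂ fun z : ℂ => zNumerator n x₂ z * (τ₂ : ℂ) ^ z :=
    (differentiable_zNumerator n x₂).mul (differentiable_cpow hp₂)
  set E := Finset.Ico 0 (x₁ + n) with hE
  set P := zPoles lam n x₂ with hP
  have hinner : ∀ z ∈ Cz.trace, (Cw.integral fun w =>
      Complex.Gamma (-w) / Complex.Gamma (z + 1) *
        (G lam n (z + x₂) / G lam n ((x₁ : ℂ) - 1 - w)) *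
        (((τ₂ : ℂ) ^ z * (τ₁ : ℂ) ^ w) / (w + z + (x₂ : ℂ) - (x₁ : ℂ) + 1))) =
      ∑ k ∈ E, 2 * Real.pi * Complex.I * ((wCoeff lam n x₁ k * τ₁ ^ k.toNat : ℝ) : ℂ) *
        (zNumerator n x₂ z * (τ₂ : ℂ) ^ z /
          ((∏ p ∈ P, (z - (p : ℂ))) * (z - ((x₁ - x₂ - 1 - k : ℤ) : ℂ)))) := by
    intro z hzt
    set w₀ := (x₁ : ℂ) - x₂ - 1 - z with hw₀
    have hw₀C : w₀ ∉ Cw.trace := by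
      intro hmem
      have := hδ' z hzt w₀ hmem
      rw [show w₀ + z + (x₂ : ℂ) - x₁ + 1 = 0 by rw [hw₀]; ring, norm_zero] at this
      exact absurd this (not_le.2 hδ)
    -- z is not an integer, hence neither is w₀, and it differs from the other poles.
    have hw₀E : ∀ k ∈ E, ((k : ℤ) : ℂ) ≠ w₀ := fun k _ hk => by
      rw [hw₀] at hk
      exact hnez z hzt (x₁ - x₂ - 1 - k) (by push_cast; linear_combination hk)
    have h1 : ∀ w ∈ Cw.trace, Complex.Gamma (-w) / Complex.Gamma (z + 1) *
        (G lam n (z + x₂) / G lam n ((x₁ : ℂ) - 1 - w)) *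
        (((τ₂ : ℂ) ^ z * (τ₁ : ℂ) ^ w) / (w + z + (x₂ : ℂ) - (x₁ : ℂ) + 1)) =
        (zNumerator n x₂ z * (τ₂ : ℂ) ^ z / ∏ p ∈ P, (z - (p : ℂ))) *
          (wNumerator lam n x₁ w * (τ₁ : ℂ) ^ w / ((∏ k ∈ E, (w - (k : ℂ))) * (w - w₀))) := by
      intro w hwt
      have e1 := G_div_Gamma (lam := lam) (n := n) (x₂ := x₂) (hnez z hzt)
      have e2 := Gamma_div_G (lam := lam) (n := n) (x₁ := x₁) (hnew w hwt)
      have e3 : w + z + (x₂ : ℂ) - x₁ + 1 = w - w₀ := by rw [hw₀]; ring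
      calc _ = (G lam n (z + x₂) / Complex.Gamma (z + 1)) *
            (Complex.Gamma (-w) / G lam n ((x₁ : ℂ) - 1 - w)) *
            (((τ₂ : ℂ) ^ z * (τ₁ : ℂ) ^ w) / (w - w₀)) := by rw [e3]; ring
        _ = _ := by rw [e1, e2, ← div_div]; ring
    rw [Contour.integral_congr h1, Contour.integral_const_mul,
      Contour.integral_entire_div_prod_mul hdw E hw₀E
        (fun p _ => hw.1 p) hw₀C, hwind z hzt, zero_mul, zero_add, Finset.mul_sum, Finset.mul_sum]
    refine Finset.sum_congr rfl fun k hk => ?_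
    have hk' := Finset.mem_Ico.1 hk
    have e4 : (k : ℂ) - w₀ = z - ((x₁ - x₂ - 1 - k : ℤ) : ℂ) := by rw [hw₀]; push_cast; ring
    rw [hw.winding_intCast, if_pos ⟨hk'.1, by lia⟩, one_mul, e4, wNumerator_intCast,
      ofReal_cpow_intCast hk'.1, wCoeff]
    push_cast
    rw [← div_div, ← div_div]
    ring
  rw [doubleIntegral, Contour.integral_congr hinner, Contour.integral_sum]
  · rw [Finset.mul_sum, doubleSum, Complex.ofReal_sum]
    refine Finset.sum_congr rfl fun k hk => ?_
    rw [Contour.integral_const_mul]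
    -- A vanishing coefficient disposes of every k for which the z-integrand could have a double
    -- pole.
    by_cases hk0 : wCoeff lam n x₁ k = 0
    · simp [hk0]
    have hm : x₁ - x₂ - 1 - k ∉ P := fun hmem => hk0 (wCoeff_eq_zero_of_mem hk hmem)
    have hm' : ∀ p ∈ P, (p : ℂ) ≠ ((x₁ - x₂ - 1 - k : ℤ) : ℂ) := fun p hp hpe => by
      rw [Int.cast_injective hpe] at hp
      exact hm hp
    rw [Contour.integral_entire_div_prod_mul hdz P hm' (fun p _ => hz.1 p) (hz.1 _)]
    simp only [winding_mul_zNumerator hz]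
    push_cast
    field_simp
    rfl
  · intro k _
    refine continuousOn_const.mul (hdz.continuous.continuousOn.div ?_ ?_)
    · fun_prop
    · intro z hzt
      exact mul_ne_zero (Finset.prod_ne_zero_iff.2 fun p _ => sub_ne_zero.2 (hnez z hzt p))
        (sub_ne_zero.2 (hnez z hzt _))

/-- The residue sum is a polynomial in both variables, with 0^0 = 1, and so provides the limits at
time 1. -/
lemma continuous_doubleSum (lam : YoungDiagram) (n : ℕ) (x₁ x₂ : ℤ) :
    Continuous fun q : ℝ × ℝ => doubleSum lam n x₁ x₂ q.1 q.2 := by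
  have hz : ∀ p, Continuous fun q : ℝ × ℝ => zTerm lam n x₂ p q.2 := by
    intro p
    unfold zTerm
    split_ifs <;> fun_prop
  unfold doubleSum
  refine continuous_finsetSum _ fun k _ => Continuous.mul (by fun_prop) (Continuous.add ?_ ?_)
  · exact (hz _).div_const _
  · exact continuous_finsetSum _ fun p _ => (hz p).div_const _

lemma tendsto_doubleIntegral {lam : YoungDiagram} {n : ℕ} {x₁ x₂ : ℤ} {Cz Cw : Contour}
    (h : Admissible lam n x₁ x₂ Cz Cw) (t₁ t₂ : ℝ) :
    Tendsto (fun p : ℝ × ℝ => doubleIntegral lam n Cz Cw x₁ p.1 x₂ p.2)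
      (𝓝[Ico (0 : ℝ) 1 ×ˢ Ico (0 : ℝ) 1] (t₁, t₂))
      (𝓝 ((doubleSum lam n x₁ x₂ (1 - t₁) (1 - t₂) : ℝ) : ℂ)) := by
  have hc : Continuous fun p : ℝ × ℝ =>
      ((doubleSum lam n x₁ x₂ (1 - p.1) (1 - p.2) : ℝ) : ℂ) :=
    Complex.continuous_ofReal.comp ((continuous_doubleSum lam n x₁ x₂).comp
      (f := fun p : ℝ × ℝ => (1 - p.1, 1 - p.2)) (by fun_prop))
  refine (hc.continuousWithinAt (x := (t₁, t₂))).tendsto.congr' ?_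
  filter_upwards [self_mem_nhdsWithin] with p hp
  exact (doubleIntegral_eq h hp.1.2 hp.2.2).symm

lemma doubleIntegralExt_eq {lam : YoungDiagram} {n : ℕ} {x₁ x₂ : ℤ} {Cz Cw : Contour}
    (h : Admissible lam n x₁ x₂ Cz Cw) (t₁ t₂ : I) :
    doubleIntegralExt lam n Cz Cw x₁ t₁ x₂ t₂ = doubleSum lam n x₁ x₂ (1 - t₁) (1 - t₂) := by
  rw [doubleIntegralExt]
  split_ifs with ht
  · exact doubleIntegral_eq h ht.1 ht.2
  -- The closure of [0,1)² contains every pair of times, so the filter is nontrivial and the limit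
  -- unique.
  · have : (𝓝[Ico (0 : ℝ) 1 ×ˢ Ico (0 : ℝ) 1] ((t₁ : ℝ), (t₂ : ℝ))).NeBot := by
      rw [← mem_closure_iff_nhdsWithin_neBot, closure_prod_eq, closure_Ico zero_ne_one]
      exact ⟨t₁.2, t₂.2⟩
    exact (tendsto_doubleIntegral h t₁ t₂).limUnder_eq

/-- The kernel, as a real number. -/
noncomputable def realKernel (lam : YoungDiagram) (n : ℕ) (p q : ℤ × I) : ℝ :=
  (if p.2 < q.2 then expCoeff (p.2 - q.2) (p.1 - 1 - q.1) else 0) +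
    doubleSum lam n p.1 q.1 (1 - p.2) (1 - q.2)

lemma kernel_eq {lam : YoungDiagram} {n : ℕ} {Cz Cw : ℤ → ℤ → Contour} {p q : ℤ × I}
    (h : Admissible lam n p.1 q.1 (Cz p.1 q.1) (Cw p.1 q.1)) :
    kernel lam n Cz Cw p q = realKernel lam n p q := by
  rw [kernel, realKernel, doubleIntegralExt_eq h, Complex.ofReal_add]
  congr 1
  by_cases h1 : p.2 < q.2
  · by_cases h2 : q.1 < p.1
    · rw [if_pos ⟨h1, h2⟩, if_pos h1, expCoeff, if_pos (by lia), sub_right_comm]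
      push_cast
      rfl
    · rw [if_neg fun h => h2 h.2, if_pos h1, expCoeff_of_neg _ (by lia), Complex.ofReal_zero]
  · rw [if_neg fun h => h1 h.1, if_neg h1, Complex.ofReal_zero]

/-! ### Comparison of the two forms of the kernel -/

lemma positions_lt {n : ℕ} (lam : YoungDiagram) (a : Fin n) :
    positions n lam a < lam.rowLen 0 := by
  have := lam.rowLen_anti 0 a (Nat.zero_le _)
  simp only [positions]
  lia

lemma doubleSum_eq_zero_of_le {lam : YoungDiagram} {n : ℕ} {x₁ x₂ : ℤ} (h : x₁ ≤ -n)
    (τ₁ τ₂ : ℝ) : doubleSum lam n x₁ x₂ τ₁ τ₂ = 0 := by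
  rw [doubleSum, Finset.Ico_eq_empty (by lia), Finset.sum_empty]

lemma doubleSum_eq_zero_of_ge {lam : YoungDiagram} {n : ℕ} {x₁ x₂ : ℤ}
    (h : (lam.rowLen 0 : ℤ) ≤ x₂) (τ₁ τ₂ : ℝ) : doubleSum lam n x₁ x₂ τ₁ τ₂ = 0 := by
  have : ∀ p, zTerm lam n x₂ p τ₂ = 0 := fun p => if_neg fun hp => by
    have := hp.1
    have := hp.2
    lia
  simp [doubleSum, this]

/-- The factors with q < k give k!, the v factors with q > k give (-1)^v v!. -/
lemma prod_Ico_erase (v k : ℕ) :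
    ∏ q ∈ (Finset.Ico (0 : ℤ) (v + k + 1)).erase k, ((k : ℤ) - q) =
      (-1) ^ v * (k.factorial : ℤ) * v.factorial := by
  have h : (Finset.Ico (0 : ℤ) (v + k + 1)).erase k =
      Finset.Ico (0 : ℤ) k ∪ (Finset.range v).image fun j : ℕ => (k : ℤ) + 1 + j := by
    ext q
    simp only [Finset.mem_erase, Finset.mem_Ico, Finset.mem_union, Finset.mem_image,
      Finset.mem_range]
    constructor
    · intro h
      rcases lt_or_ge q k with h' | h'
      · exact Or.inl ⟨h.2.1, h'⟩
      · exact Or.inr ⟨(q - k - 1).toNat, by lia, by lia⟩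
    · rintro (h | ⟨j, hj, rfl⟩) <;> lia
  rw [h, Finset.prod_union, prod_Ico_int, Finset.prod_image]
  · have h1 : ∏ j ∈ Finset.range v, ((k : ℤ) - (k + 1 + j)) = (-1) ^ v * v.factorial := by
      rw [← Finset.prod_range_add_one_eq_factorial]
      push_cast
      rw [← Finset.card_range v, ← Finset.prod_const, Finset.card_range, ← Finset.prod_mul_distrib]
      exact Finset.prod_congr rfl fun j _ => by ring
    have h2 : ∏ j ∈ Finset.range (k : ℤ).toNat, ((k : ℤ) - j) = k.factorial := by
      rw [Int.toNat_natCast, ← Finset.prod_range_add_one_eq_factorial, ← Finset.prod_range_reflect]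
      push_cast
      refine Finset.prod_congr rfl fun j hj => ?_
      have := Finset.mem_range.1 hj
      lia
    rw [h1, h2]
    ring
  · intro a _ b _ h
    simpa using h
  · rw [Finset.disjoint_left]
    intro q hq hq'
    obtain ⟨j, -, rfl⟩ := Finset.mem_image.1 hq'
    have := (Finset.mem_Ico.1 hq).2
    lia

/-- The polynomial vanishing at the shifted positions. -/
lemma wNumerator_eq {lam : YoungDiagram} {n v k : ℕ} {x₁ : ℤ} (h : x₁ + n = v + k + 1) :
    (wNumerator lam n x₁ (k : ℤ) : ℤ) =
      (-1) ^ (v + k + 1) * ∏ a : Fin n, ((v : ℤ) - shiftedPosition n lam a) := by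
  rw [wNumerator, Finset.Ico_eq_empty (by lia), Finset.prod_empty, mul_one, h]
  congr 1
  refine Finset.prod_congr rfl fun a _ => ?_
  rw [shiftedPosition_cast]
  simp only [Int.cast_id]
  lia

/-- With v = x₁ + n - 1 - k, a factor (-1)^k turns (1-t)^k into (t-1)^k, the weight of the negative
time t - 1 used in `finalKernel`. -/
lemma wCoeff_mul_pow {lam : YoungDiagram} {n v k : ℕ} {x₁ : ℤ} (h : x₁ + n = v + k + 1) (t : ℝ) :
    wCoeff lam n x₁ k * (1 - t) ^ k = -expCoeff (t - 1) k *
      ((∏ a : Fin n, ((v : ℝ) - shiftedPosition n lam a)) / v.factorial) := by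
  have hs : (1 - t) ^ k = (-1) ^ k * (t - 1) ^ k := by rw [← mul_pow]; ring
  have h1 : ((-1 : ℝ) ^ v) ≠ 0 := by positivity
  rw [wCoeff, wNumerator_eq h, h, prod_Ico_erase, expCoeff_natCast, hs]
  push_cast
  have h2 : (k.factorial : ℝ) ≠ 0 := Nat.cast_ne_zero.2 (Nat.factorial_ne_zero _)
  have h3 : (v.factorial : ℝ) ≠ 0 := Nat.cast_ne_zero.2 (Nat.factorial_ne_zero _)
  have h4 : ((-1 : ℝ) ^ k) * (-1) ^ k = 1 := by rw [← mul_pow]; simp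
  field_simp
  rw [pow_add, pow_add]
  linear_combination (-1 : ℝ) ^ v * (∏ a : Fin n, ((v : ℝ) - shiftedPosition n lam a)) *
    (t - 1) ^ k * (-1) * h4

/-- At z = v - n - x₂ ≥ 0 the numerator (z+1)⋯(z+x₂+n) is v!/z!. The bound on v puts every such z
inside the z-contour; for negative z both sides vanish. -/
lemma zTerm_eq {lam : YoungDiagram} {n : ℕ} {x₂ : ℤ} {v : ℕ} (hx : -(n : ℤ) < x₂)
    (hv : (v : ℤ) < n + lam.rowLen 0) (t : ℝ) :
    zTerm lam n x₂ (v - n - x₂) (1 - t) = v.factorial * expCoeff (1 - t) (v - n - x₂) := by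
  rw [zTerm]
  rcases lt_or_ge ((v : ℤ) - n - x₂) 0 with h | h
  · rw [if_neg fun h' => absurd h'.1 (not_le.2 h), expCoeff_of_neg _ h, mul_zero]
  · rw [if_pos ⟨h, by lia⟩]
    obtain ⟨m, hm⟩ := Int.eq_ofNat_of_zero_le h
    obtain ⟨d, hd⟩ := Int.eq_ofNat_of_zero_le (show 0 ≤ x₂ + n by lia)
    have hvm : v = m + d := by lia
    rw [hm, expCoeff_natCast, zNumerator, hd, prod_Ico_int, Int.toNat_natCast, Int.toNat_natCast]
    have h1 : ∏ k ∈ Finset.range d, ((m : ℤ) + 1 + ((k : ℤ) : ℤ)) = ((m + 1).ascFactorial d : ℕ) := by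
      rw [Nat.ascFactorial_eq_prod_range]
      push_cast
      rfl
    have h2 := Nat.factorial_mul_ascFactorial m d
    simp only [Int.cast_id]
    rw [h1, hvm, ← h2]
    have h3 : (m.factorial : ℝ) ≠ 0 := Nat.cast_ne_zero.2 (Nat.factorial_ne_zero _)
    push_cast
    field_simp

lemma zPoles_eq {lam : YoungDiagram} {n : ℕ} {x₂ : ℤ} (hx : -(n : ℤ) < x₂) :
    zPoles lam n x₂ = Finset.univ.image fun a : Fin n => positions n lam a - x₂ := by
  rw [zPoles, Finset.Ico_eq_empty (by lia), Finset.union_empty]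

lemma positions_sub_injective (n : ℕ) (lam : YoungDiagram) (x : ℤ) :
    Function.Injective fun a : Fin n => positions n lam a - x := fun _ _ h =>
  (positions_strictAnti n lam).injective (sub_left_injective h)

lemma eval_basis (n : ℕ) (lam : YoungDiagram) (v : ℝ) (a : Fin n) :
    (Lagrange.basis Finset.univ (fun b => (shiftedPosition n lam b : ℝ)) a).eval v =
      (∏ b ∈ Finset.univ.erase a, (v - shiftedPosition n lam b)) /
        ∏ b ∈ Finset.univ.erase a, ((shiftedPosition n lam a : ℝ) - shiftedPosition n lam b) := by
  rw [Lagrange.basis, Polynomial.eval_prod, ← Finset.prod_div_distrib]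
  refine Finset.prod_congr rfl fun b _ => ?_
  simp only [Lagrange.basisDivisor, Polynomial.eval_mul, Polynomial.eval_C, Polynomial.eval_sub,
    Polynomial.eval_X]
  rw [div_eq_inv_mul]

/-- If v is not a shifted position, the residue at v - n - x₂ gives the last term, and the residues
at the positions give the Lagrange basis values in `interpCoeff`. If v is a shifted position, the
prefactor vanishes, and so does the right side because interpolation at a node is trivial. -/
lemma residue_sum_eq {lam : YoungDiagram} {n : ℕ} {x₂ : ℤ} {v : ℕ} (hx : -(n : ℤ) < x₂)
    (hv : (v : ℤ) < n + lam.rowLen 0) (t : ℝ) :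
    -((∏ a : Fin n, ((v : ℝ) - shiftedPosition n lam a)) / v.factorial) *
      (zTerm lam n x₂ (v - n - x₂) (1 - t) /
          ((∏ p ∈ zPoles lam n x₂, ((v - n - x₂ : ℤ) - p) : ℤ) : ℝ) +
        ∑ p ∈ zPoles lam n x₂, zTerm lam n x₂ p (1 - t) /
          (((∏ q ∈ (zPoles lam n x₂).erase p, (p - q)) * (p - (v - n - x₂)) : ℤ) : ℝ)) =
    ∑ a, interpCoeff n lam v a * expCoeff (1 - t) (positions n lam a - x₂) -
      expCoeff (1 - t) (v - n - x₂) := by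
  have hvf : (v.factorial : ℝ) ≠ 0 := Nat.cast_ne_zero.2 (Nat.factorial_ne_zero _)
  by_cases hex : ∃ a, shiftedPosition n lam a = v
  · obtain ⟨a, rfl⟩ := hex
    rw [Finset.prod_eq_zero (Finset.mem_univ a) (sub_self _), zero_div, neg_zero, zero_mul, eq_comm,
      sub_eq_zero, Finset.sum_eq_single_of_mem a (Finset.mem_univ a)]
    · have h : (Lagrange.basis Finset.univ (fun b => (shiftedPosition n lam b : ℝ)) a).eval
          (shiftedPosition n lam a : ℝ) = 1 :=
        Lagrange.eval_basis_self (v := fun b => (shiftedPosition n lam b : ℝ))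
          (fun a _ b _ h => shiftedPosition_injective n lam (Nat.cast_injective h))
          (Finset.mem_univ a)
      rw [interpCoeff, h, shiftedPosition_cast, div_self hvf, one_mul, one_mul]
      congr 1
      ring
    · intro b _ hb
      have h : (Lagrange.basis Finset.univ (fun b => (shiftedPosition n lam b : ℝ)) b).eval
          (shiftedPosition n lam a : ℝ) = 0 :=
        Lagrange.eval_basis_of_ne (v := fun b => (shiftedPosition n lam b : ℝ)) hb
          (Finset.mem_univ a)
      rw [interpCoeff, h, mul_zero, zero_mul]
  push Not at hex
  have hne : ∀ a, (v : ℝ) - shiftedPosition n lam a ≠ 0 := fun a h =>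
    hex a (Nat.cast_injective (sub_eq_zero.1 h)).symm
  have hpos : ∀ a, positions n lam a = (shiftedPosition n lam a : ℤ) - n := fun a => by
    rw [shiftedPosition_cast]; ring
  have hP : ((∏ p ∈ zPoles lam n x₂, ((v - n - x₂ : ℤ) - p) : ℤ) : ℝ) =
      ∏ a : Fin n, ((v : ℝ) - shiftedPosition n lam a) := by
    rw [zPoles_eq hx, Finset.prod_image (positions_sub_injective n lam x₂).injOn]
    push_cast
    refine Finset.prod_congr rfl fun a _ => ?_
    rw [hpos]
    push_cast
    ring
  have hsum : ∀ a, zTerm lam n x₂ (positions n lam a - x₂) (1 - t) /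
      (((∏ q ∈ (zPoles lam n x₂).erase (positions n lam a - x₂), (positions n lam a - x₂ - q)) *
        (positions n lam a - x₂ - (v - n - x₂)) : ℤ) : ℝ) =
      (shiftedPosition n lam a).factorial * expCoeff (1 - t) (positions n lam a - x₂) /
      ((∏ b ∈ Finset.univ.erase a, ((shiftedPosition n lam a : ℝ) - shiftedPosition n lam b)) *
        ((shiftedPosition n lam a : ℝ) - v)) := by
    intro a
    have h1 := zTerm_eq (lam := lam) (n := n) (x₂ := x₂) (v := shiftedPosition n lam a) hx (by
      have := positions_lt lam a
      rw [shiftedPosition_cast]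
      lia) t
    rw [← hpos] at h1
    rw [h1, zPoles_eq hx, ← Finset.image_erase (positions_sub_injective n lam x₂),
      Finset.prod_image (positions_sub_injective n lam x₂).injOn]
    congr 1
    push_cast
    congr 1
    · refine Finset.prod_congr rfl fun b _ => ?_
      rw [hpos, hpos]
      push_cast
      ring
    · rw [hpos]
      push_cast
      ring
  rw [hP, zTerm_eq hx hv]
  nth_rewrite 1 [zPoles_eq hx]
  rw [Finset.sum_image (positions_sub_injective n lam x₂).injOn, Finset.sum_congr rfl fun a _ => hsum a,
    mul_add, add_comm, sub_eq_add_neg, Finset.mul_sum]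
  have hprod : ∏ a : Fin n, ((v : ℝ) - shiftedPosition n lam a) ≠ 0 :=
    Finset.prod_ne_zero_iff.2 fun a _ => hne a
  congr 1
  · refine Finset.sum_congr rfl fun a _ => ?_
    have h1 : ∏ b ∈ Finset.univ.erase a,
        ((shiftedPosition n lam a : ℝ) - shiftedPosition n lam b) ≠ 0 :=
      Finset.prod_ne_zero_iff.2 fun b hb h => Finset.ne_of_mem_erase hb
        (shiftedPosition_injective n lam (Nat.cast_injective (sub_eq_zero.1 h))).symm
    have h2 : (shiftedPosition n lam a : ℝ) - v ≠ 0 := fun h => hne a (by linarith)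
    rw [interpCoeff, eval_basis, ← Finset.mul_prod_erase _ _ (Finset.mem_univ a)]
    field_simp
    ring
  · field_simp

/-- Away from coinciding times, the kernel is the one found by linear algebra. -/
lemma doubleSum_eq {lam : YoungDiagram} {n : ℕ} {x₁ x₂ : ℤ} (h₁ : -(n : ℤ) < x₁)
    (h₁' : x₁ < lam.rowLen 0) (h₂ : -(n : ℤ) < x₂) (t₁ t₂ : ℝ) :
    doubleSum lam n x₁ x₂ (1 - t₁) (1 - t₂) =
      finalKernel n lam x₁ t₁ x₂ t₂ - expCoeff (t₁ - t₂) (x₁ - 1 - x₂) := by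
  obtain ⟨N, hN⟩ := Int.eq_ofNat_of_zero_le (show 0 ≤ x₁ - 1 + n by lia)
  obtain ⟨m, hm⟩ := Int.eq_ofNat_of_zero_le (show 0 ≤ x₂ + n by lia)
  have e1 : expCoeff (t₁ - t₂) (x₁ - 1 - x₂) = ∑ v ∈ Finset.range (N + 1),
      expCoeff (t₁ - 1) ((N : ℤ) - v) * expCoeff (1 - t₂) ((v : ℤ) - n - x₂) := by
    have h := expCoeff_add_sub (t₁ - 1) (1 - t₂) N m
    rw [sub_add_sub_cancel, show (N : ℤ) - m = x₁ - 1 - x₂ by lia] at h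
    rw [h]
    refine Finset.sum_congr rfl fun v _ => ?_
    rw [show (v : ℤ) - m = (v : ℤ) - n - x₂ by lia]
  have e2 : finalKernel n lam x₁ t₁ x₂ t₂ = ∑ v ∈ Finset.range (N + 1),
      expCoeff (t₁ - 1) ((N : ℤ) - v) *
        ∑ a, interpCoeff n lam v a * expCoeff (1 - t₂) (positions n lam a - x₂) := by
    rw [finalKernel, hN, Int.toNat_natCast]
    simp only [Finset.sum_mul, Finset.mul_sum, mul_assoc]
    exact Finset.sum_comm
  rw [e1, e2, ← Finset.sum_sub_distrib, doubleSum]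
  -- The w-pole k corresponds to the shifted intermediate position v = N - k at time 1.
  refine Finset.sum_bij' (fun k _ => ((N : ℤ) - k).toNat) (fun v _ => (N : ℤ) - v) ?_ ?_ ?_ ?_ ?_
  · intro k hk
    rw [Finset.mem_Ico] at hk
    rw [Finset.mem_range]
    lia
  · intro v hv
    rw [Finset.mem_range] at hv
    rw [Finset.mem_Ico]
    lia
  · intro k hk
    rw [Finset.mem_Ico] at hk
    lia
  · intro v hv
    rw [Finset.mem_range] at hv
    lia
  · intro k hk
    rw [Finset.mem_Ico] at hk
    obtain ⟨k, rfl⟩ := Int.eq_ofNat_of_zero_le hk.1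
    obtain ⟨v, hv⟩ := Int.eq_ofNat_of_zero_le (show 0 ≤ (N : ℤ) - k by lia)
    have e3 : x₁ - x₂ - 1 - k = (v : ℤ) - n - x₂ := by lia
    rw [hv, Int.toNat_natCast, Int.toNat_natCast, show (N : ℤ) - v = k by lia, e3,
      wCoeff_mul_pow (v := v) (by lia), ← mul_sub, ← residue_sum_eq h₂ (by lia)]
    ring

/-! ### The densities as determinants of the kernel -/

/-- Take the mark of largest content x: all final positions are below λ₁ ≤ x and x_b - 1 < x for
every mark, so its column is zero. -/
lemma jumpDet_eq_zero_of_mark_ge {n k : ℕ} {lam : YoungDiagram} (p : Fin k → ℤ × I) {q : Fin k}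
    (hq : (lam.rowLen 0 : ℤ) ≤ (p q).1) (t : ℝ) : jumpDet (positions n lam) t p = 0 := by
  obtain ⟨r, -, hr⟩ := Finset.exists_max_image Finset.univ (fun r => (p r).1) ⟨q, Finset.mem_univ q⟩
  have hr' := hq.trans (hr q (Finset.mem_univ q))
  rw [jumpDet, Matrix.det_eq_zero_of_column_eq_zero (Sum.inr r), mul_zero]
  rintro (a | b)
  · have := positions_lt lam a
    exact expCoeff_of_neg _ (by lia)
  · have := hr b (Finset.mem_univ b)
    simp only [jumpMatrix, Matrix.fromBlocks_apply₂₂, Matrix.of_apply]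
    rw [expCoeff_of_neg _ (by lia), ite_self]

/-- The density of the marks is the determinant of the kernel. -/
theorem jumpDet_eq_mul_det_realKernel {n k : ℕ} (lam : YoungDiagram) (p : Fin k → ℤ × I)
    (hp : Function.Injective fun i => (p i).2) : jumpDet (positions n lam) 1 p =
      jumpDet (positions n lam) 1 (default : Fin 0 → ℤ × I) *
        (Matrix.of fun a b => realKernel lam n (p a) (p b)).det := by
  -- Outside the range -n < x < λ₁ the residue comparison does not apply; there an extreme mark
  -- gives both determinants a zero row or column.
  by_cases h₁ : ∃ q, (p q).1 ≤ -n
  · obtain ⟨q, hq⟩ := h₁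
    obtain ⟨r, -, hr⟩ :=
      Finset.exists_min_image Finset.univ (fun r => (p r).1) ⟨q, Finset.mem_univ q⟩
    have hr' := (hr q (Finset.mem_univ q)).trans hq
    rw [jumpDet_eq_zero_of_mark_le _ _ p hq, Matrix.det_eq_zero_of_row_eq_zero r, mul_zero]
    intro b
    have := hr b (Finset.mem_univ b)
    simp only [Matrix.of_apply, realKernel]
    rw [doubleSum_eq_zero_of_le hr', expCoeff_of_neg _ (by lia), ite_self, add_zero]
  by_cases h₂ : ∃ q, (lam.rowLen 0 : ℤ) ≤ (p q).1
  · obtain ⟨q, hq⟩ := h₂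
    obtain ⟨r, -, hr⟩ :=
      Finset.exists_max_image Finset.univ (fun r => (p r).1) ⟨q, Finset.mem_univ q⟩
    have hr' := hq.trans (hr q (Finset.mem_univ q))
    rw [jumpDet_eq_zero_of_mark_ge p hq, Matrix.det_eq_zero_of_column_eq_zero r, mul_zero]
    intro b
    have := hr b (Finset.mem_univ b)
    simp only [Matrix.of_apply, realKernel]
    rw [doubleSum_eq_zero_of_ge hr', expCoeff_of_neg _ (by lia), ite_self, add_zero]
  push Not at h₁ h₂
  rw [jumpDet_eq_mul_det lam p h₁]
  congr 2
  ext a b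
  simp only [Matrix.of_apply, markKernel, realKernel]
  rw [doubleSum_eq (h₁ a) (h₂ a) (h₁ b)]
  -- On the diagonal the weight has degree -1 and vanishes; off it the times differ, and minus the
  -- indicator of t₂ < t₁ is that of t₁ < t₂ minus 1.
  rcases eq_or_ne a b with rfl | hab
  · simp [expCoeff_of_neg]
  · rcases lt_or_gt_of_ne (hp.ne hab) with h | h
    · rw [if_pos h, if_neg h.not_gt]; ring
    · rw [if_neg h.not_gt, if_pos h]; ring

/-! ### The points of a tableau -/

/-- The point of the cell `c`. -/
def point {lam : YoungDiagram} (T : lam.cells → I) (c : lam.cells) : ℤ × I := (content c, T c)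

lemma mem_tableaux_iff {lam : YoungDiagram} {T : lam.cells → I} :
    T ∈ tableaux lam ↔ Monotone T := by
  constructor
  · rintro ⟨h1, h2⟩
    have hrow : ∀ i j d (h : (i, j) ∈ lam.cells) (h' : (i, j + d) ∈ lam.cells),
        T ⟨(i, j), h⟩ ≤ T ⟨(i, j + d), h'⟩ := by
      intro i j d
      induction d with
      | zero => intro h h'; exact le_rfl
      | succ d ih =>
        intro h h'
        have hm : (i, j + d) ∈ lam.cells := lam.up_left_mem le_rfl (Nat.le_succ _) h'
        exact (ih h hm).trans (h1 i (j + d) hm h')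
    have hcol : ∀ i j d (h : (i, j) ∈ lam.cells) (h' : (i + d, j) ∈ lam.cells),
        T ⟨(i, j), h⟩ ≤ T ⟨(i + d, j), h'⟩ := by
      intro i j d
      induction d with
      | zero => intro h h'; exact le_rfl
      | succ d ih =>
        intro h h'
        have hm : (i + d, j) ∈ lam.cells := lam.up_left_mem (Nat.le_succ _) le_rfl h'
        exact (ih h hm).trans (h2 (i + d) j hm h')
    rintro ⟨⟨i, j⟩, h⟩ ⟨⟨i', j'⟩, h'⟩ hle
    obtain ⟨hi, hj⟩ := Prod.mk_le_mk.1 (show (i, j) ≤ (i', j') from hle)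
    obtain ⟨d, rfl⟩ := Nat.exists_eq_add_of_le hi
    obtain ⟨e, rfl⟩ := Nat.exists_eq_add_of_le hj
    have hm : (i, j + e) ∈ lam.cells := lam.up_left_mem hi le_rfl h'
    exact (hrow i j e h hm).trans (hcol i (j + e) d hm h')
  · intro h
    exact ⟨fun i j h1 h2 => h (show (i, j) ≤ (i, j + 1) by simp),
      fun i j h1 h2 => h (show (i, j) ≤ (i + 1, j) by simp)⟩

/-- By monotonicity the cells with entries ≤ t form an initial segment of the row. -/
lemma rowCount_eq {lam : YoungDiagram} {T : lam.cells → I} (hT : Monotone T) (i : ℕ) (t : ℝ) (j : ℕ) :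
    j < rowCount T i t ↔ ∃ h : (i, j) ∈ lam.cells, (T ⟨(i, j), h⟩ : ℝ) ≤ t := by
  classical
  set S : Finset ℕ := (Finset.range (lam.rowLen i)).filter
    fun j => ∃ h : (i, j) ∈ lam.cells, (T ⟨(i, j), h⟩ : ℝ) ≤ t with hS
  have hmem : ∀ j, j ∈ S ↔ ∃ h : (i, j) ∈ lam.cells, (T ⟨(i, j), h⟩ : ℝ) ≤ t := by
    intro j
    simp only [hS, Finset.mem_filter, Finset.mem_range, and_iff_right_iff_imp]
    rintro ⟨h, -⟩
    exact YoungDiagram.mem_iff_lt_rowLen.1 h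
  have hcard : rowCount T i t = S.card := by
    rw [rowCount, ← Nat.card_eq_finsetCard]
    refine Nat.card_congr ⟨fun c => ⟨(c : lam.cells).1.2, ?_⟩,
      fun j => ⟨⟨(i, j), ((hmem j).1 j.2).choose⟩, rfl, ((hmem j).1 j.2).choose_spec⟩, ?_, ?_⟩
    · obtain ⟨⟨⟨a, b⟩, hc⟩, rfl, hc'⟩ := c
      exact (hmem b).2 ⟨hc, hc'⟩
    · rintro ⟨⟨⟨a, b⟩, hc⟩, rfl, hc'⟩
      rfl
    · rintro ⟨j, hj⟩
      rfl
  have hlow : ∀ a b, a ≤ b → b ∈ S → a ∈ S := by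
    intro a b hab hb
    obtain ⟨h, h'⟩ := (hmem b).1 hb
    have ha : (i, a) ∈ lam.cells := lam.up_left_mem le_rfl hab h
    refine (hmem a).2 ⟨ha, le_trans ?_ h'⟩
    exact hT (show (i, a) ≤ (i, b) from Prod.mk_le_mk.2 ⟨le_rfl, hab⟩)
  have hrange : S = Finset.range S.card := by
    refine Finset.eq_of_subset_of_card_le (fun b hb => ?_) (by simp)
    rw [Finset.mem_range]
    by_contra h
    have : Finset.range (b + 1) ⊆ S := fun a ha => hlow a b (by simpa [Nat.lt_succ_iff] using ha) hb
    have := Finset.card_le_card this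
    rw [Finset.card_range] at this
    lia
  rw [hcard, ← hmem]
  nth_rewrite 2 [hrange]
  rw [Finset.mem_range]

/-- There are finitely many entries, so the particle rests during a short interval before t and its
left limit is an attained value, also at t = 0. -/
lemma leftLim_particle {lam : YoungDiagram} (T : lam.cells → I) (i : ℕ) (t : ℝ) :
    ∃ s < t, (∀ c, (T c : ℝ) < t → (T c : ℝ) ≤ s) ∧
      Function.leftLim (particle T i) t = particle T i s := by
  classical
  obtain ⟨s, hst, hs⟩ : ∃ s < t, ∀ c, (T c : ℝ) < t → (T c : ℝ) ≤ s := by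
    have h : ∀ᶠ s in 𝓝[<] t, ∀ c, (T c : ℝ) < t → (T c : ℝ) ≤ s := by
      rw [eventually_all]
      intro c
      by_cases hc : (T c : ℝ) < t
      · filter_upwards [Ioo_mem_nhdsLT hc] with s hs _
        exact hs.1.le
      · exact Eventually.of_forall fun _ h => absurd h hc
    obtain ⟨s, hs, hst⟩ := (h.and self_mem_nhdsWithin).exists
    exact ⟨s, hst, hs⟩
  refine ⟨s, hst, hs, leftLim_eq_of_tendsto ?_⟩
  refine tendsto_const_nhds.congr' ?_
  filter_upwards [Ioo_mem_nhdsLT hst] with r hr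
  have : ∀ c, (T c : ℝ) ≤ s ↔ (T c : ℝ) ≤ r := fun c =>
    ⟨fun h => h.trans hr.1.le, fun h => hs c (h.trans_lt hr.2)⟩
  simp only [particle, rowCount, this]

/-- Positions are half-integers, so the jump condition says that the row count is ≤ x + i just
before t and > x + i at t; equivalently, the cell in column x + i of row i has entry t. -/
lemma isJump_iff {lam : YoungDiagram} {T : lam.cells → I} (hT : Monotone T) (i : ℕ) (s : ℤ × I) :
    IsJump T i s ↔ ∃ c : lam.cells, c.1.1 = i ∧ point T c = s := by
  obtain ⟨x, t⟩ := s
  obtain ⟨r, hrt, hr, hlim⟩ := leftLim_particle T i (t : ℝ)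
  rw [IsJump, hlim]
  simp only [particle, mem_Icc]
  have e1 : ((rowCount T i r : ℝ) - ((i : ℝ) + 1) + 1 / 2 ≤ x) ↔ (rowCount T i r : ℤ) ≤ x + i := by
    constructor
    · intro h
      have h2 : ((rowCount T i r : ℤ) : ℝ) < ((x + i + 1 : ℤ) : ℝ) := by push_cast; linarith
      have := Int.cast_lt.1 h2
      lia
    · intro h
      have h2 : ((rowCount T i r : ℤ) : ℝ) ≤ ((x + i : ℤ) : ℝ) := Int.cast_le.2 h
      push_cast at h2
      linarith
  have e2 : ((x : ℝ) ≤ (rowCount T i t : ℝ) - ((i : ℝ) + 1) + 1 / 2) ↔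
      x + i < (rowCount T i t : ℤ) := by
    constructor
    · intro h
      have h2 : ((x + i : ℤ) : ℝ) < ((rowCount T i t : ℤ) : ℝ) := by push_cast; linarith
      exact Int.cast_lt.1 h2
    · intro h
      have h2 : ((x + i + 1 : ℤ) : ℝ) ≤ ((rowCount T i t : ℤ) : ℝ) := Int.cast_le.2 (by lia)
      push_cast at h2
      linarith
  rw [e1, e2]
  constructor
  · rintro ⟨h1, h2⟩
    obtain ⟨j, hj⟩ := Int.eq_ofNat_of_zero_le (show 0 ≤ x + i by lia)
    obtain ⟨hc, hle⟩ := (rowCount_eq hT i t j).1 (by lia)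
    have hge : ¬ (T ⟨(i, j), hc⟩ : ℝ) ≤ r := fun h =>
      absurd ((rowCount_eq hT i r j).2 ⟨hc, h⟩) (by lia)
    refine ⟨⟨(i, j), hc⟩, rfl, ?_⟩
    have h3 : (T ⟨(i, j), hc⟩ : ℝ) = t := by
      rcases hle.lt_or_eq with h | h
      · exact absurd (hr _ h) hge
      · exact h
    exact Prod.ext (by simp only [point, content]; lia) (Subtype.ext h3)
  · rintro ⟨⟨⟨a, j⟩, hc⟩, rfl, hp⟩
    have hx : (j : ℤ) - a = x := congrArg Prod.fst hp
    have ht : T ⟨(a, j), hc⟩ = t := congrArg Prod.snd hp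
    constructor
    · by_contra h
      obtain ⟨_, h'⟩ := (rowCount_eq hT a r j).1 (by lia)
      rw [ht] at h'
      exact absurd hrt (not_lt.2 h')
    · have := (rowCount_eq hT a t j).2 ⟨hc, by rw [ht]⟩
      lia

/-- A row has at most one cell of a given content, so counting particles amounts to counting cells.
-/
lemma jumps_eq {lam : YoungDiagram} (T : tableaux lam) (s : ℤ × I) :
    jumps T s = (Finset.univ.filter fun c => point T.1 c = s).card := by
  have hT := mem_tableaux_iff.1 T.2
  have : {i : ℕ | IsJump T.1 i s} =
      (fun c : lam.cells => c.1.1) '' (Finset.univ.filter fun c => point T.1 c = s) := by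
    ext i
    simp [isJump_iff hT, and_comm]
  rw [jumps, this, InjOn.ncard_image, ncard_coe_finset]
  rintro ⟨⟨a, b⟩, hc⟩ h ⟨⟨a', b'⟩, hc'⟩ h' (rfl : a = a')
  have e1 : (point T.1 ⟨(a, b), hc⟩).1 = s.1 := congrArg Prod.fst (by simpa using h)
  have e2 : (point T.1 ⟨(a, b'), hc'⟩).1 = s.1 := congrArg Prod.fst (by simpa using h')
  simp only [point, content] at e1 e2
  obtain rfl : b = b' := by lia
  rfl

/-! ### The point process of jumps -/

lemma measurableSet_tableaux (lam : YoungDiagram) : MeasurableSet (tableaux lam) := by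
  have : tableaux lam = {T | Monotone T} := Set.ext fun T => mem_tableaux_iff
  rw [this]
  exact isClosed_monotone.measurableSet

lemma measurable_point {lam : YoungDiagram} (c : lam.cells) :
    Measurable fun T : lam.cells → I => point T c :=
  measurable_const.prodMk (measurable_pi_apply c)

-- Passage from fillings of the diagram to fillings of the plane; at t = 1 the bound on the entries
-- is void.
open Classical in
lemma lintegral_tableaux {n k : ℕ} {lam : YoungDiagram} (hn : lam.colLen 0 ≤ n)
    {f : (Fin k → ℤ × I) → ℝ≥0∞} (hf : Measurable f) :
    (∫⁻ T in tableaux lam, ∑ c : Fin k → lam.cells with Function.Injective c,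
      f fun i => point T (c i)) = densityIntegral n lam 1 f := by
  rw [← tabIntegral_eq_densityIntegral lam hn 1 hf 0, tabIntegral, lmarginal,
    ← lintegral_indicator (measurableSet_tableaux lam)]
  refine lintegral_congr fun T => ?_
  have hu : ∀ c : lam.cells, Function.updateFinset (0 : ℕ × ℕ → I) lam.cells T c = T c := fun c => by
    simp [Function.updateFinset]
  have hmem : Function.updateFinset (0 : ℕ × ℕ → I) lam.cells T ∈ tabSet lam 1 ↔
      T ∈ tableaux lam := by
    rw [mem_tableaux_iff]
    constructor
    · rintro ⟨h, -⟩ a b hab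
      have := h a.2 b.2 hab
      rwa [hu, hu] at this
    · intro h
      refine ⟨fun a ha b hb hab => ?_, fun c _ => unitInterval.le_one'⟩
      rw [hu ⟨a, ha⟩, hu ⟨b, hb⟩]
      exact h hab
  have hsum : ∑ c : Fin k → lam.cells with Function.Injective c, f (fun i => point T (c i)) =
      pointSum lam f (Function.updateFinset (0 : ℕ × ℕ → I) lam.cells T) := by
    refine Finset.sum_bij (fun c _ i => (c i : ℕ × ℕ)) ?_ ?_ ?_ ?_
    · intro c hc
      simp only [cellTuples, Finset.mem_filter, Fintype.mem_piFinset]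
      exact ⟨fun i => (c i).2, Subtype.val_injective.comp (Finset.mem_filter.1 hc).2⟩
    · intro c _ d _ h
      funext i
      exact Subtype.ext (congrFun h i)
    · intro d hd
      simp only [cellTuples, Finset.mem_filter, Fintype.mem_piFinset] at hd
      refine ⟨fun i => ⟨d i, hd.1 i⟩, ?_, rfl⟩
      exact Finset.mem_filter.2 ⟨Finset.mem_univ _, fun i j h => hd.2 (congrArg Subtype.val h)⟩
    · intro c _
      simp only [hu]
      rfl
  by_cases h : T ∈ tableaux lam
  · rw [indicator_of_mem h, indicator_of_mem (hmem.2 h), hsum]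
  · rw [indicator_of_notMem h, indicator_of_notMem (h ∘ hmem.1)]

/-- The total weight of the particle configurations. -/
noncomputable def totalWeight (n : ℕ) (lam : YoungDiagram) : ℝ :=
  jumpDet (positions n lam) 1 (default : Fin 0 → ℤ × I)

lemma totalWeight_pos {n : ℕ} {lam : YoungDiagram} (hn : lam.colLen 0 ≤ n) :
    0 < totalWeight n lam :=
  lt_of_le_of_ne (jumpDet_nonneg lam hn _ (Function.injective_of_subsingleton _) 1 zero_le_one
    fun i => i.elim0) (jumpDet_fin_zero_ne_zero n lam).symm

/-- The case k = 0 of the density formula. -/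
lemma volume_tableaux {n : ℕ} {lam : YoungDiagram} (hn : lam.colLen 0 ≤ n) :
    (volume : Measure (lam.cells → I)) (tableaux lam) = ENNReal.ofReal (totalWeight n lam) := by
  classical
  have h := lintegral_tableaux (k := 0) hn (f := fun _ => 1) measurable_const
  have h1 : (Finset.univ.filter fun c : Fin 0 → lam.cells => Function.Injective c).card = 1 := by
    rw [Finset.filter_true_of_mem fun c _ => Function.injective_of_subsingleton c]
    simp
  rw [Finset.sum_const, h1, one_smul, setLIntegral_one] at h
  rw [h, densityIntegral, Measure.pi_of_empty, lintegral_dirac, one_mul, jumpDensity,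
    if_pos fun i => i.elim0, totalWeight, Subsingleton.elim (default : Fin 0 → ℤ × I)]
  rfl

lemma isProbabilityMeasure_uniformTableau (lam : YoungDiagram) :
    IsProbabilityMeasure (uniformTableau lam) := by
  have h := volume_tableaux (lam := lam) le_rfl
  constructor
  rw [uniformTableau, Measure.smul_apply,
    (MeasurableEmbedding.subtype_coe (measurableSet_tableaux lam)).comap_apply, image_univ,
    Subtype.range_coe, smul_eq_mul]
  refine ENNReal.inv_mul_cancel ?_ (measure_ne_top _ _)
  rw [h]
  exact (ENNReal.ofReal_pos.2 (totalWeight_pos le_rfl)).ne'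

lemma ae_uniformTableau {lam : YoungDiagram} {p : (lam.cells → I) → Prop}
    (h : ∀ᵐ T, p T) : ∀ᵐ T ∂(uniformTableau lam), p T.1 := by
  rw [uniformTableau]
  refine Measure.ae_smul_measure ?_ _
  refine ae_of_ae_map (f := Subtype.val) measurable_subtype_coe.aemeasurable ?_
  rw [map_comap_subtype_coe (measurableSet_tableaux lam)]
  exact ae_restrict_of_ae h

lemma ae_injective_tableau (lam : YoungDiagram) :
    ∀ᵐ T ∂(uniformTableau lam), Function.Injective T.1 :=
  ae_uniformTableau (ae_pi_injective (volume : Measure I) measurable_id fun s => by simp)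

lemma point_injective {lam : YoungDiagram} {T : lam.cells → I} (hT : Function.Injective T) :
    Function.Injective (point T) := fun _ _ h => hT (congrArg Prod.snd h)

lemma isPointProcess_jumps (lam : YoungDiagram) :
    IsPointProcess (uniformTableau lam) (jumps (lam := lam)) where
  isProbabilityMeasure := isProbabilityMeasure_uniformTableau lam
  locallyFinite T C _ := by
    refine ((finite_range (point T.1)).subset fun s hs => ?_).inter_of_left C
    rw [Function.mem_support, jumps_eq, Finset.card_ne_zero] at hs
    obtain ⟨c, hc⟩ := hs
    exact ⟨c, (Finset.mem_filter.1 hc).2⟩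
  measurable_count B hB := by
    have h : ∀ T : tableaux lam, ∑' s : B, (jumps T s : ℝ≥0∞) =
        ∑ c : lam.cells, B.indicator 1 (point T.1 c) := by
      intro T
      have h1 : ∀ s : B, (jumps T s : ℝ≥0∞) = ∑ c : lam.cells, if point T.1 c = s then 1 else 0 := by
        intro s
        rw [jumps_eq]
        simp
      rw [tsum_congr h1, Summable.tsum_finsetSum fun _ _ => ENNReal.summable]
      refine Finset.sum_congr rfl fun c _ => ?_
      by_cases hc : point T.1 c ∈ B
      · rw [tsum_eq_single ⟨point T.1 c, hc⟩, if_pos rfl, indicator_of_mem hc]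
        · rfl
        · intro s hs
          exact if_neg fun h => hs (Subtype.ext h.symm)
      · rw [indicator_of_notMem hc]
        exact ENNReal.tsum_eq_zero.2 fun s => if_neg fun h : point T.1 c = s => hc (by rw [h]; exact s.2)
    simp only [h]
    exact Finset.measurable_sum _ fun c _ => (measurable_one.indicator hB).comp
      ((measurable_point c).comp measurable_subtype_coe)

-- Expanding the product of multiplicities gives a sum over tuples of cells; distinct entries make
-- `point T` injective, so distinct points mean distinct cells.
open Classical in
lemma distinctSum_jumps {lam : YoungDiagram} {T : tableaux lam} (hT : Function.Injective T.1) {k : ℕ}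
    (f : (Fin k → ℤ × I) → ℝ) : distinctSum (jumps T) k f =
      ∑ c : Fin k → lam.cells with Function.Injective c, f fun i => point T.1 (c i) := by
  have h1 : ∀ p : Fin k → ℤ × I, ∏ i, (jumps T (p i) : ℝ) =
      ∑ c : Fin k → lam.cells, if p = fun i => point T.1 (c i) then 1 else 0 := by
    intro p
    have h2 : ∀ i, (jumps T (p i) : ℝ) = ∑ c : lam.cells, if point T.1 c = p i then 1 else 0 := by
      intro i
      rw [jumps_eq]
      simp
    simp only [h2]
    rw [Finset.prod_univ_sum, Fintype.piFinset_univ]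
    refine Finset.sum_congr rfl fun c _ => ?_
    rw [Finset.prod_ite_zero]
    simp only [Finset.mem_univ, true_imp_iff, Finset.prod_const_one, funext_iff, eq_comm]
  have h3 : ∀ p : Fin k → ℤ × I, (∑ᶠ (_ : Function.Injective p), (∏ i, (jumps T (p i) : ℝ)) * f p) =
      ∑ c : Fin k → lam.cells, if p = fun i => point T.1 (c i) then
        (if Function.Injective p then f p else 0) else 0 := by
    intro p
    rw [h1]
    by_cases hp : Function.Injective p
    · simp only [hp, finsum_true, if_true, Finset.sum_mul, ite_mul, one_mul, zero_mul]
    · simp [hp]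
  rw [distinctSum, finsum_congr h3, finsum_sum_comm, Finset.sum_filter]
  · refine Finset.sum_congr rfl fun c _ => ?_
    rw [finsum_eq_single _ (fun i => point T.1 (c i)) fun p hp => if_neg hp, if_pos rfl]
    exact if_congr ((point_injective hT).of_comp_iff c) rfl rfl
  · intro c _
    exact (finite_singleton fun i => point T.1 (c i)).subset fun p hp => by
      by_contra h
      exact hp (if_neg h)

/-- The sum of the laws of the tuples of points, before normalization. -/
noncomputable def pointMeasure (lam : YoungDiagram) (k : ℕ) : Measure (Fin k → ℤ × I) :=
  open Classical in
  ∑ c : Fin k → lam.cells with Function.Injective c,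
    (volume.restrict (tableaux lam)).map fun T i => point T (c i)

lemma measurable_points {lam : YoungDiagram} {k : ℕ} (c : Fin k → lam.cells) :
    Measurable fun (T : lam.cells → I) i => point T (c i) :=
  measurable_pi_lambda _ fun i => measurable_point (c i)

instance (lam : YoungDiagram) (k : ℕ) : IsFiniteMeasure (pointMeasure lam k) := by
  unfold pointMeasure
  infer_instance

lemma pointMeasure_eq {n k : ℕ} {lam : YoungDiagram} (hn : lam.colLen 0 ≤ n) :
    pointMeasure lam k =
      (Measure.pi fun _ : Fin k => refMeasure).withDensity (jumpDensity n lam 1) := by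
  classical
  ext A hA
  have h := lintegral_tableaux hn (k := k) (f := A.indicator 1) (measurable_one.indicator hA)
  have hm : ∀ c : Fin k → lam.cells, Measurable fun T : lam.cells → I =>
      (A.indicator 1 fun i => point T (c i) : ℝ≥0∞) := fun c =>
    (measurable_one.indicator hA).comp (measurable_points c)
  rw [lintegral_finsetSum _ fun c _ => hm c] at h
  rw [withDensity_apply _ hA, ← lintegral_indicator hA, pointMeasure, Measure.finsetSum_apply]
  refine Eq.trans ?_ (h.trans ?_)
  · refine Finset.sum_congr rfl fun c _ => ?_
    rw [← lintegral_indicator_one hA, lintegral_map (measurable_one.indicator hA) (measurable_points c)]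
  · refine lintegral_congr fun p => ?_
    by_cases hp : p ∈ A <;> simp [hp]

lemma jumpDensity_ae_eq {n k : ℕ} {lam : YoungDiagram} (hn : lam.colLen 0 ≤ n) :
    (fun p => (jumpDensity n lam 1 p).toReal) =ᵐ[Measure.pi fun _ : Fin k => refMeasure]
      fun p => totalWeight n lam * (Matrix.of fun a b => realKernel lam n (p a) (p b)).det := by
  filter_upwards [ae_injective_times k] with p hp
  rw [totalWeight, ← jumpDet_eq_mul_det_realKernel lam p hp, jumpDensity,
    if_pos fun i => unitInterval.le_one', ENNReal.toReal_ofReal]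
  · rfl
  · exact jumpDet_nonneg lam hn p hp _ zero_le_one fun i => (p i).2.2.2

instance : IsFiniteMeasureOnCompacts (Measure.count : Measure ℤ) where
  lt_top_of_isCompact _ hK :=
    Measure.count_apply_lt_top.2 (isCompact_iff_finite.1 hK)

lemma regular_refMeasure : refMeasure.Regular := by
  unfold refMeasure
  infer_instance

/-- `pointMeasure` is finite, so a bounded f is integrable against it; its density transfers this to
the determinant side, and the total weight cancels against the normalization of the law. -/
theorem isDeterminantal_jumps {n : ℕ} {lam : YoungDiagram} (hn : lam.colLen 0 ≤ n) :
    IsDeterminantal (uniformTableau lam) jumps (realKernel lam n) refMeasure where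
  isPointProcess := isPointProcess_jumps lam
  simple := by
    filter_upwards [ae_injective_tableau lam] with T hT s
    rw [jumps_eq, Finset.card_le_one]
    intro a ha b hb
    exact point_injective hT ((Finset.mem_filter.1 ha).2.trans (Finset.mem_filter.1 hb).2.symm)
  radon := regular_refMeasure
  correlation k f hf hfs := by
    classical
    have := isProbabilityMeasure_uniformTableau lam
    obtain ⟨C, hC⟩ := hf.bounded_above_of_compact_support hfs
    have hpos := totalWeight_pos hn
    have hfm := hf.measurable
    have hf1 : Integrable f (pointMeasure lam k) :=
      Integrable.of_bound hfm.aestronglyMeasurable C (Eventually.of_forall hC)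
    have hdm : Measurable (jumpDensity (k := k) n lam 1) :=
      (measurable_jumpDensity n k lam).comp (measurable_const.prodMk measurable_id)
    have hdt : ∀ p : Fin k → ℤ × I, jumpDensity n lam 1 p < ∞ := fun p => by
      rw [jumpDensity]
      split_ifs <;> simp
    have hf2 := hf1
    rw [pointMeasure_eq hn, integrable_withDensity_iff_integrable_smul' hdm
      (Eventually.of_forall hdt)] at hf2
    have hae : (fun p => (jumpDensity n lam 1 p).toReal • f p) =ᵐ[Measure.pi fun _ : Fin k =>
        refMeasure] fun p => totalWeight n lam *
          ((Matrix.of fun a b => realKernel lam n (p a) (p b)).det * f p) := by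
      filter_upwards [jumpDensity_ae_eq hn] with p hp
      rw [hp, smul_eq_mul, mul_assoc]
    have hi1 : Integrable (fun p => totalWeight n lam *
        ((Matrix.of fun a b => realKernel lam n (p a) (p b)).det * f p))
        (Measure.pi fun _ : Fin k => refMeasure) := hf2.congr hae
    have hi2 : Integrable (fun p => (Matrix.of fun a b => realKernel lam n (p a) (p b)).det * f p)
        (Measure.pi fun _ : Fin k => refMeasure) :=
      (integrable_const_mul_iff (IsUnit.mk0 _ hpos.ne') _).1 hi1
    have hint : ∫ p, f p ∂(pointMeasure lam k) = totalWeight n lam *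
        ∫ p, (Matrix.of fun a b => realKernel lam n (p a) (p b)).det * f p
          ∂(Measure.pi fun _ : Fin k => refMeasure) := by
      rw [pointMeasure_eq hn, integral_withDensity_eq_integral_toReal_smul hdm
        (Eventually.of_forall hdt), integral_congr_ae hae, integral_const_mul]
    set S : (lam.cells → I) → ℝ := fun T =>
      ∑ c : Fin k → lam.cells with Function.Injective c, f fun i => point T (c i) with hS
    have hSae : (fun T => distinctSum (jumps T) k f) =ᵐ[uniformTableau lam] fun T => S T.1 := by
      filter_upwards [ae_injective_tableau lam] with T hT
      exact distinctSum_jumps hT f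
    have hterm : ∀ c : Fin k → lam.cells, Measurable fun T : lam.cells → I =>
        f fun i => point T (c i) := fun c => hfm.comp (measurable_points c)
    have hSint : Integrable (fun T : tableaux lam => S T.1) (uniformTableau lam) := by
      refine integrable_finsetSum _ fun c _ => ?_
      exact Integrable.of_bound ((hterm c).comp measurable_subtype_coe).aestronglyMeasurable C
        (Eventually.of_forall fun T => hC _)
    have hSval : ∫ T, S T.1 ∂(uniformTableau lam) =
        (totalWeight n lam)⁻¹ * ∫ p, f p ∂(pointMeasure lam k) := by
      rw [uniformTableau, integral_smul_measure, integral_subtype_comap (measurableSet_tableaux lam),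
        volume_tableaux hn, ENNReal.toReal_inv, ENNReal.toReal_ofReal hpos.le, smul_eq_mul, hS,
        integral_finsetSum, pointMeasure, integral_finsetSum_measure]
      · congr 1
        refine Finset.sum_congr rfl fun c _ => ?_
        rw [integral_map (measurable_points c).aemeasurable hfm.aestronglyMeasurable]
      · intro c _
        exact Integrable.of_bound hfm.aestronglyMeasurable C (Eventually.of_forall hC)
      · intro c _
        exact Integrable.of_bound (hterm c).aestronglyMeasurable C
          (Eventually.of_forall fun T => hC _)
    refine ⟨hSint.congr hSae.symm, hi2, ?_⟩
    rw [integral_congr_ae hSae, hSval, hint, inv_mul_cancel_left₀ hpos.ne']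

end PYT

theorem theorem1p3 (lam : YoungDiagram) (n : ℕ) (hn : lam.colLen 0 ≤ n) :
    -- the two expressions for `G_λ` agree
    (∀ u : ℂ, (∀ k : ℤ, u ≠ (k : ℂ)) → ∃ Q : ℂ,
      HasProd (fun i : ℕ => (u + ((i : ℂ) + 1)) / (u - (lam.rowLen i : ℂ) + ((i : ℂ) + 1))) Q ∧
      PYT.G lam n u = Complex.Gamma (u + 1) * Q) ∧
    -- contours as required exist
    (∀ x₁ x₂ : ℤ, ∃ Cz Cw : PYT.Contour, PYT.Admissible lam n x₁ x₂ Cz Cw) ∧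
    -- for any choice of such contours
    ∀ Cz Cw : ℤ → ℤ → PYT.Contour,
      (∀ x₁ x₂ : ℤ, PYT.Admissible lam n x₁ x₂ (Cz x₁ x₂) (Cw x₁ x₂)) →
      -- the limits defining the kernel at `t₁ = 1` or `t₂ = 1` exist
      (∀ (x₁ x₂ : ℤ) (t₁ t₂ : unitInterval),
        Filter.Tendsto
          (fun p : ℝ × ℝ => PYT.doubleIntegral lam n (Cz x₁ x₂) (Cw x₁ x₂) x₁ p.1 x₂ p.2)
          (nhdsWithin ((t₁ : ℝ), (t₂ : ℝ)) (Set.Ico (0 : ℝ) 1 ×ˢ Set.Ico (0 : ℝ) 1))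
          (nhds (PYT.doubleIntegralExt lam n (Cz x₁ x₂) (Cw x₁ x₂) x₁ t₁ x₂ t₂))) ∧
      -- the kernel is real
      (∀ p q : ℤ × unitInterval, (PYT.kernel lam n Cz Cw p q).im = 0) ∧
      -- the jumps of a uniformly random tableau are determinantal with this kernel
      PYT.IsDeterminantal (PYT.uniformTableau lam) PYT.jumps
        (fun p q => (PYT.kernel lam n Cz Cw p q).re)
        ((MeasureTheory.Measure.count : MeasureTheory.Measure ℤ).prod
          (MeasureTheory.volume : MeasureTheory.Measure unitInterval)) := by
  refine ⟨fun u hu => PYT.exists_hasProd_G hn hu, PYT.exists_admissible lam n,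
    fun Cz Cw hadm => ⟨fun x₁ x₂ t₁ t₂ => ?_, fun p q => ?_, ?_⟩⟩
  · rw [PYT.doubleIntegralExt_eq (hadm x₁ x₂) t₁ t₂]
    exact PYT.tendsto_doubleIntegral (hadm x₁ x₂) t₁ t₂
  · rw [PYT.kernel_eq (hadm p.1 q.1)]
    exact Complex.ofReal_im _
  · have hK : (fun p q => (PYT.kernel lam n Cz Cw p q).re) = PYT.realKernel lam n := by
      funext p q
      rw [PYT.kernel_eq (hadm p.1 q.1), Complex.ofReal_re]
    rw [hK]
    exact PYT.isDeterminantal_jumps hn
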